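/- For $t,s>0$ with $t+s>1$ let $\Sigma_t^s(\mathbf R)$ be the space of all $f\in C^\infty(\mathbf R)$ such that for every $h>0$ $$\|f\|_{h}=\sup_{a,b\in\mathbf N,\ x\in\mathbf R}\frac{|x^aD^bf(x)|}{h^{a+b}\,a!^t\,b!^s}<\infty ,$$ with the topology given by these norms, and let $(\Sigma_t^s)'(\mathbf R)$ be its topological dual, acting conjugate linearly and written $(u,\varphi)$; a bounded continuous function $u$ acts by $(u,\varphi)=\int u\,\overline{\varphi}\,dx$. For $\psi\in\Sigma_t^s(\mathbf R)\setminus 0$ and $u\in(\Sigma_t^s)'(\mathbf R)$ put $$V_\psi u(x,\xi)=(2\pi)^{-1/2}\bigl(u,\,e^{i\xi\,\cdot}\,\psi(\cdot-x)\bigr),\qquad x,\xi\in\mathbf R .$$ The wave front set $\mathrm{WF}^{t,s}(u)\subseteq\mathbf R^2\setminus 0$ is defined as follows: $(x_0,\xi_0)\in\mathbf R^2\setminus0$ is not in $\mathrm{WF}^{t,s}(u)$ if there is an open set $U\subseteq\mathbf R^2\setminus 0$ containing $(x_0,\xi_0)$ such that $$\sup_{\lambda>0,\ (x,\xi)\in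 U}e^{r\lambda}\,|V_\psi u(\lambda^tx,\lambda^s\xi)|<\infty\qquad\text{for all } r>0 .$$ **Theorem.** Let $c\in\mathbf R\setminus 0$. The following holds for every choice of the window $\psi\in\Sigma_t^s(\mathbf R)\setminus0$, where $s=t(m-1)$ in (i) and $s=t(\alpha-1)$ in (ii). (i) If $m\ge 2$ is an integer, $u(x)=e^{icx^m}$ and $t>\frac1{m-1}$, then $$\mathrm{WF}^{t,t(m-1)}(u)=\{(x,cmx^{m-1})\in\mathbf R^2:\ x\neq0\}.$$ (ii) If $\alpha>1$ is a real number that is not an even integer, $u(x)=e^{ic|x|^\alpha}$ and $t>\frac1{\alpha-1}$, then $$\{0\}\times(\mathbf R\setminus0)\subseteq\mathrm{WF}^{t,t(\alpha-1)}(u)\subseteq\{(x,c\alpha\operatorname{sgn}(x)|x|^{\alpha-1})\in\mathbf R^2:\ x\neq0\}\cup\{0\}\times(\mathbf R\setminus0).$$ -/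

import Mathlib

noncomputable section

namespace GelfandShilov

open MeasureTheory
open scoped ContDiff Nat BoundedContinuousFunction

/-! ### The Beurling type Gelfand–Shilov space on the real line -/

/-- The quotient `|x ^ a * D ^ b f (x)| / (h ^ (a + b) * a! ^ t * b! ^ s)`,
indexed by `p = (a, b, x)`. -/
def ratio (t s h : ℝ) (f : ℝ → ℂ) (p : ℕ × ℕ × ℝ) : ℝ :=
  ‖((p.2.2 : ℝ) : ℂ) ^ p.1 * iteratedDeriv p.2.1 f p.2.2‖ /
    (h ^ (p.1 + p.2.1) * (p.1 ! : ℝ) ^ t * (p.2.1 ! : ℝ) ^ s)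

/-- The norm of `𝓢_{t,h}^s(ℝ)`: the supremum of `ratio` over all `a`, `b` and `x`. -/
def gsNorm (t s h : ℝ) (f : ℝ → ℂ) : ℝ := ⨆ p : ℕ × ℕ × ℝ, ratio t s h f p

theorem weight_pos (t s : ℝ) {h : ℝ} (hh : 0 < h) (a b : ℕ) :
    0 < h ^ (a + b) * (a ! : ℝ) ^ t * (b ! : ℝ) ^ s := by
  have := Nat.factorial_pos a
  have := Nat.factorial_pos b
  positivity

theorem bddAbove_ratio_iff (t s : ℝ) {h : ℝ} (hh : 0 < h) (f : ℝ → ℂ) :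
    BddAbove (Set.range (ratio t s h f)) ↔ ∃ C : ℝ, 0 ≤ C ∧ ∀ (a b : ℕ) (x : ℝ),
      |x| ^ a * ‖iteratedDeriv b f x‖ ≤ C * (h ^ (a + b) * (a ! : ℝ) ^ t * (b ! : ℝ) ^ s) := by
  constructor
  · rintro ⟨C, hC⟩
    refine ⟨C, ?_, fun a b x => ?_⟩
    · refine le_trans ?_ (hC ⟨(0, 0, 0), rfl⟩)
      exact div_nonneg (norm_nonneg _) (weight_pos t s hh 0 0).le
    · have := hC ⟨(a, b, x), rfl⟩
      rw [ratio, div_le_iff₀ (weight_pos t s hh a b)] at this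
      simpa using this
  · rintro ⟨C, -, hC⟩
    refine ⟨C, ?_⟩
    rintro _ ⟨⟨a, b, x⟩, rfl⟩
    rw [ratio, div_le_iff₀ (weight_pos t s hh a b)]
    simpa using hC a b x

/-- `Σ_t^s(ℝ) = ⋂_{h > 0} 𝓢_{t,h}^s(ℝ)`: the smooth functions all of whose norms `gsNorm t s h`,
`h > 0`, are finite. -/
def Space (t s : ℝ) : Submodule ℂ (ℝ → ℂ) where
  carrier := {f | ContDiff ℝ ∞ f ∧ ∀ h : ℝ, 0 < h → BddAbove (Set.range (ratio t s h f))}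
  zero_mem' := by
    refine ⟨contDiff_const, fun h hh => ⟨0, ?_⟩⟩
    rintro _ ⟨⟨a, b, x⟩, rfl⟩
    have : iteratedDeriv b (0 : ℝ → ℂ) x = 0 := by
      rw [iteratedDeriv_eq_iteratedFDeriv]
      simp
    simp [ratio, this]
  add_mem' := by
    rintro f g ⟨hf, hf'⟩ ⟨hg, hg'⟩
    refine ⟨hf.add hg, fun h hh => ?_⟩
    obtain ⟨C, hC0, hC⟩ := (bddAbove_ratio_iff t s hh f).1 (hf' h hh)
    obtain ⟨D, hD0, hD⟩ := (bddAbove_ratio_iff t s hh g).1 (hg' h hh)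
    refine (bddAbove_ratio_iff t s hh _).2 ⟨C + D, by positivity, fun a b x => ?_⟩
    rw [iteratedDeriv_add (hf.contDiffAt.of_le (by exact_mod_cast le_top))
      (hg.contDiffAt.of_le (by exact_mod_cast le_top))]
    calc |x| ^ a * ‖iteratedDeriv b f x + iteratedDeriv b g x‖
        ≤ |x| ^ a * (‖iteratedDeriv b f x‖ + ‖iteratedDeriv b g x‖) := by
          gcongr; exact norm_add_le _ _
      _ ≤ _ := by rw [mul_add, add_mul]; exact add_le_add (hC a b x) (hD a b x)
  smul_mem' := by
    rintro c f ⟨hf, hf'⟩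
    refine ⟨contDiff_const.smul hf, fun h hh => ?_⟩
    obtain ⟨C, hC0, hC⟩ := (bddAbove_ratio_iff t s hh f).1 (hf' h hh)
    refine (bddAbove_ratio_iff t s hh _).2 ⟨‖c‖ * C, by positivity, fun a b x => ?_⟩
    rw [iteratedDeriv_const_smul (hf.contDiffAt.of_le (by exact_mod_cast le_top)), norm_smul,
      mul_left_comm, mul_assoc]
    exact mul_le_mul_of_nonneg_left (hC a b x) (norm_nonneg c)

/-! ### Translations and modulations act on the space -/

theorem exists_pow_le (A h s : ℝ) (hA : 0 ≤ A) (hh : 0 < h) (hs : 0 < s) :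
    ∃ K : ℝ, 0 ≤ K ∧ ∀ i : ℕ, A ^ i ≤ K * (h ^ i * (i ! : ℝ) ^ s) := by
  have hB : 0 ≤ A / h := by positivity
  refine ⟨Real.exp ((A / h) ^ s⁻¹) ^ s, by positivity, fun i => ?_⟩
  have h1 := Real.pow_div_factorial_le_exp (x := (A / h) ^ s⁻¹) (by positivity) i
  have hi : (0 : ℝ) < i ! := by exact_mod_cast Nat.factorial_pos i
  rw [div_le_iff₀ hi] at h1
  have h2 := Real.rpow_le_rpow (by positivity) h1 hs.le
  rw [Real.mul_rpow (by positivity) hi.le, ← Real.rpow_natCast, ← Real.rpow_mul hB,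
    ← Real.rpow_mul hB, mul_right_comm, inv_mul_cancel₀ hs.ne', one_mul, Real.rpow_natCast,
    div_pow, div_le_iff₀ (by positivity)] at h2
  linarith

theorem factorial_rpow_mul_le (s : ℝ) (hs : 0 < s) {n i : ℕ} (hi : i ≤ n) :
    (i ! : ℝ) ^ s * ((n - i)! : ℝ) ^ s ≤ (n ! : ℝ) ^ s := by
  rw [← Real.mul_rpow (by positivity) (by positivity)]
  refine Real.rpow_le_rpow (by positivity) ?_ hs.le
  exact_mod_cast Nat.le_of_dvd (Nat.factorial_pos n) (Nat.factorial_mul_factorial_dvd_factorial hi)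

theorem sum_choose_le (s h K M : ℝ) (hs : 0 < s) (hh : 0 < h) (hK : 0 ≤ K) (hM : 0 ≤ M) (n : ℕ) :
    ∑ i ∈ Finset.range (n + 1), (n.choose i : ℝ) *
      ((K * ((h / 2) ^ i * (i ! : ℝ) ^ s)) * (M * ((h / 2) ^ (n - i) * ((n - i)! : ℝ) ^ s)))
      ≤ K * M * (h ^ n * (n ! : ℝ) ^ s) := by
  calc _ ≤ ∑ i ∈ Finset.range (n + 1), (n.choose i : ℝ) *
        (K * M * ((h / 2) ^ n * (n ! : ℝ) ^ s)) := by
        refine Finset.sum_le_sum fun i hi => ?_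
        have hin : i ≤ n := Nat.lt_succ_iff.1 (Finset.mem_range.1 hi)
        refine mul_le_mul_of_nonneg_left ?_ (Nat.cast_nonneg _)
        calc _ = K * M * ((h / 2) ^ i * (h / 2) ^ (n - i) *
              ((i ! : ℝ) ^ s * ((n - i)! : ℝ) ^ s)) := by ring
          _ ≤ _ := by
            rw [← pow_add, Nat.add_sub_cancel' hin]
            gcongr
            exact factorial_rpow_mul_le s hs hin
    _ = (2 ^ n : ℝ) * (K * M * ((h / 2) ^ n * (n ! : ℝ) ^ s)) := by
        rw [← Finset.sum_mul]
        congr 1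
        exact_mod_cast Nat.sum_range_choose n
    _ = _ := by rw [div_pow]; field_simp

theorem translation_mem {t s : ℝ} (ht : 0 < t) {f : ℝ → ℂ} (hf : f ∈ Space t s) (x : ℝ) :
    (fun y => f (y - x)) ∈ Space t s := by
  obtain ⟨hf1, hf2⟩ := hf
  refine ⟨hf1.comp (contDiff_id.sub contDiff_const), fun h hh => ?_⟩
  obtain ⟨C, hC0, hC⟩ := (bddAbove_ratio_iff t s (half_pos hh) f).1 (hf2 _ (half_pos hh))
  obtain ⟨K, hK0, hK⟩ := exists_pow_le |x| (h / 2) t (abs_nonneg x) (half_pos hh) ht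
  refine (bddAbove_ratio_iff t s hh _).2 ⟨K * C, by positivity, fun a b y => ?_⟩
  rw [iteratedDeriv_comp_sub_const]
  set z := y - x with hz
  set N := ‖iteratedDeriv b f z‖
  have hM : 0 ≤ C * ((h / 2) ^ b * (b ! : ℝ) ^ s) := by positivity
  have hy : |y| ≤ |x| + |z| := by
    calc |y| = |x + z| := by rw [hz]; congr 1; ring
      _ ≤ _ := abs_add_le _ _
  calc |y| ^ a * N ≤ (|x| + |z|) ^ a * N := by gcongr
    _ = ∑ i ∈ Finset.range (a + 1), (a.choose i : ℝ) * (|x| ^ i * (|z| ^ (a - i) * N)) := by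
        rw [add_pow, Finset.sum_mul]
        exact Finset.sum_congr rfl fun i _ => by ring
    _ ≤ ∑ i ∈ Finset.range (a + 1), (a.choose i : ℝ) * ((K * ((h / 2) ^ i * (i ! : ℝ) ^ t)) *
          ((C * ((h / 2) ^ b * (b ! : ℝ) ^ s)) * ((h / 2) ^ (a - i) * ((a - i)! : ℝ) ^ t))) := by
        refine Finset.sum_le_sum fun i _ => ?_
        refine mul_le_mul_of_nonneg_left (mul_le_mul (hK i) ?_ (by positivity) (by positivity))
          (Nat.cast_nonneg _)
        · refine (hC (a - i) b z).trans (le_of_eq ?_)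
          rw [pow_add]; ring
    _ ≤ K * (C * ((h / 2) ^ b * (b ! : ℝ) ^ s)) * (h ^ a * (a ! : ℝ) ^ t) :=
        sum_choose_le t h K _ ht hh hK0 hM a
    _ ≤ K * (C * (h ^ b * (b ! : ℝ) ^ s)) * (h ^ a * (a ! : ℝ) ^ t) := by
        gcongr; linarith
    _ = _ := by rw [pow_add]; ring

theorem contDiff_character (ξ : ℝ) :
    ContDiff ℝ ∞ (fun y : ℝ => Complex.exp (Complex.I * (y * ξ : ℝ))) :=
  (contDiff_const.mul (Complex.ofRealCLM.contDiff.comp (contDiff_id.mul contDiff_const))).cexp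

theorem iteratedDeriv_character (ξ : ℝ) (n : ℕ) :
    iteratedDeriv n (fun y : ℝ => Complex.exp (Complex.I * (y * ξ : ℝ))) =
      fun y : ℝ => (Complex.I * ξ) ^ n * Complex.exp (Complex.I * (y * ξ : ℝ)) := by
  induction n with
  | zero => simp
  | succ n ih =>
    rw [iteratedDeriv_succ, ih]
    funext y
    have h1 : HasDerivAt (fun y : ℝ => ((y * ξ : ℝ) : ℂ)) (ξ : ℂ) y := by
      simpa using ((hasDerivAt_id y).mul_const ξ).ofReal_comp
    have h2 := (((h1.const_mul Complex.I).cexp).const_mul ((Complex.I * ξ) ^ n)).deriv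
    rw [h2, pow_succ]
    ring

theorem modulation_mem {t s : ℝ} (hs : 0 < s) {f : ℝ → ℂ} (hf : f ∈ Space t s) (ξ : ℝ) :
    (fun y : ℝ => Complex.exp (Complex.I * (y * ξ : ℝ)) * f y) ∈ Space t s := by
  obtain ⟨hf1, hf2⟩ := hf
  refine ⟨(contDiff_character ξ).mul hf1, fun h hh => ?_⟩
  obtain ⟨C, hC0, hC⟩ := (bddAbove_ratio_iff t s (half_pos hh) f).1 (hf2 _ (half_pos hh))
  obtain ⟨K, hK0, hK⟩ := exists_pow_le |ξ| (h / 2) s (abs_nonneg ξ) (half_pos hh) hs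
  refine (bddAbove_ratio_iff t s hh _).2 ⟨K * C, by positivity, fun a b y => ?_⟩
  have hM : 0 ≤ C * ((h / 2) ^ a * (a ! : ℝ) ^ t) := by positivity
  rw [iteratedDeriv_fun_mul ((contDiff_character ξ).contDiffAt.of_le (by exact_mod_cast le_top))
    (hf1.contDiffAt.of_le (by exact_mod_cast le_top))]
  have hnorm : ∀ i : ℕ, ‖(b.choose i : ℂ) *
      iteratedDeriv i (fun y : ℝ => Complex.exp (Complex.I * (y * ξ : ℝ))) y *
      iteratedDeriv (b - i) f y‖ = (b.choose i : ℝ) * (|ξ| ^ i * ‖iteratedDeriv (b - i) f y‖) := by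
    intro i
    rw [iteratedDeriv_character, norm_mul, norm_mul, norm_mul, norm_pow, norm_mul,
      mul_comm Complex.I ((y * ξ : ℝ) : ℂ), Complex.norm_exp_ofReal_mul_I]
    simp [mul_assoc]
  calc _ ≤ |y| ^ a * ∑ i ∈ Finset.range (b + 1),
        (b.choose i : ℝ) * (|ξ| ^ i * ‖iteratedDeriv (b - i) f y‖) := by
        gcongr
        refine (norm_sum_le _ _).trans (le_of_eq (Finset.sum_congr rfl fun i _ => hnorm i))
    _ = ∑ i ∈ Finset.range (b + 1),
        (b.choose i : ℝ) * (|ξ| ^ i * (|y| ^ a * ‖iteratedDeriv (b - i) f y‖)) := by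
        rw [Finset.mul_sum]
        exact Finset.sum_congr rfl fun i _ => by ring
    _ ≤ ∑ i ∈ Finset.range (b + 1), (b.choose i : ℝ) * ((K * ((h / 2) ^ i * (i ! : ℝ) ^ s)) *
          ((C * ((h / 2) ^ a * (a ! : ℝ) ^ t)) * ((h / 2) ^ (b - i) * ((b - i)! : ℝ) ^ s))) := by
        refine Finset.sum_le_sum fun i _ => ?_
        refine mul_le_mul_of_nonneg_left (mul_le_mul (hK i) ?_ (by positivity) (by positivity))
          (Nat.cast_nonneg _)
        · refine (hC a (b - i) y).trans (le_of_eq ?_)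
          rw [pow_add]; ring
    _ ≤ K * (C * ((h / 2) ^ a * (a ! : ℝ) ^ t)) * (h ^ b * (b ! : ℝ) ^ s) :=
        sum_choose_le s h K _ hs hh hK0 hM b
    _ ≤ K * (C * (h ^ a * (a ! : ℝ) ^ t)) * (h ^ b * (b ! : ℝ) ^ s) := by
        gcongr; linarith
    _ = _ := by rw [pow_add]; ring

/-- The time-frequency shift `M_ξ T_x ψ (y) = e^{i y ξ} ψ(y - x)`. -/
def shift {t s : ℝ} (ht : 0 < t) (hs : 0 < s) (x ξ : ℝ) (ψ : Space t s) : Space t s :=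
  ⟨fun y : ℝ => Complex.exp (Complex.I * (y * ξ : ℝ)) * (ψ : ℝ → ℂ) (y - x),
    modulation_mem hs (translation_mem ht ψ.2 x) ξ⟩

/-! ### Ultradistributions -/

/-- The topological dual `(Σ_t^s)'(ℝ)`: conjugate linear functionals on `Σ_t^s(ℝ)` that are
continuous. The norms `gsNorm t s h` define the topology and are decreasing in `h`, so continuity
means boundedness with respect to one of them. -/
structure Ultradistribution (t s : ℝ) where
  /-- the conjugate linear action `g ↦ (u, g)` -/
  pairing : Space t s →ₛₗ[starRingEnd ℂ] ℂ
  continuous' : ∃ h : ℝ, 0 < h ∧ ∃ C : ℝ, ∀ g : Space t s,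
    ‖pairing g‖ ≤ C * gsNorm t s h (g : ℝ → ℂ)

theorem one_add_sq_mul_norm_le {t s : ℝ} (g : Space t s) (x : ℝ) :
    (1 + x ^ 2) * ‖(g : ℝ → ℂ) x‖ ≤ (1 + 2 ^ t) * gsNorm t s 1 (g : ℝ → ℂ) := by
  have hb := g.2.2 1 one_pos
  have h0 := le_ciSup hb (0, 0, x)
  have h2 := le_ciSup hb (2, 0, x)
  have e0 : ratio t s 1 (g : ℝ → ℂ) (0, 0, x) = ‖(g : ℝ → ℂ) x‖ := by simp [ratio]
  have e2 : ratio t s 1 (g : ℝ → ℂ) (2, 0, x) = x ^ 2 * ‖(g : ℝ → ℂ) x‖ / 2 ^ t := by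
    simp [ratio]
  rw [e0] at h0
  rw [e2, div_le_iff₀ (by positivity)] at h2
  change ‖(g : ℝ → ℂ) x‖ ≤ gsNorm t s 1 (g : ℝ → ℂ) at h0
  change _ ≤ gsNorm t s 1 (g : ℝ → ℂ) * _ at h2
  linarith

theorem norm_le_inv {t s : ℝ} (g : Space t s) (x : ℝ) :
    ‖(g : ℝ → ℂ) x‖ ≤ (1 + 2 ^ t) * gsNorm t s 1 (g : ℝ → ℂ) * (1 + x ^ 2)⁻¹ := by
  rw [← div_eq_mul_inv, le_div_iff₀ (by positivity), mul_comm]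
  exact one_add_sq_mul_norm_le g x

theorem norm_pair_le {t s : ℝ} (u : ℝ →ᵇ ℂ) (g : Space t s) (x : ℝ) :
    ‖u x * (starRingEnd ℂ) ((g : ℝ → ℂ) x)‖ ≤
      ‖u‖ * ((1 + 2 ^ t) * gsNorm t s 1 (g : ℝ → ℂ)) * (1 + x ^ 2)⁻¹ := by
  rw [norm_mul, RCLike.norm_conj, mul_assoc]
  exact mul_le_mul (u.norm_coe_le_norm x) (norm_le_inv g x) (norm_nonneg _) (norm_nonneg _)

theorem integrable_pair {t s : ℝ} (u : ℝ →ᵇ ℂ) (g : Space t s) :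
    Integrable (fun y : ℝ => u y * (starRingEnd ℂ) ((g : ℝ → ℂ) y)) := by
  refine (integrable_inv_one_add_sq.const_mul
    (‖u‖ * ((1 + 2 ^ t) * gsNorm t s 1 (g : ℝ → ℂ)))).mono' ?_
    (Filter.Eventually.of_forall fun x => norm_pair_le u g x)
  exact (u.continuous.mul (Complex.continuous_conj.comp g.2.1.continuous)).aestronglyMeasurable

/-- A bounded continuous function `u` as an ultradistribution, consistently with the `L²` inner
product: `(u, g) = ∫ u(y) conj(g(y)) dy`. -/
def ofFunction (t s : ℝ) (u : ℝ →ᵇ ℂ) : Ultradistribution t s where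
  pairing :=
    { toFun := fun g => ∫ y : ℝ, u y * (starRingEnd ℂ) ((g : ℝ → ℂ) y)
      map_add' := fun g k => by
        rw [← integral_add (integrable_pair u g) (integrable_pair u k)]
        refine integral_congr_ae (Filter.Eventually.of_forall fun y => ?_)
        simp [mul_add]
      map_smul' := fun c g => by
        rw [smul_eq_mul, ← integral_const_mul]
        refine integral_congr_ae (Filter.Eventually.of_forall fun y => ?_)
        simp [mul_left_comm] }
  continuous' := by
    refine ⟨1, one_pos, ‖u‖ * (1 + 2 ^ t) * ∫ x : ℝ, (1 + x ^ 2)⁻¹, fun g => ?_⟩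
    calc _ ≤ ∫ x : ℝ, ‖u‖ * ((1 + 2 ^ t) * gsNorm t s 1 (g : ℝ → ℂ)) * (1 + x ^ 2)⁻¹ :=
          norm_integral_le_of_norm_le (integrable_inv_one_add_sq.const_mul _)
            (Filter.Eventually.of_forall fun x => norm_pair_le u g x)
      _ = _ := by rw [integral_const_mul]; ring

/-! ### The short-time Fourier transform and the wave front set -/

/-- The short-time Fourier transform `V_ψ u (x, ξ) = (2π)^{-1/2} (u, M_ξ T_x ψ)`. -/
def stft {t s : ℝ} (ht : 0 < t) (hs : 0 < s) (ψ : Space t s) (u : Ultradistribution t s)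
    (x ξ : ℝ) : ℂ :=
  (((2 * Real.pi) ^ (-(1 / 2) : ℝ) : ℝ) : ℂ) * u.pairing (shift ht hs x ξ ψ)

/-- The `t,s`-Gelfand–Shilov wave front set, computed with the window `ψ`: a point `z ≠ 0` of the
phase space is outside it when, for some open `U ∌ 0` around `z` and all `r > 0`, the supremum of
`e^{r μ} |V_ψ u (μ^t x, μ^s ξ)|` over `μ > 0` and `(x, ξ) ∈ U` is finite. -/
def waveFrontSet {t s : ℝ} (ht : 0 < t) (hs : 0 < s) (ψ : Space t s)
    (u : Ultradistribution t s) : Set (ℝ × ℝ) :=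
  {z | z ≠ 0 ∧ ¬ ∃ U : Set (ℝ × ℝ), IsOpen U ∧ (0 : ℝ × ℝ) ∉ U ∧ z ∈ U ∧
    ∀ r : ℝ, 0 < r → ∃ C : ℝ, ∀ μ : ℝ, 0 < μ → ∀ p ∈ U,
      Real.exp (r * μ) * ‖stft ht hs ψ u (μ ^ t * p.1) (μ ^ s * p.2)‖ ≤ C}

/-! ### Chirps -/

/-- `x ↦ e^{i θ(x)}` for a continuous real phase `θ`. -/
def oscillation (θ : ℝ → ℝ) (hθ : Continuous θ) : ℝ →ᵇ ℂ :=
  BoundedContinuousFunction.ofNormedAddCommGroup (fun x : ℝ => Complex.exp (Complex.I * (θ x : ℂ)))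
    (Complex.continuous_exp.comp
      (continuous_const.mul (Complex.continuous_ofReal.comp hθ))) 1
    (fun x => by rw [mul_comm, Complex.norm_exp_ofReal_mul_I])

/-- `u(x) = e^{i c x^m}`. -/
def monomialChirp (c : ℝ) (m : ℕ) : ℝ →ᵇ ℂ :=
  oscillation (fun x => c * x ^ m) (by fun_prop)

/-- `u(x) = e^{i c |x|^α}` with `α ≥ 0`. -/
def powerChirp (c α : ℝ) (hα : 0 ≤ α) : ℝ →ᵇ ℂ :=
  oscillation (fun x => c * |x| ^ α)
    (continuous_const.mul (continuous_abs.rpow_const fun _ => Or.inr hα))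

/-! ### Positivity of the indices `t` and `s = t (β - 1)` -/

theorem index_pos {β t : ℝ} (hβ : 1 < β) (ht : 1 / (β - 1) < t) : 0 < t :=
  (one_div_pos.2 (sub_pos.2 hβ)).trans ht

theorem index_mul_pos {β t : ℝ} (hβ : 1 < β) (ht : 1 / (β - 1) < t) : 0 < t * (β - 1) :=
  mul_pos (index_pos hβ ht) (sub_pos.2 hβ)

end GelfandShilov

end

/-! Let `θ` be the phase of `u` and `f = θ'`. In both cases `f (μ ^ t * v) = μ ^ s * f v` for `μ >
0`, so the curves `μ ↦ (μ ^ t x, μ ^ s ξ)` preserve the graph of `f`. Off this graph the phase is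
not stationary, which gives the upper bounds; the lower bounds come from showing that decay at a
singular point would force the window to vanish.

Upper bounds (`decaysNear_of_ne`). After `y = μ ^ t * w` the phase in the transform at `(μ ^ t x, μ
^ s ξ)` has derivative `μ ^ (s + t) * (f (x + w) - ξ)`. If `f x₀ ≠ ξ₀`, this is bounded away from
zero for small `w` and `(x, ξ)` near `(x₀, ξ₀)`, and one integrates by parts about `μ` times.
Weighted jet norms count the derivatives: the Cauchy bounds on `f` control the reciprocal of `f (x +
w) - ξ`, while the window may grow like `h ^ j * (j !) ^ s` with `h` as small as desired, so `N ≤ μ`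
steps gain `exp (-r * N)` for arbitrary `r`. Boundary terms and the part away from `w = 0` are small
because the window decays faster than every `exp (-r * |y| ^ t⁻¹)`.

Lower bound in (i) (`eq_zero_of_decaysNear`). If a point of the curve over `x₀ ≠ 0` were regular,
then all of `{x₀} × ℝ` would be, and so would `(0, ±1)`. Compactness and homogeneity then bound the
transform on the line over `μ ^ t * x₀` by `exp (-μ)` times an integrable function. On such a line
the transform is a Fourier transform of `u` times a translated conjugate window, and `|u| = 1`;
inversion and `μ → ∞` give `ψ = 0`.

Lower bound in (ii) (`not_decaysNear_powerChirp`). Regularity of `(0, ξ₀)` makes the Fourier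
transform of `u` times every translated conjugate window decay rapidly on the half line of the sign
of `ξ₀`. The same is true with `1` in place of `u`, hence for `g * (u - 1)`, which behaves like `i c
g(0) |y| ^ α` at the origin. Testing against the dilates of `(1 + i y) ^ (-(n + 1))`, whose spectrum
lies on one half line, shows that one-sided decay is incompatible with such a singularity unless `g
0 = 0`: the decisive constant is `2 cos ((α + 1) π / 2)` times a positive number, nonzero because
`α` is not an even integer. Every value of the window occurs as a conjugate of some `g 0`, so `ψ =
0`. -/

noncomputable section

namespace GelfandShilov

open MeasureTheory
open scoped ContDiff Nat BoundedContinuousFunction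

/-! ### Weighted norms of jets -/

/-- The weighted `ℓ¹` norm `∑_{j ≤ n} ρ ^ j / j! * ‖f⁽ʲ⁾(y)‖` of the `n`-jet of `f` at `y`. -/
def jetNorm (n : ℕ) (ρ : ℝ) (f : ℝ → ℂ) (y : ℝ) : ℝ :=
  ∑ j ∈ Finset.range (n + 1), ρ ^ j / j ! * ‖iteratedDeriv j f y‖

theorem jetNorm_nonneg (n : ℕ) {ρ : ℝ} (hρ : 0 ≤ ρ) (f : ℝ → ℂ) (y : ℝ) : 0 ≤ jetNorm n ρ f y :=
  Finset.sum_nonneg fun j _ => by positivity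

theorem jetNorm_zero_order (ρ : ℝ) (f : ℝ → ℂ) (y : ℝ) : jetNorm 0 ρ f y = ‖f y‖ := by
  simp [jetNorm]

theorem norm_le_jetNorm (n : ℕ) {ρ : ℝ} (hρ : 0 ≤ ρ) (f : ℝ → ℂ) (y : ℝ) :
    ‖f y‖ ≤ jetNorm n ρ f y := by
  have := Finset.single_le_sum (f := fun j => ρ ^ j / (j ! : ℝ) * ‖iteratedDeriv j f y‖)
    (fun j _ => by positivity) (Finset.mem_range.2 (Nat.succ_pos n))
  simpa [jetNorm] using this

theorem jetNorm_mono (n : ℕ) {ρ' ρ : ℝ} (h0 : 0 ≤ ρ') (h : ρ' ≤ ρ) (f : ℝ → ℂ) (y : ℝ) :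
    jetNorm n ρ' f y ≤ jetNorm n ρ f y :=
  Finset.sum_le_sum fun j _ => by gcongr

theorem jetNorm_congr (n : ℕ) (ρ : ℝ) {f g : ℝ → ℂ} {y : ℝ} (h : f =ᶠ[nhds y] g) :
    jetNorm n ρ f y = jetNorm n ρ g y :=
  Finset.sum_congr rfl fun j _ => by rw [h.iteratedDeriv_eq]

theorem jetNorm_const_mul (n : ℕ) (ρ : ℝ) (c : ℂ) (f : ℝ → ℂ) (y : ℝ) :
    jetNorm n ρ (fun w => c * f w) y = ‖c‖ * jetNorm n ρ f y := by
  rw [jetNorm, jetNorm, Finset.mul_sum]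
  refine Finset.sum_congr rfl fun j _ => ?_
  rw [iteratedDeriv_const_mul_field, norm_mul]
  ring

theorem jetNorm_const_sub_le (n : ℕ) (ρ : ℝ) (c : ℂ) (f : ℝ → ℂ) (y : ℝ) :
    jetNorm n ρ (fun w => c - f w) y ≤ ‖c‖ + jetNorm n ρ f y := by
  rw [jetNorm, jetNorm, Finset.sum_range_succ', Finset.sum_range_succ' _ n]
  have h0 : ‖c - f y‖ ≤ ‖c‖ + ‖f y‖ := norm_sub_le _ _
  have h1 : ∀ j : ℕ, iteratedDeriv (j + 1) (fun w => c - f w) y = -iteratedDeriv (j + 1) f y := by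
    intro j
    rw [iteratedDeriv_const_sub (Nat.succ_pos j) c, iteratedDeriv_neg]
  simp only [h1, norm_neg]
  simp only [iteratedDeriv_zero, pow_zero, Nat.factorial_zero, Nat.cast_one, div_one, one_mul]
  linarith

/-- The weights `1 / j !` absorb the binomial coefficients of the Leibniz rule, leaving a truncated
Cauchy product of nonnegative terms. -/
theorem jetNorm_mul_le {n : ℕ} {ρ : ℝ} (hρ : 0 ≤ ρ) {f g : ℝ → ℂ} {y : ℝ}
    (hf : ContDiffAt ℝ n f y) (hg : ContDiffAt ℝ n g y) :
    jetNorm n ρ (fun w => f w * g w) y ≤ jetNorm n ρ f y * jetNorm n ρ g y := by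
  set A : ℕ → ℝ := fun j => ρ ^ j / j ! * ‖iteratedDeriv j f y‖ with hA
  set B : ℕ → ℝ := fun j => ρ ^ j / j ! * ‖iteratedDeriv j g y‖ with hB
  have hA0 : ∀ j, 0 ≤ A j := fun j => by positivity
  have hB0 : ∀ j, 0 ≤ B j := fun j => by positivity
  calc jetNorm n ρ (fun w => f w * g w) y
      ≤ ∑ j ∈ Finset.range (n + 1), ∑ i ∈ Finset.range (j + 1), A i * B (j - i) := by
        refine Finset.sum_le_sum fun j hj => ?_
        have hjn : (j : WithTop ℕ∞) ≤ n := by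
          exact_mod_cast Nat.lt_succ_iff.1 (Finset.mem_range.1 hj)
        rw [iteratedDeriv_fun_mul (hf.of_le hjn) (hg.of_le hjn)]
        refine (mul_le_mul_of_nonneg_left (norm_sum_le _ _) (by positivity)).trans (le_of_eq ?_)
        rw [Finset.mul_sum]
        refine Finset.sum_congr rfl fun i hi => ?_
        have hij : i ≤ j := Nat.lt_succ_iff.1 (Finset.mem_range.1 hi)
        have e1 : (j ! : ℝ) = j.choose i * i ! * (j - i)! := by
          exact_mod_cast (Nat.choose_mul_factorial_mul_factorial hij).symm
        have e2 : ρ ^ j = ρ ^ i * ρ ^ (j - i) := by rw [← pow_add, Nat.add_sub_cancel' hij]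
        have hc : (j.choose i : ℝ) ≠ 0 := by exact_mod_cast (Nat.choose_pos hij).ne'
        simp only [hA, hB, norm_mul, e1, e2, RCLike.norm_natCast]
        field_simp
    _ = ∑ i ∈ Finset.range (n + 1), ∑ k ∈ Finset.range (n + 1 - i), A i * B k :=
        Finset.sum_range_diag_flip (n + 1) fun i k => A i * B k
    _ ≤ ∑ i ∈ Finset.range (n + 1), ∑ k ∈ Finset.range (n + 1), A i * B k := by
        refine Finset.sum_le_sum fun i _ => ?_
        refine Finset.sum_le_sum_of_subset_of_nonneg ?_ fun k _ _ => mul_nonneg (hA0 i) (hB0 k)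
        exact Finset.range_mono (Nat.sub_le _ _)
    _ = _ := by rw [← Finset.sum_mul_sum]; rfl

theorem succ_mul_pow_mul_sub_le {ρ' ρ : ℝ} (h0 : 0 ≤ ρ') (h : ρ' ≤ ρ) (j : ℕ) :
    ((j : ℝ) + 1) * ρ' ^ j * (ρ - ρ') + ρ' ^ (j + 1) ≤ ρ ^ (j + 1) := by
  induction j with
  | zero => simp
  | succ j ih =>
    have h1 : 0 ≤ ((j : ℝ) + 1) * ρ' ^ j * (ρ - ρ') :=
      mul_nonneg (by positivity) (sub_nonneg.2 h)
    have h2 : ρ * (((j : ℝ) + 1) * ρ' ^ j * (ρ - ρ') + ρ' ^ (j + 1)) ≤ ρ * ρ ^ (j + 1) :=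
      mul_le_mul_of_nonneg_left ih (h0.trans h)
    have h3 := mul_le_mul_of_nonneg_right h h1
    have e : ρ ^ (j + 1 + 1) = ρ * ρ ^ (j + 1) := by ring
    rw [e]
    refine le_trans (le_of_eq ?_) (le_trans (add_le_add_left h3 (ρ * ρ' ^ (j + 1))) ?_)
    · push_cast; ring
    · linarith

/-- A Cauchy estimate: a derivative is paid for by shrinking the radius, since `(j + 1) * ρ' ^ j *
(ρ - ρ') ≤ ρ ^ (j + 1)`. -/
theorem jetNorm_deriv_le (n : ℕ) {ρ' ρ : ℝ} (h0 : 0 ≤ ρ') (h : ρ' < ρ) (f : ℝ → ℂ) (y : ℝ) :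
    jetNorm n ρ' (deriv f) y ≤ (ρ - ρ')⁻¹ * jetNorm (n + 1) ρ f y := by
  have hd : 0 < ρ - ρ' := sub_pos.2 h
  have hρ : 0 < ρ := h0.trans_lt h
  rw [jetNorm, jetNorm, Finset.sum_range_succ' _ (n + 1), mul_add, Finset.mul_sum]
  refine le_add_of_le_of_nonneg (Finset.sum_le_sum fun j _ => ?_) (by positivity)
  rw [← iteratedDeriv_succ', ← mul_assoc]
  refine mul_le_mul_of_nonneg_right ?_ (norm_nonneg _)
  rw [← div_eq_inv_mul, le_div_iff₀ hd, Nat.factorial_succ, Nat.cast_mul, div_mul_eq_mul_div,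
    div_le_div_iff₀ (by positivity) (by positivity)]
  have h1 := succ_mul_pow_mul_sub_le h0 h.le j
  have h2 : ((j : ℝ) + 1) * ρ' ^ j * (ρ - ρ') ≤ ρ ^ (j + 1) :=
    (le_add_of_nonneg_right (by positivity)).trans h1
  have h3 := mul_le_mul_of_nonneg_right h2 (Nat.cast_nonneg (α := ℝ) j !)
  push_cast
  linarith

/-- Take jet norms in `f(y) / f = 1 + f⁻¹ (f(y) - f)`. The last factor has norm at most `δ / 2`, so
its contribution is absorbed by the left side, which is at least `δ` times the norm of `f⁻¹`. The
bound does not depend on `n`. -/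
theorem jetNorm_inv_le {n : ℕ} {ρ δ : ℝ} (hρ : 0 ≤ ρ) (hδ : 0 < δ) {f : ℝ → ℂ} {y : ℝ}
    (hf : ContDiffAt ℝ n f y) (hy : δ ≤ ‖f y‖)
    (h : ∑ j ∈ Finset.range n, ρ ^ (j + 1) / (j + 1)! * ‖iteratedDeriv (j + 1) f y‖ ≤ δ / 2) :
    jetNorm n ρ (fun w => (f w)⁻¹) y ≤ 2 / δ := by
  have hy0 : f y ≠ 0 := norm_pos_iff.1 (hδ.trans_le hy)
  have hinv : ContDiffAt ℝ n (fun w => (f w)⁻¹) y := hf.inv hy0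
  set P := jetNorm n ρ (fun w => (f w)⁻¹) y with hP
  have hP0 : 0 ≤ P := jetNorm_nonneg n hρ _ y
  have hsub : jetNorm n ρ (fun w => f y - f w) y ≤ δ / 2 := by
    refine le_trans (le_of_eq ?_) h
    rw [jetNorm, Finset.sum_range_succ']
    simp only [iteratedDeriv_zero, sub_self, norm_zero, mul_zero, add_zero]
    refine Finset.sum_congr rfl fun j _ => ?_
    rw [iteratedDeriv_const_sub (Nat.succ_pos j), iteratedDeriv_neg, norm_neg]
  have hmul := jetNorm_mul_le hρ hinv (contDiffAt_const.sub hf : ContDiffAt ℝ n (f y - f ·) y)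
  have hcongr : jetNorm n ρ (fun w => f y * (f w)⁻¹) y =
      jetNorm n ρ (fun w => 1 - (-1) * ((f w)⁻¹ * (f y - f w))) y := by
    refine jetNorm_congr n ρ ?_
    filter_upwards [hf.continuousAt.eventually_ne hy0] with w hw
    field_simp
    ring
  have h1 := jetNorm_const_sub_le n ρ 1 (fun w => (-1) * ((f w)⁻¹ * (f y - f w))) y
  rw [← hcongr, jetNorm_const_mul, jetNorm_const_mul, norm_neg, norm_one, one_mul] at h1
  have h2 : δ * P ≤ ‖f y‖ * P := mul_le_mul_of_nonneg_right hy hP0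
  have h3 : P * jetNorm n ρ (fun w => f y - f w) y ≤ P * (δ / 2) :=
    mul_le_mul_of_nonneg_left hsub hP0
  rw [le_div_iff₀ hδ]
  linarith

theorem norm_iteratedDeriv_ofReal {f : ℝ → ℝ} {y : ℝ} {j : ℕ} (hf : ContDiffAt ℝ j f y) :
    ‖iteratedDeriv j (fun w => (f w : ℂ)) y‖ = |iteratedDeriv j f y| := by
  rw [← Real.norm_eq_abs, ← norm_iteratedFDeriv_eq_norm_iteratedDeriv,
    ← norm_iteratedFDeriv_eq_norm_iteratedDeriv]
  exact Complex.ofRealLI.norm_iteratedFDeriv_comp_left hf le_rfl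

theorem norm_iteratedDeriv_conj (f : ℝ → ℂ) (y : ℝ) (j : ℕ) :
    ‖iteratedDeriv j (fun w => (starRingEnd ℂ) (f w)) y‖ = ‖iteratedDeriv j f y‖ := by
  rw [← norm_iteratedFDeriv_eq_norm_iteratedDeriv, ← norm_iteratedFDeriv_eq_norm_iteratedDeriv]
  exact Complex.conjLIE.norm_iteratedFDeriv_comp_left f y j

/-! ### Iterated integration by parts -/

/-- The functions `g`, `(q g)'`, `(q (q g)')'`, … produced by repeated integration by parts. -/
def parts (q g : ℝ → ℂ) : ℕ → ℝ → ℂ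
  | 0 => g
  | k + 1 => deriv fun w => q w * parts q g k w

theorem contDiffOn_parts {O : Set ℝ} (hO : IsOpen O) {q g : ℝ → ℂ} (hq : ContDiffOn ℝ ∞ q O)
    (hg : ContDiffOn ℝ ∞ g O) (k : ℕ) : ContDiffOn ℝ ∞ (parts q g k) O := by
  induction k with
  | zero => exact hg
  | succ k ih => exact (hq.mul ih).deriv_of_isOpen hO (by simp)

/-- The radius is spent in `N` equal portions `ρ / N`, so every step costs the factor `N / ρ` for
the derivative and `Q` for the multiplication by `q`; no expansion of the iterated derivative is
needed. -/
theorem jetNorm_parts_le {O : Set ℝ} (hO : IsOpen O) {q g : ℝ → ℂ} (hq : ContDiffOn ℝ ∞ q O)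
    (hg : ContDiffOn ℝ ∞ g O) {ρ Q : ℝ} (hρ : 0 < ρ) (hQ : 0 ≤ Q) {y : ℝ} (hy : y ∈ O)
    (hqQ : ∀ n, jetNorm n ρ q y ≤ Q) {N : ℕ} (hN : 0 < N) (k : ℕ) (hk : k ≤ N) :
    jetNorm (N - k) (ρ * (1 - k / N)) (parts q g k) y ≤ (Q * N / ρ) ^ k * jetNorm N ρ g y := by
  induction k with
  | zero => simp [parts]
  | succ k ih =>
    have hN' : (0 : ℝ) < N := by exact_mod_cast hN
    have hkN : ((k : ℝ) + 1) ≤ N := by exact_mod_cast hk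
    obtain ⟨l, rfl⟩ : ∃ l, N = k + l + 1 := ⟨N - k - 1, by omega⟩
    have e1 : k + l + 1 - (k + 1) = l := by omega
    have e2 : k + l + 1 - k = l + 1 := by omega
    set N := k + l + 1 with hNdef
    rw [e1]
    rw [e2] at ih
    set ρ₁ := ρ * (1 - k / N) with hρ₁
    set ρ₂ := ρ * (1 - (k + 1 : ℕ) / N) with hρ₂
    have h01 : 0 ≤ ρ₁ := mul_nonneg hρ.le (sub_nonneg.2 ((div_le_one hN').2 (by linarith)))
    have h02 : 0 ≤ ρ₂ :=
      mul_nonneg hρ.le (sub_nonneg.2 ((div_le_one hN').2 (by push_cast; linarith)))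
    have hdiff : ρ₁ - ρ₂ = ρ / N := by
      rw [hρ₁, hρ₂]; push_cast; field_simp; ring
    have h12 : ρ₂ < ρ₁ := sub_pos.1 (by rw [hdiff]; positivity)
    have h1ρ : ρ₁ ≤ ρ := mul_le_of_le_one_right hρ.le (by
      have : 0 ≤ (k : ℝ) / N := by positivity
      linarith)
    have hOy := hO.mem_nhds hy
    have hle : ((l + 1 : ℕ) : WithTop ℕ∞) ≤ ∞ := by exact_mod_cast le_top
    have hp := ((contDiffOn_parts hO hq hg k).contDiffAt hOy).of_le hle
    have hq' := (hq.contDiffAt hOy).of_le hle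
    have hg0 := jetNorm_nonneg N hρ.le g y
    calc jetNorm l ρ₂ (parts q g (k + 1)) y
        ≤ (ρ₁ - ρ₂)⁻¹ * jetNorm (l + 1) ρ₁ (fun w => q w * parts q g k w) y :=
          jetNorm_deriv_le l h02 h12 _ y
      _ ≤ (ρ₁ - ρ₂)⁻¹ * (jetNorm (l + 1) ρ₁ q y * jetNorm (l + 1) ρ₁ (parts q g k) y) := by
          have : 0 < ρ₁ - ρ₂ := sub_pos.2 h12
          gcongr
          exact jetNorm_mul_le h01 hq' hp
      _ ≤ (ρ / N)⁻¹ * (Q * ((Q * N / ρ) ^ k * jetNorm N ρ g y)) := by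
          rw [hdiff]
          refine mul_le_mul_of_nonneg_left (mul_le_mul ?_ (ih (by omega)) (jetNorm_nonneg _ h01 _ _) hQ)
            (by positivity)
          exact (jetNorm_mono _ h01 h1ρ q y).trans (hqQ _)
      _ = _ := by rw [pow_succ]; field_simp

theorem norm_parts_le {O : Set ℝ} (hO : IsOpen O) {q g : ℝ → ℂ} (hq : ContDiffOn ℝ ∞ q O)
    (hg : ContDiffOn ℝ ∞ g O) {ρ Q : ℝ} (hρ : 0 < ρ) (hQ : 0 ≤ Q) {y : ℝ} (hy : y ∈ O)
    (hqQ : ∀ n, jetNorm n ρ q y ≤ Q) (N : ℕ) :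
    ‖parts q g N y‖ ≤ (Q * N / ρ) ^ N * jetNorm N ρ g y := by
  rcases Nat.eq_zero_or_pos N with rfl | hN
  · simp [parts, jetNorm_zero_order]
  · have := jetNorm_parts_le hO hq hg hρ hQ hy hqQ hN N le_rfl
    rwa [Nat.sub_self, jetNorm_zero_order] at this

/-- With `q = 1 / (i F)` the derivative of `exp (i Φ) * q * p` is `exp (i Φ) * (p + (q p)')`, so
each integration by parts replaces `parts q g k` by its successor, up to sign and boundary terms. -/
theorem norm_integral_oscillation_le {O : Set ℝ} (hO : IsOpen O) {a b : ℝ} (hab : a ≤ b)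
    (hIccO : Set.Icc a b ⊆ O) {Φ F : ℝ → ℝ} (hΦ : ∀ w ∈ O, HasDerivAt Φ (F w) w)
    (hF : ContDiffOn ℝ ∞ F O) (hF0 : ∀ w ∈ O, F w ≠ 0) {g : ℝ → ℂ} (hg : ContDiffOn ℝ ∞ g O)
    {q : ℝ → ℂ} (hq : q = fun w => (Complex.I * F w)⁻¹) (N : ℕ) :
    ‖∫ w in a..b, Complex.exp (Complex.I * Φ w) * g w‖ ≤
      (∑ k ∈ Finset.range N, (‖q b * parts q g k b‖ + ‖q a * parts q g k a‖)) +
        ‖∫ w in a..b, Complex.exp (Complex.I * Φ w) * parts q g N w‖ := by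
  have hqO : ContDiffOn ℝ ∞ q O := by
    rw [hq]
    refine (contDiffOn_const.mul (Complex.ofRealCLM.contDiff.comp_contDiffOn hF)).inv ?_
    intro w hw
    simpa using hF0 w hw
  have hIccO' : Set.uIcc a b ⊆ O := by rwa [Set.uIcc_of_le hab]
  have hE : ∀ w : ℝ, ‖Complex.exp (Complex.I * Φ w)‖ = 1 := fun w => by
    rw [mul_comm, Complex.norm_exp_ofReal_mul_I]
  have hEd : ∀ w ∈ O, HasDerivAt (fun w => Complex.exp (Complex.I * Φ w))
      (Complex.exp (Complex.I * Φ w) * (Complex.I * F w)) w := fun w hw =>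
    ((hΦ w hw).ofReal_comp.const_mul Complex.I).cexp
  have hInt : ∀ k, IntervalIntegrable
      (fun w => Complex.exp (Complex.I * Φ w) * parts q g k w) volume a b := fun k => by
    refine ContinuousOn.intervalIntegrable ?_
    refine ContinuousOn.mul (fun w hw => (hEd w (hIccO' hw)).continuousAt.continuousWithinAt) ?_
    exact (contDiffOn_parts hO hqO hg k).continuousOn.mono hIccO'
  induction N with
  | zero => simp [parts]
  | succ k ih =>
    refine ih.trans ?_
    rw [Finset.sum_range_succ, add_assoc]
    gcongr
    have hder : ∀ w ∈ Set.uIcc a b, HasDerivAt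
        (fun w => Complex.exp (Complex.I * Φ w) * (q w * parts q g k w))
        (Complex.exp (Complex.I * Φ w) * parts q g k w +
          Complex.exp (Complex.I * Φ w) * parts q g (k + 1) w) w := by
      intro w hw
      have hwO := hIccO' hw
      have hd : HasDerivAt (fun w => q w * parts q g k w) (parts q g (k + 1) w) w := by
        refine DifferentiableAt.hasDerivAt ?_
        exact ((hqO.mul (contDiffOn_parts hO hqO hg k)).contDiffAt
          (hO.mem_nhds hwO)).differentiableAt (by simp)
      have h1 := (hEd w hwO).mul hd
      have h2 : Complex.I * F w * q w = 1 := by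
        rw [hq]
        exact mul_inv_cancel₀ (mul_ne_zero Complex.I_ne_zero (by exact_mod_cast hF0 w hwO))
      refine h1.congr_deriv ?_
      linear_combination (Complex.exp (Complex.I * Φ w) * parts q g k w) * h2
    have hFTC := intervalIntegral.integral_eq_sub_of_hasDerivAt hder ((hInt k).add (hInt (k + 1)))
    rw [intervalIntegral.integral_add (hInt k) (hInt (k + 1))] at hFTC
    rw [eq_sub_of_add_eq hFTC]
    refine (norm_sub_le _ _).trans (add_le_add_left ((norm_sub_le _ _).trans (le_of_eq ?_)) _)
    rw [norm_mul _ (q b * _), hE, one_mul, norm_mul _ (q a * _), hE, one_mul]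

/-! ### Decay of the elements of the space -/

/-- Raising the hypothesis to the power `t⁻¹` turns `(a !) ^ t` into `a !`, so the bounds can be
summed against the exponential series of `r / t * z ^ t⁻¹`. The bound on `κ` makes the majorant
geometric with ratio `1 / 2`; its sum `2` becomes `2 ^ t`. -/
theorem exp_mul_le_of_forall_pow_mul_le {t r κ z B D : ℝ} (ht : 0 < t) (hr : 0 < r) (hκ : 0 < κ)
    (hκ' : κ ≤ (t / (2 * r)) ^ t) (hz : 0 ≤ z) (hB : 0 ≤ B) (hD : 0 ≤ D)
    (H : ∀ a : ℕ, z ^ a * B ≤ D * (κ ^ a * (a ! : ℝ) ^ t)) :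
    Real.exp (r * z ^ t⁻¹) * B ≤ 2 ^ t * D := by
  have hκ2 : κ ^ t⁻¹ ≤ t / (2 * r) := by
    have := Real.rpow_le_rpow hκ.le hκ' (inv_nonneg.2 ht.le)
    rwa [← Real.rpow_mul (by positivity), mul_inv_cancel₀ ht.ne', Real.rpow_one] at this
  have hswap : ∀ {p : ℝ} (_ : 0 ≤ p) (a : ℕ), (p ^ a) ^ t⁻¹ = (p ^ t⁻¹) ^ a := fun hp a => by
    rw [← Real.rpow_natCast, ← Real.rpow_natCast, ← Real.rpow_mul hp, ← Real.rpow_mul hp, mul_comm]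
  have hterm : ∀ a : ℕ, (r / t * z ^ t⁻¹) ^ a / (a ! : ℝ) * B ^ t⁻¹ ≤
      (1 / 2 : ℝ) ^ a * D ^ t⁻¹ := by
    intro a
    have hfac : (0 : ℝ) < a ! := by exact_mod_cast Nat.factorial_pos a
    have h1 := Real.rpow_le_rpow (by positivity) (H a) (inv_nonneg.2 ht.le)
    rw [Real.mul_rpow (by positivity) hB, Real.mul_rpow hD (by positivity),
      Real.mul_rpow (by positivity) (by positivity), hswap hz, hswap hκ.le, ← Real.rpow_mul hfac.le,
      mul_inv_cancel₀ ht.ne', Real.rpow_one] at h1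
    have h2 : (κ ^ t⁻¹) ^ a ≤ (t / (2 * r)) ^ a := by gcongr
    calc (r / t * z ^ t⁻¹) ^ a / (a ! : ℝ) * B ^ t⁻¹
        = (r / t) ^ a / a ! * ((z ^ t⁻¹) ^ a * B ^ t⁻¹) := by rw [mul_pow]; ring
      _ ≤ (r / t) ^ a / a ! * (D ^ t⁻¹ * ((t / (2 * r)) ^ a * a !)) := by
          refine mul_le_mul_of_nonneg_left (h1.trans ?_) (by positivity)
          gcongr
      _ = (r / t * (t / (2 * r))) ^ a * D ^ t⁻¹ := by rw [mul_pow]; field_simp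
      _ = _ := by congr 2; field_simp
  have hsum : HasSum (fun a : ℕ => (r / t * z ^ t⁻¹) ^ a / (a ! : ℝ))
      (Real.exp (r / t * z ^ t⁻¹)) := by
    rw [Real.exp_eq_exp_ℝ]
    exact NormedSpace.expSeries_div_hasSum_exp _
  have h3 := hasSum_le hterm (hsum.mul_right (B ^ t⁻¹)) (hasSum_geometric_two.mul_right (D ^ t⁻¹))
  have h4 := Real.rpow_le_rpow (by positivity) h3 ht.le
  rwa [Real.mul_rpow (by positivity) (by positivity), Real.mul_rpow (by positivity) (by positivity),
    ← Real.rpow_mul hB, ← Real.rpow_mul hD, inv_mul_cancel₀ ht.ne', Real.rpow_one, Real.rpow_one,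
    ← Real.exp_mul, mul_right_comm, div_mul_cancel₀ _ ht.ne'] at h4

theorem exists_norm_iteratedDeriv_le {t s : ℝ} (ht : 0 < t) (ψ : Space t s) {r h : ℝ} (hr : 0 < r)
    (hh : 0 < h) : ∃ C : ℝ, 0 ≤ C ∧ ∀ (j : ℕ) (y : ℝ), ‖iteratedDeriv j (ψ : ℝ → ℂ) y‖ ≤
      C * (h ^ j * (j ! : ℝ) ^ s) * Real.exp (-(r * |y| ^ t⁻¹)) := by
  -- A single seminorm serves both purposes: `κ ≤ h` for the growth in `j`, and `κ ≤ (t / (2 * r)) ^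
  -- t` for the decay in `y`.
  set κ := min h ((t / (2 * r)) ^ t) with hκdef
  have hκ : 0 < κ := lt_min hh (by positivity)
  obtain ⟨C, hC0, hC⟩ := (bddAbove_ratio_iff t s hκ ψ).1 (ψ.2.2 κ hκ)
  refine ⟨2 ^ t * C, by positivity, fun j y => ?_⟩
  have := exp_mul_le_of_forall_pow_mul_le ht hr hκ (min_le_right _ _) (abs_nonneg y)
    (norm_nonneg (iteratedDeriv j (ψ : ℝ → ℂ) y)) (D := C * (κ ^ j * (j ! : ℝ) ^ s))
    (by positivity) (fun a => (hC a j y).trans (le_of_eq (by rw [pow_add]; ring)))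
  rw [Real.exp_neg, ← div_eq_mul_inv, le_div_iff₀ (Real.exp_pos _), mul_comm]
  refine this.trans ?_
  rw [← mul_assoc]
  gcongr
  exact min_le_left _ _

theorem integrable_coe {t s : ℝ} (ψ : Space t s) : Integrable (ψ : ℝ → ℂ) := by
  refine (integrable_inv_one_add_sq.const_mul
    ((1 + 2 ^ t) * gsNorm t s 1 (ψ : ℝ → ℂ))).mono' ψ.2.1.continuous.aestronglyMeasurable
    (Filter.Eventually.of_forall fun x => norm_le_inv ψ x)

theorem exists_rpow_le_exp {p : ℝ} (hp : 0 ≤ p) {r : ℝ} (hr : 0 < r) :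
    ∃ K : ℝ, 0 ≤ K ∧ ∀ z : ℝ, 0 ≤ z → z ^ p ≤ K * Real.exp (r * z) := by
  set n := ⌈p⌉₊
  refine ⟨1 + (n ! : ℝ) / r ^ n, by positivity, fun z hz => ?_⟩
  have hexp : 1 ≤ Real.exp (r * z) := Real.one_le_exp (by positivity)
  rcases le_total z 1 with h | h
  · have h1 : z ^ p ≤ 1 := Real.rpow_le_one hz h hp
    have h2 : (0 : ℝ) ≤ (n ! : ℝ) / r ^ n := by positivity
    nlinarith
  · have h1 : z ^ p ≤ z ^ n := by
      rw [← Real.rpow_natCast]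
      exact Real.rpow_le_rpow_of_exponent_le h (Nat.le_ceil p)
    have h2 := Real.pow_div_factorial_le_exp (x := r * z) (by positivity) n
    have hn : (0 : ℝ) < n ! := by exact_mod_cast Nat.factorial_pos n
    rw [div_le_iff₀ hn, mul_pow] at h2
    have h3 : z ^ n ≤ (n ! : ℝ) / r ^ n * Real.exp (r * z) := by
      rw [div_mul_eq_mul_div, le_div_iff₀ (by positivity)]
      linarith
    linarith

theorem exists_one_add_sq_mul_exp_le {t : ℝ} (ht : 0 < t) {r : ℝ} (hr : 0 < r) :
    ∃ K : ℝ, 0 ≤ K ∧ ∀ y : ℝ, Real.exp (-(r * |y| ^ t⁻¹)) ≤ K * (1 + y ^ 2)⁻¹ := by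
  obtain ⟨K, hK0, hK⟩ := exists_rpow_le_exp (p := t * 2) (by positivity) hr
  refine ⟨1 + K, by positivity, fun y => ?_⟩
  have h1 := hK (|y| ^ t⁻¹) (by positivity)
  rw [← Real.rpow_mul (abs_nonneg y), inv_mul_cancel_left₀ ht.ne', Real.rpow_two, sq_abs] at h1
  have h2 : 1 ≤ Real.exp (r * |y| ^ t⁻¹) := Real.one_le_exp (by positivity)
  rw [Real.exp_neg, ← div_eq_mul_inv, le_div_iff₀ (by positivity), ← div_eq_inv_mul,
    div_le_iff₀ (Real.exp_pos _)]
  linarith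

theorem integrable_exp_neg_abs_rpow {t : ℝ} (ht : 0 < t) {r : ℝ} (hr : 0 < r) :
    Integrable fun y : ℝ => Real.exp (-(r * |y| ^ t⁻¹)) := by
  obtain ⟨K, -, hK⟩ := exists_one_add_sq_mul_exp_le ht hr
  refine (integrable_inv_one_add_sq.const_mul K).mono' ?_
    (Filter.Eventually.of_forall fun y => ?_)
  · refine Continuous.aestronglyMeasurable (Real.continuous_exp.comp (continuous_const.mul ?_).neg)
    exact continuous_abs.rpow_const fun _ => Or.inr (inv_nonneg.2 ht.le)
  · rw [Real.norm_of_nonneg (Real.exp_pos _).le]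
    exact hK y

theorem exists_setIntegral_norm_le {t s : ℝ} (ht : 0 < t) (ψ : Space t s) {r ε : ℝ} (hr : 0 < r)
    (hε : 0 < ε) : ∃ C : ℝ, 0 ≤ C ∧ ∀ μ : ℝ, 0 < μ →
      ∫ y in (Set.Ioc (-(μ ^ t * ε)) (μ ^ t * ε))ᶜ, ‖(ψ : ℝ → ℂ) y‖ ≤ C * Real.exp (-(r * μ)) := by
  set κ := ε ^ t⁻¹ with hκdef
  have hκ : 0 < κ := by positivity
  -- On the domain of integration `|y| ^ t⁻¹ ≥ μ * κ`, so the share `r / κ` of the rate yields `exp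
  -- (-(r * μ))`; the remaining share `1` keeps the integral finite.
  obtain ⟨C, hC0, hC⟩ := exists_norm_iteratedDeriv_le ht ψ (r := r / κ + 1) (h := 1) (by positivity)
    one_pos
  have hInt := integrable_exp_neg_abs_rpow ht one_pos
  refine ⟨C * ∫ y : ℝ, Real.exp (-(1 * |y| ^ t⁻¹)), mul_nonneg hC0 (integral_nonneg fun y =>
    (Real.exp_pos _).le), fun μ hμ => ?_⟩
  set S := (Set.Ioc (-(μ ^ t * ε)) (μ ^ t * ε))ᶜ with hS
  have hSm : MeasurableSet S := measurableSet_Ioc.compl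
  have hInt' := (hInt.const_mul (C * Real.exp (-(r * μ))))
  calc ∫ y in S, ‖(ψ : ℝ → ℂ) y‖
      ≤ ∫ y in S, C * Real.exp (-(r * μ)) * Real.exp (-(1 * |y| ^ t⁻¹)) := by
        refine setIntegral_mono_on (integrable_coe ψ).norm.integrableOn hInt'.integrableOn hSm ?_
        intro y hy
        have hy' : μ ^ t * ε ≤ |y| := by
          by_contra hlt
          exact hy ⟨(abs_lt.1 (not_le.1 hlt)).1, (abs_lt.1 (not_le.1 hlt)).2.le⟩
        have h1 : μ * κ ≤ |y| ^ t⁻¹ := by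
          have := Real.rpow_le_rpow (by positivity) hy' (inv_nonneg.2 ht.le)
          rwa [Real.mul_rpow (by positivity) hε.le, ← Real.rpow_mul hμ.le, mul_inv_cancel₀ ht.ne',
            Real.rpow_one] at this
        have h2 := hC 0 y
        simp only [iteratedDeriv_zero, pow_zero, Nat.factorial_zero, Nat.cast_one, Real.one_rpow,
          mul_one] at h2
        refine h2.trans ?_
        rw [mul_assoc, ← Real.exp_add]
        refine mul_le_mul_of_nonneg_left (Real.exp_le_exp.2 ?_) hC0
        have h3 : r / κ * (μ * κ) ≤ r / κ * |y| ^ t⁻¹ := by gcongr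
        have h4 : r / κ * (μ * κ) = r * μ := by field_simp
        linarith
    _ ≤ ∫ y, C * Real.exp (-(r * μ)) * Real.exp (-(1 * |y| ^ t⁻¹)) :=
        setIntegral_le_integral hInt' (Filter.Eventually.of_forall fun y => by positivity)
    _ = _ := by rw [integral_const_mul]; ring

/-! ### The short-time Fourier transform of an oscillation -/

/-- The normalizing constant `(2π)^{-1/2}`. -/
def stftConst : ℝ := (2 * Real.pi) ^ (-(1 / 2) : ℝ)

theorem stftConst_pos : 0 < stftConst := Real.rpow_pos_of_pos (by positivity) _

theorem stft_oscillation {t s : ℝ} (ht : 0 < t) (hs : 0 < s) (ψ : Space t s) (θ : ℝ → ℝ)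
    (hθ : Continuous θ) (x ξ : ℝ) :
    stft ht hs ψ (ofFunction t s (oscillation θ hθ)) x ξ = stftConst *
      ∫ y : ℝ, Complex.exp (Complex.I * θ y) * (starRingEnd ℂ)
        (Complex.exp (Complex.I * (y * ξ : ℝ)) * (ψ : ℝ → ℂ) (y - x)) := rfl

theorem norm_stft_oscillation {t s : ℝ} (ht : 0 < t) (hs : 0 < s) (ψ : Space t s) (θ : ℝ → ℝ)
    (hθ : Continuous θ) (x ξ : ℝ) :
    ‖stft ht hs ψ (ofFunction t s (oscillation θ hθ)) x ξ‖ = stftConst *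
      ‖∫ y : ℝ, Complex.exp (Complex.I * (θ (x + y) - ξ * y : ℝ)) *
        (starRingEnd ℂ) ((ψ : ℝ → ℂ) y)‖ := by
  rw [stft_oscillation, norm_mul, Complex.norm_real, Real.norm_of_nonneg stftConst_pos.le,
    ← integral_add_left_eq_self _ x]
  congr 1
  have : ∀ y : ℝ, Complex.exp (Complex.I * θ (x + y)) * (starRingEnd ℂ)
      (Complex.exp (Complex.I * ((x + y) * ξ : ℝ)) * (ψ : ℝ → ℂ) (x + y - x)) =
      Complex.exp ((-(x * ξ) : ℝ) * Complex.I) *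
        (Complex.exp (Complex.I * (θ (x + y) - ξ * y : ℝ)) *
          (starRingEnd ℂ) ((ψ : ℝ → ℂ) y)) := by
    intro y
    rw [add_sub_cancel_left, map_mul, ← Complex.exp_conj, map_mul, Complex.conj_I,
      Complex.conj_ofReal, ← mul_assoc, ← mul_assoc, ← Complex.exp_add, ← Complex.exp_add]
    congr 2
    push_cast
    ring
  simp_rw [this]
  rw [integral_const_mul, norm_mul, Complex.norm_exp_ofReal_mul_I, one_mul]

theorem norm_stft_oscillation_le {t s : ℝ} (ht : 0 < t) (hs : 0 < s) (ψ : Space t s) (θ : ℝ → ℝ)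
    (hθ : Continuous θ) (x ξ : ℝ) :
    ‖stft ht hs ψ (ofFunction t s (oscillation θ hθ)) x ξ‖ ≤
      stftConst * ∫ y : ℝ, ‖(ψ : ℝ → ℂ) y‖ := by
  rw [norm_stft_oscillation]
  refine mul_le_mul_of_nonneg_left ?_ stftConst_pos.le
  refine (norm_integral_le_integral_norm _).trans (le_of_eq (integral_congr_ae ?_))
  filter_upwards with y
  rw [norm_mul, mul_comm Complex.I, Complex.norm_exp_ofReal_mul_I, one_mul, RCLike.norm_conj]

/-! ### Decay where the phase is not stationary -/

/-- This is where the powers of `μ` cancel. For `j ≤ k ≤ μ` and `s > 1` one has `(j !) ^ (s - 1) ≤ μ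
^ ((s - 1) * j)`, so each summand is at most `(h * μ ^ (s + t - 1)) ^ j`. The base is at least `1`,
which allows `j` to be raised to `k`, and the number `k + 1` of terms is at most `2 ^ k`. -/
theorem pow_mul_jet_weight_le {A h μ s t ρ : ℝ} {k : ℕ} (hA : 0 ≤ A) (hh : 0 < h) (hk : (k : ℝ) ≤ μ)
    (hμ : 1 ≤ μ) (hρ : 0 ≤ ρ) (hρ1 : ρ ≤ 1) (hs : 1 < s) (hsmall : 1 ≤ h * μ ^ (s + t - 1)) :
    (A * k / μ ^ (s + t)) ^ k *
      ∑ j ∈ Finset.range (k + 1), (ρ * μ ^ t) ^ j / j ! * (h ^ j * (j ! : ℝ) ^ s) ≤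
      (2 * A * h) ^ k := by
  have hμ0 : 0 < μ := one_pos.trans_le hμ
  have hterm : ∀ j ∈ Finset.range (k + 1),
      (ρ * μ ^ t) ^ j / j ! * (h ^ j * (j ! : ℝ) ^ s) ≤ (h * μ ^ (s + t - 1)) ^ k := by
    intro j hj
    have hjk : j ≤ k := Nat.lt_succ_iff.1 (Finset.mem_range.1 hj)
    have hfac : (0 : ℝ) < j ! := by exact_mod_cast Nat.factorial_pos j
    have h1 : (j ! : ℝ) ≤ μ ^ j := by
      have e : (j ! : ℝ) ≤ (j : ℝ) ^ j := by exact_mod_cast Nat.factorial_le_pow j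
      refine e.trans (pow_le_pow_left₀ (Nat.cast_nonneg j) (le_trans ?_ hk) j)
      exact_mod_cast hjk
    have h2 : (j ! : ℝ) ^ (s - 1) ≤ (μ ^ (s - 1)) ^ j := by
      refine (Real.rpow_le_rpow hfac.le h1 (by linarith)).trans (le_of_eq ?_)
      rw [← Real.rpow_natCast, ← Real.rpow_natCast, ← Real.rpow_mul hμ0.le, ← Real.rpow_mul hμ0.le,
        mul_comm]
    have h3 : (j ! : ℝ) ^ s = j ! * (j ! : ℝ) ^ (s - 1) := by
      rw [Real.rpow_sub_one hfac.ne']; field_simp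
    calc (ρ * μ ^ t) ^ j / j ! * (h ^ j * (j ! : ℝ) ^ s)
        = ρ ^ j * ((μ ^ t * h) ^ j * (j ! : ℝ) ^ (s - 1)) := by
          rw [h3, mul_pow, mul_pow]; field_simp
      _ ≤ 1 * ((μ ^ t * h) ^ j * (μ ^ (s - 1)) ^ j) := by
          gcongr
          exact pow_le_one₀ hρ hρ1
      _ = (h * μ ^ (s + t - 1)) ^ j := by
          rw [one_mul, ← mul_pow, show s + t - 1 = t + (s - 1) by ring, Real.rpow_add hμ0]
          ring
      _ ≤ _ := pow_le_pow_right₀ hsmall hjk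
  have hsum := Finset.sum_le_sum hterm
  rw [Finset.sum_const, Finset.card_range, nsmul_eq_mul] at hsum
  have hk2 : ((k + 1 : ℕ) : ℝ) ≤ 2 ^ k := by exact_mod_cast Nat.lt_two_pow_self (n := k)
  calc _ ≤ (A * μ / μ ^ (s + t)) ^ k * (2 ^ k * (h * μ ^ (s + t - 1)) ^ k) := by
        gcongr
        exact hsum.trans (by gcongr)
    _ = (A * μ / μ ^ (s + t) * (2 * (h * μ ^ (s + t - 1)))) ^ k := by
        rw [← mul_pow, ← mul_pow]
    _ = _ := by
        congr 1
        rw [Real.rpow_sub_one hμ0.ne']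
        have : μ ^ (s + t) ≠ 0 := by positivity
        field_simp

theorem norm_iteratedDeriv_conj_comp_mul {t s : ℝ} (ψ : Space t s) (κ : ℝ) (hκ : 0 ≤ κ) (j : ℕ)
    (w : ℝ) :
    ‖iteratedDeriv j (fun w => (starRingEnd ℂ) ((ψ : ℝ → ℂ) (κ * w))) w‖ =
      κ ^ j * ‖iteratedDeriv j (ψ : ℝ → ℂ) (κ * w)‖ := by
  have hj : ((j : ℕ) : WithTop ℕ∞) ≤ ∞ := by exact_mod_cast le_top
  rw [norm_iteratedDeriv_conj (fun w => (ψ : ℝ → ℂ) (κ * w)),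
    iteratedDeriv_comp_const_smul (ψ.2.1.of_le hj), norm_smul, Real.norm_of_nonneg (by positivity)]

/-- The constants are fixed before `O`, `Φ` and `p`, because the estimate must be uniform over a
neighbourhood of a phase space point. -/
theorem exists_norm_integral_le {t s : ℝ} (ht : 0 < t) (hs : 1 < s) (ψ : Space t s) {r δ ρ ε : ℝ}
    (hr : 0 < r) (hδ : 0 < δ) (hρ : 0 < ρ) (hρ1 : ρ ≤ 1) (hε : 0 < ε) :
    ∃ C : ℝ, 0 ≤ C ∧ ∃ μ₀ : ℝ, 1 ≤ μ₀ ∧ ∀ μ : ℝ, μ₀ ≤ μ → ∀ (O : Set ℝ) (_ : IsOpen O)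
      (_ : Set.Icc (-ε) ε ⊆ O) (Φ p : ℝ → ℝ)
      (_ : ∀ w ∈ O, HasDerivAt Φ (μ ^ (s + t) * p w) w) (_ : ContDiffOn ℝ ∞ p O)
      (_ : ∀ w ∈ O, p w ≠ 0)
      (_ : ∀ w ∈ O, ∀ n, jetNorm n ρ (fun w => ((p w : ℝ) : ℂ)⁻¹) w ≤ 2 / δ),
      ‖∫ w in (-ε)..ε, Complex.exp (Complex.I * Φ w) *
        (starRingEnd ℂ) ((ψ : ℝ → ℂ) (μ ^ t * w))‖ ≤ C * μ * Real.exp (-(r * μ)) := by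
  set A := 2 / (δ * ρ) with hA
  have hA0 : 0 < A := by positivity
  -- Chosen so that the factor `(2 * A * h) ^ k` left by `k` integrations by parts is `exp (-r) ^
  -- k`.
  set h := Real.exp (-r) / (2 * A) with hh
  have hh0 : 0 < h := by positivity
  have hAh : 2 * A * h = Real.exp (-r) := by rw [hh]; field_simp
  set κ := ε ^ t⁻¹ with hκ
  have hκ0 : 0 < κ := by positivity
  obtain ⟨C₀, hC₀, hC⟩ := exists_norm_iteratedDeriv_le ht ψ (r := r / κ) (h := h) (by positivity) hh0
  have hst : 0 < s + t - 1 := by linarith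
  -- `4 / δ` comes from the two endpoints, each contributing `2 / δ` per step; `2 * ε` is the length
  -- of the interval and `exp r` pays for rounding `μ` down. The lower bound on `μ` ensures `1 ≤ h *
  -- μ ^ (s + t - 1)`.
  refine ⟨C₀ * (4 / δ + 2 * ε * Real.exp r), by positivity, max 1 ((1 / h) ^ (s + t - 1)⁻¹),
    le_max_left _ _, ?_⟩
  intro μ hμ O hO hIccO Φ p hΦ hp hp0 hjet
  have hμ1 : 1 ≤ μ := (le_max_left _ _).trans hμ
  have hμ0 : 0 < μ := one_pos.trans_le hμ1
  have hsmall : 1 ≤ h * μ ^ (s + t - 1) := by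
    have h1 := Real.rpow_le_rpow (by positivity) ((le_max_right _ _).trans hμ) hst.le
    rw [← Real.rpow_mul (by positivity), inv_mul_cancel₀ hst.ne', Real.rpow_one,
      div_le_iff₀ hh0] at h1
    linarith
  set g : ℝ → ℂ := fun w => (starRingEnd ℂ) ((ψ : ℝ → ℂ) (μ ^ t * w)) with hg
  have hgs : ContDiff ℝ ∞ g :=
    Complex.conjCLE.contDiff.comp (ψ.2.1.comp (contDiff_const.mul contDiff_id))
  set F : ℝ → ℝ := fun w => μ ^ (s + t) * p w with hF
  set q : ℝ → ℂ := fun w => (Complex.I * F w)⁻¹ with hq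
  have hFs : ContDiffOn ℝ ∞ F O := contDiffOn_const.mul hp
  have hF0 : ∀ w ∈ O, F w ≠ 0 := fun w hw => mul_ne_zero (by positivity) (hp0 w hw)
  have hqs : ContDiffOn ℝ ∞ q O := by
    refine (contDiffOn_const.mul (Complex.ofRealCLM.contDiff.comp_contDiffOn hFs)).inv ?_
    intro w hw
    simpa using hF0 w hw
  set Q := 2 / δ / μ ^ (s + t) with hQ
  have hQ0 : 0 ≤ Q := by positivity
  have hQ1 : Q ≤ 2 / δ :=
    div_le_self (by positivity) (Real.one_le_rpow hμ1 (by linarith))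
  have hqQ : ∀ w ∈ O, ∀ n, jetNorm n ρ q w ≤ Q := by
    intro w hw n
    have e : q = fun w => (Complex.I * (μ ^ (s + t) : ℝ))⁻¹ * ((p w : ℝ) : ℂ)⁻¹ := by
      funext w
      simp only [hq, hF, Complex.ofReal_mul, mul_inv]
      ring
    rw [e, jetNorm_const_mul, norm_inv, norm_mul, Complex.norm_I, one_mul, Complex.norm_real,
      Real.norm_of_nonneg (by positivity), hQ, ← div_eq_inv_mul]
    gcongr
    exact hjet w hw n
  have hparts : ∀ w ∈ O, ∀ k : ℕ, (k : ℝ) ≤ μ → ‖parts q g k w‖ ≤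
      C₀ * Real.exp (-(r / κ * |μ ^ t * w| ^ t⁻¹)) * Real.exp (-r) ^ k := by
    intro w hw k hk
    have h1 := norm_parts_le hO hqs hgs.contDiffOn hρ hQ0 hw (hqQ w hw) k
    have h2 : jetNorm k ρ g w ≤ C₀ * Real.exp (-(r / κ * |μ ^ t * w| ^ t⁻¹)) *
        ∑ j ∈ Finset.range (k + 1), (ρ * μ ^ t) ^ j / j ! * (h ^ j * (j ! : ℝ) ^ s) := by
      rw [jetNorm, Finset.mul_sum]
      refine Finset.sum_le_sum fun j _ => ?_
      rw [norm_iteratedDeriv_conj_comp_mul ψ _ (by positivity), mul_pow]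
      calc ρ ^ j / (j ! : ℝ) * ((μ ^ t) ^ j * ‖iteratedDeriv j (ψ : ℝ → ℂ) (μ ^ t * w)‖)
          ≤ ρ ^ j / (j ! : ℝ) * ((μ ^ t) ^ j * (C₀ * (h ^ j * (j ! : ℝ) ^ s) *
              Real.exp (-(r / κ * |μ ^ t * w| ^ t⁻¹)))) := by
            gcongr
            exact hC j _
        _ = _ := by ring
    have e : Q * k / ρ = A * k / μ ^ (s + t) := by
      rw [hQ, hA]; field_simp
    rw [e] at h1
    refine h1.trans ((mul_le_mul_of_nonneg_left h2 (by positivity)).trans ?_)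
    rw [mul_left_comm, ← hAh]
    exact mul_le_mul_of_nonneg_left (pow_mul_jet_weight_le hA0.le hh0 hk hμ1 hρ.le hρ1 hs hsmall)
      (by positivity)
  -- The boundary terms with few integrations by parts gain little from `exp (-r) ^ k`; the decay of
  -- the window at `± μ ^ t * ε` makes them small instead.
  have hend : ∀ w, |w| = ε → Real.exp (-(r / κ * |μ ^ t * w| ^ t⁻¹)) = Real.exp (-(r * μ)) := by
    intro w hw
    rw [abs_mul, hw, abs_of_pos (by positivity), Real.mul_rpow (by positivity) hε.le,
      ← Real.rpow_mul hμ0.le, mul_inv_cancel₀ ht.ne', Real.rpow_one, ← hκ]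
    congr 2
    field_simp
  set N := ⌊μ⌋₊ with hN
  have hNμ : (N : ℝ) ≤ μ := Nat.floor_le hμ0.le
  have hexp1 : Real.exp (-r) ≤ 1 := Real.exp_le_one_iff.2 (by linarith)
  have hbdry : ∀ w ∈ O, |w| = ε → ∀ k ∈ Finset.range N,
      ‖q w * parts q g k w‖ ≤ 2 / δ * (C₀ * Real.exp (-(r * μ))) := by
    intro w hw hwε k hk
    have hkN : (k : ℝ) ≤ N := by exact_mod_cast (Finset.mem_range.1 hk).le
    have h1 := hparts w hw k (hkN.trans hNμ)
    rw [hend w hwε] at h1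
    rw [norm_mul]
    refine mul_le_mul ((norm_le_jetNorm 0 hρ.le q w).trans ((hqQ w hw 0).trans hQ1)) (h1.trans ?_)
      (norm_nonneg _) (by positivity)
    exact mul_le_of_le_one_right (by positivity) (pow_le_one₀ (Real.exp_pos _).le hexp1)
  have hεO : ε ∈ O := hIccO ⟨by linarith, le_rfl⟩
  have hεO' : -ε ∈ O := hIccO ⟨le_rfl, by linarith⟩
  have hmain := norm_integral_oscillation_le hO (by linarith : -ε ≤ ε) hIccO hΦ hFs hF0
    hgs.contDiffOn hq N
  have hsum : ∑ k ∈ Finset.range N, (‖q ε * parts q g k ε‖ + ‖q (-ε) * parts q g k (-ε)‖) ≤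
      μ * (4 / δ * (C₀ * Real.exp (-(r * μ)))) := by
    refine (Finset.sum_le_sum fun k hk => add_le_add
      (hbdry ε hεO (abs_of_pos hε) k hk)
      (hbdry (-ε) hεO' (by rw [abs_neg, abs_of_pos hε]) k hk)).trans ?_
    rw [Finset.sum_const, Finset.card_range, nsmul_eq_mul]
    refine mul_le_mul hNμ (le_of_eq (by ring)) (by positivity) hμ0.le
  have hlast : ‖∫ w in (-ε)..ε, Complex.exp (Complex.I * Φ w) * parts q g N w‖ ≤
      2 * ε * (C₀ * (Real.exp r * Real.exp (-(r * μ)))) := by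
    have := intervalIntegral.norm_integral_le_of_norm_le_const (a := -ε) (b := ε)
      (f := fun w => Complex.exp (Complex.I * Φ w) * parts q g N w)
      (C := C₀ * (Real.exp r * Real.exp (-(r * μ)))) (fun w hw => ?_)
    · rw [sub_neg_eq_add, abs_of_pos (by linarith)] at this
      linarith
    · rw [Set.uIoc_of_le (by linarith)] at hw
      have hwO := hIccO (Set.Ioc_subset_Icc_self hw)
      rw [norm_mul, mul_comm Complex.I, Complex.norm_exp_ofReal_mul_I, one_mul]
      refine (hparts w hwO N hNμ).trans ?_
      rw [mul_assoc]
      refine mul_le_mul_of_nonneg_left ?_ hC₀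
      have h1 : Real.exp (-(r / κ * |μ ^ t * w| ^ t⁻¹)) ≤ 1 :=
        Real.exp_le_one_iff.2 (neg_nonpos.2 (by positivity))
      have h2 : Real.exp (-r) ^ N ≤ Real.exp r * Real.exp (-(r * μ)) := by
        rw [← Real.exp_nat_mul, ← Real.exp_add]
        refine Real.exp_le_exp.2 ?_
        have := Nat.lt_floor_add_one μ
        rw [← hN] at this
        nlinarith
      calc _ ≤ 1 * Real.exp (-r) ^ N := by gcongr
        _ ≤ _ := by rwa [one_mul]
  refine hmain.trans ((add_le_add hsum hlast).trans ?_)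
  have hX : 0 ≤ 2 * ε * (C₀ * (Real.exp r * Real.exp (-(r * μ)))) := by positivity
  have hY := mul_le_mul_of_nonneg_right hμ1 hX
  calc _ ≤ μ * (4 / δ * (C₀ * Real.exp (-(r * μ)))) +
        μ * (2 * ε * (C₀ * (Real.exp r * Real.exp (-(r * μ))))) := by linarith
    _ = _ := by ring

/-- The short-time Fourier transform of `u` decays superexponentially along the curves
`μ ↦ (μ ^ t x, μ ^ s ξ)` for `(x, ξ)` near `z`. -/
def DecaysNear {t s : ℝ} (ht : 0 < t) (hs : 0 < s) (ψ : Space t s) (u : Ultradistribution t s)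
    (z : ℝ × ℝ) : Prop :=
  ∃ U : Set (ℝ × ℝ), IsOpen U ∧ (0 : ℝ × ℝ) ∉ U ∧ z ∈ U ∧
    ∀ r : ℝ, 0 < r → ∃ C : ℝ, ∀ μ : ℝ, 0 < μ → ∀ p ∈ U,
      Real.exp (r * μ) * ‖stft ht hs ψ u (μ ^ t * p.1) (μ ^ s * p.2)‖ ≤ C

theorem mem_waveFrontSet_iff {t s : ℝ} (ht : 0 < t) (hs : 0 < s) (ψ : Space t s)
    (u : Ultradistribution t s) (z : ℝ × ℝ) :
    z ∈ waveFrontSet ht hs ψ u ↔ z ≠ 0 ∧ ¬ DecaysNear ht hs ψ u z := Iff.rfl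

theorem norm_integral_le_add_of_interval {H : ℝ → ℂ} (hH : Integrable H) {κ ε : ℝ} (hκ : 0 < κ)
    (hε : 0 < ε) :
    ‖∫ y, H y‖ ≤ κ * ‖∫ w in (-ε)..ε, H (κ * w)‖ +
      ∫ y in (Set.Ioc (-(κ * ε)) (κ * ε))ᶜ, ‖H y‖ := by
  have hκε : 0 < κ * ε := by positivity
  have e := intervalIntegral.smul_integral_comp_mul_left (a := -ε) (b := ε) H κ
  rw [mul_neg, intervalIntegral.integral_of_le (by linarith : -(κ * ε) ≤ κ * ε)] at e
  rw [← integral_add_compl (measurableSet_Ioc (a := -(κ * ε)) (b := κ * ε)) hH, ← e]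
  refine (norm_add_le _ _).trans (add_le_add (le_of_eq ?_) (norm_integral_le_integral_norm _))
  rw [norm_smul, Real.norm_of_nonneg hκ.le]

/-- Homogeneity of `f` turns the dilation into a large parameter `μ ^ (s + t)` in front of the fixed
slope `f (x + w) - ξ`. The piece `|w| ≤ ε` is oscillatory and the rest is a tail of the window. -/
theorem exists_exp_mul_norm_stft_le {t s : ℝ} (ht : 0 < t) (hs0 : 0 < s) (hs : 1 < s)
    (ψ : Space t s) (θ : ℝ → ℝ) (hθ : Continuous θ) {δ ρ ε : ℝ} (hδ : 0 < δ) (hρ : 0 < ρ)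
    (hρ1 : ρ ≤ 1) (hε : 0 < ε) (f : ℝ → ℝ)
    (hhom : ∀ μ : ℝ, 0 < μ → ∀ v, f (μ ^ t * v) = μ ^ s * f v) {r : ℝ} (hr : 0 < r) :
    ∃ C : ℝ, ∀ μ : ℝ, 0 < μ → ∀ x ξ : ℝ, ∀ (O : Set ℝ) (_ : IsOpen O) (_ : Set.Icc (-ε) ε ⊆ O)
      (_ : ∀ w ∈ O, HasDerivAt θ (f (μ ^ t * (x + w))) (μ ^ t * (x + w)))
      (_ : ContDiffOn ℝ ∞ (fun w => f (x + w) - ξ) O) (_ : ∀ w ∈ O, f (x + w) - ξ ≠ 0)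
      (_ : ∀ w ∈ O, ∀ n, jetNorm n ρ (fun w => ((f (x + w) - ξ : ℝ) : ℂ)⁻¹) w ≤ 2 / δ),
      Real.exp (r * μ) * ‖stft ht hs0 ψ (ofFunction t s (oscillation θ hθ))
        (μ ^ t * x) (μ ^ s * ξ)‖ ≤ C := by
  -- The extra unit of decay absorbs `μ ^ (t + 1)`: the Jacobian `μ ^ t` times the factor `μ`
  -- counting the boundary terms. For `μ < μ₀` the trivial bound by the `L¹` norm of the window
  -- suffices.
  obtain ⟨C₁, hC₁0, μ₀, hμ₀, hC₁⟩ := exists_norm_integral_le ht hs ψ (r := r + 1) (by linarith)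
    hδ hρ hρ1 hε
  obtain ⟨C₂, hC₂0, hC₂⟩ := exists_setIntegral_norm_le ht ψ (r := r + 1) (by linarith) hε
  obtain ⟨K, hK0, hK⟩ := exists_rpow_le_exp (p := t + 1) (by linarith) one_pos
  have hI0 : 0 ≤ ∫ y : ℝ, ‖(ψ : ℝ → ℂ) y‖ := integral_nonneg fun y => norm_nonneg _
  have hc0 := stftConst_pos
  refine ⟨stftConst * (K * C₁ + C₂) + Real.exp (r * μ₀) * (stftConst * ∫ y : ℝ, ‖(ψ : ℝ → ℂ) y‖),
    ?_⟩
  intro μ hμ x ξ O hO hIccO hder hsm hne hjet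
  rcases lt_or_ge μ μ₀ with hlt | hge
  · refine le_add_of_nonneg_of_le (by positivity) ?_
    refine mul_le_mul (Real.exp_le_exp.2 (by nlinarith)) (norm_stft_oscillation_le ht hs0 ψ θ hθ _ _)
      (norm_nonneg _) (Real.exp_pos _).le
  · refine le_add_of_le_of_nonneg ?_ (by positivity)
    rw [norm_stft_oscillation, mul_left_comm]
    refine mul_le_mul_of_nonneg_left ?_ hc0.le
    set Φ : ℝ → ℝ := fun w => θ (μ ^ t * x + μ ^ t * w) - μ ^ s * ξ * (μ ^ t * w) with hΦ
    have hΦd : ∀ w ∈ O, HasDerivAt Φ (μ ^ (s + t) * (f (x + w) - ξ)) w := by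
      intro w hw
      have h1 : HasDerivAt (fun w => μ ^ t * x + μ ^ t * w) (μ ^ t) w := by
        simpa using ((hasDerivAt_id w).const_mul (μ ^ t)).const_add (μ ^ t * x)
      have h2 : HasDerivAt (fun w => μ ^ s * ξ * (μ ^ t * w)) (μ ^ s * ξ * μ ^ t) w := by
        simpa using ((hasDerivAt_id w).const_mul (μ ^ t)).const_mul (μ ^ s * ξ)
      have h3 := hder w hw
      rw [mul_add] at h3
      refine ((h3.comp w h1).sub h2).congr_deriv ?_
      rw [← mul_add, hhom μ hμ, Real.rpow_add hμ]
      ring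
    have hInt := hC₁ μ hge O hO hIccO Φ (fun w => f (x + w) - ξ) hΦd hsm hne hjet
    set H : ℝ → ℂ := fun y => Complex.exp (Complex.I * (θ (μ ^ t * x + y) - μ ^ s * ξ * y : ℝ)) *
        (starRingEnd ℂ) ((ψ : ℝ → ℂ) y) with hH
    have hHn : ∀ y, ‖H y‖ = ‖(ψ : ℝ → ℂ) y‖ := fun y => by
      rw [hH]
      simp only
      rw [norm_mul, mul_comm Complex.I, Complex.norm_exp_ofReal_mul_I, one_mul, RCLike.norm_conj]
    have hHi : Integrable H := by
      refine (integrable_coe ψ).norm.mono' ?_ (Filter.Eventually.of_forall fun y => (hHn y).le)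
      have hψc := ψ.2.1.continuous
      exact Continuous.aestronglyMeasurable (by fun_prop)
    have hsplit := norm_integral_le_add_of_interval hHi (κ := μ ^ t) (by positivity) hε
    simp_rw [hHn] at hsplit
    have htail := hC₂ μ hμ
    have hKμ := hK μ hμ.le
    rw [Real.rpow_add_one hμ.ne', one_mul] at hKμ
    have hexp : Real.exp (r * μ) * Real.exp (-((r + 1) * μ)) = Real.exp (-μ) := by
      rw [← Real.exp_add]; congr 1; ring
    have hexp' : Real.exp μ * Real.exp (-μ) = 1 := by rw [← Real.exp_add]; simp
    have hexp1 : Real.exp (-μ) ≤ 1 := Real.exp_le_one_iff.2 (by linarith)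
    calc Real.exp (r * μ) * ‖∫ y, H y‖
        ≤ Real.exp (r * μ) * (μ ^ t * (C₁ * μ * Real.exp (-((r + 1) * μ))) +
            C₂ * Real.exp (-((r + 1) * μ))) := by
          refine mul_le_mul_of_nonneg_left (hsplit.trans (add_le_add ?_ htail)) (Real.exp_pos _).le
          exact mul_le_mul_of_nonneg_left hInt (by positivity)
      _ = (μ ^ t * μ) * C₁ * (Real.exp (r * μ) * Real.exp (-((r + 1) * μ))) +
            C₂ * (Real.exp (r * μ) * Real.exp (-((r + 1) * μ))) := by ring
      _ ≤ (K * Real.exp μ) * C₁ * Real.exp (-μ) + C₂ * 1 := by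
          rw [hexp]
          gcongr
      _ = K * C₁ * (Real.exp μ * Real.exp (-μ)) + C₂ := by ring
      _ = _ := by rw [hexp', mul_one]

theorem sum_jet_le_of_analytic_bound {M R ρ δ : ℝ} (hM : 0 ≤ M) (hR : 0 < R) (hρ : 0 ≤ ρ)
    (h1 : ρ * R ≤ 1 / 2) (h2 : 2 * M * (ρ * R) ≤ δ / 2) {a : ℕ → ℝ}
    (ha : ∀ j, a j ≤ M * (j ! * R ^ j)) (n : ℕ) :
    ∑ j ∈ Finset.range n, ρ ^ (j + 1) / (j + 1)! * a (j + 1) ≤ δ / 2 := by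
  have h0 : 0 ≤ ρ * R := by positivity
  calc _ ≤ ∑ j ∈ Finset.range n, M * (ρ * R) * (1 / 2 : ℝ) ^ j := by
        refine Finset.sum_le_sum fun j _ => ?_
        have hfac : (0 : ℝ) < (j + 1)! := by exact_mod_cast Nat.factorial_pos _
        calc ρ ^ (j + 1) / ((j + 1)! : ℝ) * a (j + 1)
            ≤ ρ ^ (j + 1) / ((j + 1)! : ℝ) * (M * ((j + 1)! * R ^ (j + 1))) := by
              gcongr
              exact ha _
          _ = M * (ρ * R) * (ρ * R) ^ j := by field_simp; ring
          _ ≤ _ := by gcongr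
    _ = M * (ρ * R) * ∑ j ∈ Finset.range n, (1 / 2 : ℝ) ^ j := by rw [Finset.mul_sum]
    _ ≤ M * (ρ * R) * 2 := by
        gcongr
        exact sum_geometric_two_le n
    _ ≤ _ := by linarith

/-- Non-stationary phase. The bounds `M * (j ! * R ^ j)` express analyticity of `f` near `x₀`; they
make the jet norms of the reciprocal slope bounded independently of the order, as is needed when the
number of integrations by parts grows with `μ`. -/
theorem decaysNear_of_ne {t s : ℝ} (ht : 0 < t) (hs0 : 0 < s) (hs : 1 < s)
    (ψ : Space t s) (θ : ℝ → ℝ) (hθ : Continuous θ) (f : ℝ → ℝ)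
    (hhom : ∀ μ : ℝ, 0 < μ → ∀ v, f (μ ^ t * v) = μ ^ s * f v) {x₀ ξ₀ η M R : ℝ} (hη : 0 < η)
    (hR : 0 < R)
    (hder : ∀ μ : ℝ, 0 < μ → ∀ v ∈ Metric.ball x₀ η, HasDerivAt θ (f (μ ^ t * v)) (μ ^ t * v))
    (hsm : ContDiffOn ℝ ∞ f (Metric.ball x₀ η))
    (hb : ∀ v ∈ Metric.ball x₀ η, ∀ j : ℕ, |iteratedDeriv j f v| ≤ M * (j ! * R ^ j))
    (hne : f x₀ ≠ ξ₀) (hz : (x₀, ξ₀) ≠ (0 : ℝ × ℝ)) :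
    DecaysNear ht hs0 ψ (ofFunction t s (oscillation θ hθ)) (x₀, ξ₀) := by
  set δ := |f x₀ - ξ₀| / 2 with hδdef
  have hδ : 0 < δ := half_pos (abs_pos.2 (sub_ne_zero.2 hne))
  have hM : 0 ≤ M := by
    have := hb x₀ (Metric.mem_ball_self hη) 0
    simp only [Nat.factorial_zero, Nat.cast_one, pow_zero, mul_one] at this
    exact (abs_nonneg _).trans this
  have hcont : ContinuousAt f x₀ :=
    (hsm.contDiffAt (Metric.ball_mem_nhds x₀ hη)).continuousAt
  obtain ⟨η₁, hη₁, hη₁f⟩ := Metric.continuousAt_iff.1 hcont (δ / 2) (half_pos hδ)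
  -- The third leaves room for `|x - x₀| < ε` together with `|w| < 2 * ε`. From `|f x₀ - ξ₀| = 2 *
  -- δ`, a change of `f` and a change of `ξ` of at most `δ / 2` each leave a slope of size at least
  -- `δ`.
  set ε := min (min η η₁ / 3) (δ / 2) with hεdef
  have hε : 0 < ε := lt_min (by have := lt_min hη hη₁; positivity) (half_pos hδ)
  have hε3 : 3 * ε ≤ min η η₁ := by
    have := min_le_left (min η η₁ / 3) (δ / 2)
    linarith
  have hεδ : ε ≤ δ / 2 := min_le_right _ _
  -- The radius makes the jet of the slope without its constant term at most `δ / 2`, as the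
  -- inversion of the slope requires; `M + 1` avoids division by zero.
  set ρ := min 1 (min (1 / 2) (δ / (4 * (M + 1))) / R) with hρdef
  have hmin : 0 < min (1 / 2) (δ / (4 * (M + 1))) := lt_min (by norm_num) (by positivity)
  have hρ : 0 < ρ := lt_min one_pos (by positivity)
  have hρR : ρ * R ≤ min (1 / 2) (δ / (4 * (M + 1))) := by
    rw [← le_div_iff₀ hR]
    exact min_le_right _ _
  have hρR1 : ρ * R ≤ 1 / 2 := hρR.trans (min_le_left _ _)
  have hρR2 : 2 * M * (ρ * R) ≤ δ / 2 := by
    have h1 := hρR.trans (min_le_right _ _)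
    rw [le_div_iff₀ (by positivity)] at h1
    have h2 : 0 ≤ ρ * R := by positivity
    nlinarith
  -- The origin may lie in the box and has to be removed, since the neighbourhood must avoid it.
  refine ⟨(Metric.ball x₀ ε ×ˢ Metric.ball ξ₀ ε) \ {0},
    (Metric.isOpen_ball.prod Metric.isOpen_ball).sdiff isClosed_singleton,
    fun h => h.2 rfl, ⟨⟨Metric.mem_ball_self hε, Metric.mem_ball_self hε⟩, hz⟩, fun r hr => ?_⟩
  obtain ⟨C, hC⟩ := exists_exp_mul_norm_stft_le ht hs0 hs ψ θ hθ hδ hρ (min_le_left _ _) hε f hhom hr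
  refine ⟨C, ?_⟩
  rintro μ hμ ⟨x, ξ⟩ ⟨⟨hx, hξ⟩, -⟩
  simp only [Metric.mem_ball, Real.dist_eq] at hx hξ
  have hball : ∀ w ∈ Metric.ball (0 : ℝ) (2 * ε), |x + w - x₀| < min η η₁ := by
    intro w hw
    simp only [Metric.mem_ball, Real.dist_eq, sub_zero] at hw
    calc |x + w - x₀| = |(x - x₀) + w| := by congr 1; ring
      _ ≤ |x - x₀| + |w| := abs_add_le _ _
      _ < _ := by linarith
  have hballη : ∀ w ∈ Metric.ball (0 : ℝ) (2 * ε), x + w ∈ Metric.ball x₀ η := fun w hw => by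
    rw [Metric.mem_ball, Real.dist_eq]
    exact (hball w hw).trans_le (min_le_left _ _)
  have hlow : ∀ w ∈ Metric.ball (0 : ℝ) (2 * ε), δ ≤ |f (x + w) - ξ| := by
    intro w hw
    have h1 : |f (x + w) - f x₀| < δ / 2 := by
      have := hη₁f (x := x + w) (by
        rw [Real.dist_eq]
        exact (hball w hw).trans_le (min_le_right _ _))
      rwa [Real.dist_eq] at this
    have h2 : |f x₀ - ξ₀| ≤ |f (x + w) - ξ| + |f (x + w) - f x₀| + |ξ - ξ₀| := by
      calc |f x₀ - ξ₀| = |(f (x + w) - ξ) - (f (x + w) - f x₀) + (ξ - ξ₀)| := by congr 1; ring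
        _ ≤ |(f (x + w) - ξ) - (f (x + w) - f x₀)| + |ξ - ξ₀| := abs_add_le _ _
        _ ≤ _ := by gcongr; exact abs_sub _ _
    have h3 : |f x₀ - ξ₀| = 2 * δ := by rw [hδdef]; ring
    linarith
  have hsm' : ContDiffOn ℝ ∞ (fun w => f (x + w) - ξ) (Metric.ball (0 : ℝ) (2 * ε)) :=
    (hsm.comp (contDiff_const.add contDiff_id).contDiffOn hballη).sub contDiffOn_const
  refine hC μ hμ x ξ (Metric.ball 0 (2 * ε)) Metric.isOpen_ball ?_ ?_ hsm' ?_ ?_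
  · intro w hw
    rw [Metric.mem_ball, Real.dist_eq, sub_zero, abs_lt]
    constructor <;> linarith [hw.1, hw.2]
  · exact fun w hw => hder μ hμ _ (hballη w hw)
  · exact fun w hw => abs_pos.1 (hδ.trans_le (hlow w hw))
  · intro w hw n
    have hcd := hsm'.contDiffAt (Metric.isOpen_ball.mem_nhds hw)
    have hle : ∀ j : ℕ, (j : WithTop ℕ∞) ≤ ∞ := fun j => by exact_mod_cast le_top
    refine jetNorm_inv_le hρ.le hδ
      (Complex.ofRealCLM.contDiff.contDiffAt.comp w (hcd.of_le (hle n))) ?_ ?_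
    · rw [Complex.norm_real]
      exact hlow w hw
    · refine le_trans (Finset.sum_le_sum fun j _ => le_of_eq ?_)
        (sum_jet_le_of_analytic_bound hM hR hρ.le hρR1 hρR2 (hb _ (hballη w hw)) n)
      rw [norm_iteratedDeriv_ofReal (hcd.of_le (hle _))]
      congr 2
      rw [iteratedDeriv_fun_sub ?_ contDiffAt_const, iteratedDeriv_comp_const_add]
      · simp [iteratedDeriv_const]
      · have := (hcd.of_le (hle (j + 1))).add (contDiffAt_const (c := ξ))
        simpa using this

/-! ### The phases of the chirps -/

theorem decaysNear_monomialChirp {c : ℝ} {m : ℕ} {t : ℝ} (hm : 2 ≤ m) (ht : 0 < t)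
    (hs0 : 0 < t * ((m : ℝ) - 1)) (hs : 1 < t * ((m : ℝ) - 1)) (ψ : Space t (t * ((m : ℝ) - 1)))
    {x₀ ξ₀ : ℝ} (hne : ξ₀ ≠ c * m * x₀ ^ (m - 1)) (hz : (x₀, ξ₀) ≠ (0 : ℝ × ℝ)) :
    DecaysNear ht hs0 ψ (ofFunction t _ (monomialChirp c m)) (x₀, ξ₀) := by
  have hcast : ((m - 1 : ℕ) : ℝ) = (m : ℝ) - 1 := by
    rw [Nat.cast_sub (by omega), Nat.cast_one]
  refine decaysNear_of_ne ht hs0 hs ψ (fun x => c * x ^ m) (by fun_prop)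
    (fun v => c * m * v ^ (m - 1)) ?_ (η := 1) (R := 1)
    (M := |c * m| * (2 ^ (m - 1) * (2 + |x₀|) ^ (m - 1))) one_pos one_pos ?_ ?_ ?_ hne.symm hz
  · intro μ hμ v
    rw [mul_pow, Real.rpow_mul hμ.le, ← hcast, Real.rpow_natCast]
    ring
  · intro μ _ v _
    refine ((hasDerivAt_pow m (μ ^ t * v)).const_mul c).congr_deriv ?_
    ring
  · exact (contDiff_const.mul (contDiff_id.pow _)).contDiffOn
  · intro v hv j
    rw [iteratedDeriv_const_mul_field, iteratedDeriv_pow, abs_mul (c * m), abs_mul _ (v ^ _), abs_pow,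
      Nat.abs_cast, one_pow, mul_one, mul_assoc, Nat.descFactorial_eq_factorial_mul_choose, Nat.cast_mul]
    have h1 : ((m - 1).choose j : ℝ) ≤ 2 ^ (m - 1) := by exact_mod_cast Nat.choose_le_two_pow _ _
    have hv' : |v| ≤ 1 + |x₀| := by
      rw [Metric.mem_ball, Real.dist_eq] at hv
      calc |v| = |(v - x₀) + x₀| := by congr 1; ring
        _ ≤ |v - x₀| + |x₀| := abs_add_le _ _
        _ ≤ _ := by linarith
    have h2 : |v| ^ (m - 1 - j) ≤ (2 + |x₀|) ^ (m - 1) := by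
      calc |v| ^ (m - 1 - j) ≤ (2 + |x₀|) ^ (m - 1 - j) := by
            gcongr
            linarith
        _ ≤ _ := pow_le_pow_right₀ (by linarith [abs_nonneg x₀]) (Nat.sub_le _ _)
    calc |c * m| * (j ! * (m - 1).choose j * |v| ^ (m - 1 - j))
        ≤ |c * m| * (j ! * 2 ^ (m - 1) * (2 + |x₀|) ^ (m - 1)) := by gcongr
      _ = _ := by ring

/-- The derivative `c α sgn(v) |v|^{α - 1}` of the phase `c |v|^α`. -/
def powerSlope (c α : ℝ) (v : ℝ) : ℝ := c * α * Real.sign v * |v| ^ (α - 1)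

theorem sign_mul_of_pos {κ : ℝ} (hκ : 0 < κ) (v : ℝ) : Real.sign (κ * v) = Real.sign v := by
  rcases lt_trichotomy v 0 with hv | rfl | hv
  · rw [Real.sign_of_neg hv, Real.sign_of_neg (mul_neg_of_pos_of_neg hκ hv)]
  · simp
  · rw [Real.sign_of_pos hv, Real.sign_of_pos (mul_pos hκ hv)]

theorem powerSlope_homogeneous (c α : ℝ) {t μ : ℝ} (hμ : 0 < μ) (v : ℝ) :
    powerSlope c α (μ ^ t * v) = μ ^ (t * (α - 1)) * powerSlope c α v := by
  have hμt : 0 < μ ^ t := by positivity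
  rw [powerSlope, powerSlope, sign_mul_of_pos hμt, abs_mul, abs_of_pos hμt,
    Real.mul_rpow hμt.le (abs_nonneg v), ← Real.rpow_mul hμ.le]
  ring

theorem powerSlope_neg (c α v : ℝ) : powerSlope c α (-v) = -powerSlope c α v := by
  have : Real.sign (-v) = -Real.sign v := by
    rcases lt_trichotomy v 0 with hv | rfl | hv
    · rw [Real.sign_of_neg hv, Real.sign_of_pos (neg_pos.2 hv), neg_neg]
    · simp
    · rw [Real.sign_of_pos hv, Real.sign_of_neg (neg_neg_iff_pos.2 hv)]
  rw [powerSlope, powerSlope, this, abs_neg]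
  ring

theorem hasDerivAt_abs_rpow (c α : ℝ) {v : ℝ} (hv : v ≠ 0) :
    HasDerivAt (fun x => c * |x| ^ α) (powerSlope c α v) v := by
  have h := ((hasDerivAt_abs hv).rpow_const (p := α) (Or.inl (abs_ne_zero.2 hv))).const_mul c
  refine h.congr_deriv ?_
  have : ((SignType.sign v : SignType) : ℝ) = Real.sign v := by
    rcases lt_or_gt_of_ne hv with hv | hv
    · rw [Real.sign_of_neg hv, sign_neg hv]; simp
    · rw [Real.sign_of_pos hv, sign_pos hv]; simp
  rw [powerSlope, this]
  ring

theorem contDiffAt_powerSlope (c α : ℝ) {v : ℝ} (hv : v ≠ 0) :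
    ContDiffAt ℝ ∞ (powerSlope c α) v := by
  have hsign : ∀ᶠ w in nhds v, Real.sign w = Real.sign v := by
    rcases lt_or_gt_of_ne hv with hv | hv
    · filter_upwards [eventually_lt_nhds hv] with w hw
      rw [Real.sign_of_neg hv, Real.sign_of_neg hw]
    · filter_upwards [eventually_gt_nhds hv] with w hw
      rw [Real.sign_of_pos hv, Real.sign_of_pos hw]
  have h : ContDiffAt ℝ ∞ (fun w => c * α * Real.sign v * |w| ^ (α - 1)) v :=
    contDiffAt_const.mul
      ((Real.contDiffAt_rpow_const_of_ne (abs_ne_zero.2 hv)).comp v (contDiffAt_abs hv))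
  refine h.congr_of_eventuallyEq ?_
  filter_upwards [hsign] with w hw
  rw [powerSlope, hw]

theorem abs_descPochhammer_eval_le {β : ℝ} (hβ : 0 ≤ β) (j : ℕ) :
    |(descPochhammer ℝ j).eval β| ≤ (1 + β) ^ j * j ! := by
  induction j with
  | zero => simp
  | succ j ih =>
    rw [descPochhammer_succ_eval, abs_mul, Nat.factorial_succ, Nat.cast_mul]
    have h1 : |β - j| ≤ (1 + β) * ((j + 1 : ℕ) : ℝ) := by
      have hj : (0 : ℝ) ≤ j := Nat.cast_nonneg j
      have := mul_nonneg hβ hj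
      push_cast
      rw [abs_le]
      constructor <;> nlinarith
    calc _ ≤ ((1 + β) ^ j * j !) * ((1 + β) * ((j + 1 : ℕ) : ℝ)) := by gcongr
      _ = _ := by ring

theorem abs_iteratedDeriv_powerSlope_of_pos (c α : ℝ) {v : ℝ} (hv : 0 < v) (j : ℕ) :
    |iteratedDeriv j (powerSlope c α) v| =
      |c * α| * (|(descPochhammer ℝ j).eval (α - 1)| * v ^ (α - 1 - j)) := by
  have h : powerSlope c α =ᶠ[nhds v] fun w => c * α * w ^ (α - 1) := by
    filter_upwards [eventually_gt_nhds hv] with w hw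
    rw [powerSlope, Real.sign_of_pos hw, abs_of_pos hw, mul_one]
  rw [h.iteratedDeriv_eq, iteratedDeriv_const_mul_field, iteratedDeriv_eq_iterate,
    Real.iter_deriv_rpow_const, abs_mul (c * α), abs_mul _ (v ^ _),
    abs_of_pos (a := v ^ (α - 1 - j)) (by positivity)]

theorem abs_iteratedDeriv_powerSlope (c α : ℝ) {v : ℝ} (hv : v ≠ 0) (j : ℕ) :
    |iteratedDeriv j (powerSlope c α) v| =
      |c * α| * (|(descPochhammer ℝ j).eval (α - 1)| * |v| ^ (α - 1 - j)) := by
  rcases lt_or_gt_of_ne hv with hv | hv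
  · have h := iteratedDeriv_comp_neg j (powerSlope c α) (-v)
    have e : (fun x => powerSlope c α (-x)) = -powerSlope c α := funext fun x =>
      powerSlope_neg c α x
    rw [e, iteratedDeriv_neg, neg_neg] at h
    have h2 := congrArg abs h
    rw [abs_neg, smul_eq_mul, abs_mul, abs_pow, abs_neg, abs_one, one_pow, one_mul,
      abs_iteratedDeriv_powerSlope_of_pos c α (neg_pos.2 hv)] at h2
    rw [← h2, abs_of_neg hv]
  · rw [abs_iteratedDeriv_powerSlope_of_pos c α hv, abs_of_pos hv]

/-- Away from `0` the slope is analytic. In `R = α * (2 / |x₀|)` the factor `α` comes from the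
falling factorials of `α - 1`, bounded by `α ^ j * j !`, and `2 / |x₀|` from `|v| ≥ |x₀| / 2` on the
ball. -/
theorem decaysNear_powerChirp {c α t : ℝ} (hα : 1 < α) (hα0 : 0 ≤ α) (ht : 0 < t)
    (hs0 : 0 < t * (α - 1)) (hs : 1 < t * (α - 1)) (ψ : Space t (t * (α - 1)))
    {x₀ ξ₀ : ℝ} (hx₀ : x₀ ≠ 0) (hne : ξ₀ ≠ powerSlope c α x₀) :
    DecaysNear ht hs0 ψ (ofFunction t _ (powerChirp c α hα0)) (x₀, ξ₀) := by
  have hx : 0 < |x₀| := abs_pos.2 hx₀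
  have hball : ∀ v ∈ Metric.ball x₀ (|x₀| / 2), |x₀| / 2 ≤ |v| ∧ |v| ≤ 2 * |x₀| := by
    intro v hv
    rw [Metric.mem_ball, Real.dist_eq] at hv
    have h1 := abs_sub_abs_le_abs_sub v x₀
    have h2 := abs_sub_abs_le_abs_sub x₀ v
    rw [abs_sub_comm x₀ v] at h2
    constructor <;> linarith
  have hball0 : ∀ v ∈ Metric.ball x₀ (|x₀| / 2), v ≠ 0 := fun v hv =>
    abs_pos.1 ((half_pos hx).trans_le (hball v hv).1)
  refine decaysNear_of_ne ht hs0 hs ψ (fun x => c * |x| ^ α)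
    (continuous_const.mul (continuous_abs.rpow_const fun _ => Or.inr hα0))
    (powerSlope c α) (fun μ hμ v => powerSlope_homogeneous c α hμ v) (η := |x₀| / 2)
    (R := α * (2 / |x₀|)) (M := |c * α| * (2 * |x₀|) ^ (α - 1)) (half_pos hx)
    (by positivity) ?_ ?_ ?_ hne.symm (fun h => hx₀ (congrArg Prod.fst h))
  · intro μ hμ v hv
    exact hasDerivAt_abs_rpow c α (mul_ne_zero (by positivity) (hball0 v hv))
  · exact fun v hv => (contDiffAt_powerSlope c α (hball0 v hv)).contDiffWithinAt
  · intro v hv j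
    obtain ⟨h1, h2⟩ := hball v hv
    have hv0 : 0 < |v| := (half_pos hx).trans_le h1
    have h3 := abs_descPochhammer_eval_le (β := α - 1) (by linarith) j
    rw [add_sub_cancel] at h3
    have h4 : |v| ^ (α - 1 - j) ≤ (2 * |x₀|) ^ (α - 1) * (2 / |x₀|) ^ j := by
      rw [Real.rpow_sub hv0, Real.rpow_natCast, div_eq_mul_inv, ← inv_pow]
      have h5 : |v|⁻¹ ≤ 2 / |x₀| := by
        rw [← inv_div]
        exact inv_anti₀ (half_pos hx) h1
      have h6 : |v| ^ (α - 1) ≤ (2 * |x₀|) ^ (α - 1) :=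
        Real.rpow_le_rpow hv0.le h2 (by linarith)
      gcongr
    rw [abs_iteratedDeriv_powerSlope c α (hball0 v hv)]
    calc _ ≤ |c * α| * ((α ^ j * j !) * ((2 * |x₀|) ^ (α - 1) * (2 / |x₀|) ^ j)) := by gcongr
      _ = _ := by rw [mul_pow]; ring

/-! ### Decay along a vertical line forces the window to vanish -/

theorem norm_fourier_oscillation {t s : ℝ} (ht : 0 < t) (hs : 0 < s) (ψ : Space t s) (θ : ℝ → ℝ)
    (hθ : Continuous θ) (x v : ℝ) :
    ‖stft ht hs ψ (ofFunction t s (oscillation θ hθ)) x (2 * Real.pi * v)‖ = stftConst *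
      ‖FourierTransform.fourier
        (fun y : ℝ => Complex.exp (Complex.I * θ y) * (starRingEnd ℂ) ((ψ : ℝ → ℂ) (y - x))) v‖ := by
  rw [stft_oscillation, norm_mul, Complex.norm_real, Real.norm_of_nonneg stftConst_pos.le,
    Real.fourier_eq']
  congr 2
  refine integral_congr_ae (Filter.Eventually.of_forall fun y => ?_)
  simp only [map_mul, smul_eq_mul]
  rw [← Complex.exp_conj, map_mul, Complex.conj_I, Complex.conj_ofReal, mul_left_comm]
  congr 2
  simp only [RCLike.inner_apply, conj_trivial]
  push_cast
  ring

theorem norm_le_integral_norm_fourier {F : ℝ → ℂ} (hF : Continuous F) (hFi : Integrable F)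
    {B : ℝ → ℝ} (hB : Integrable B) (h : ∀ v, ‖FourierTransform.fourier F v‖ ≤ B v) (y : ℝ) :
    ‖F y‖ ≤ ∫ v, B v := by
  have hc : Continuous (FourierTransform.fourier F) :=
    VectorFourier.fourierIntegral_continuous Real.continuous_fourierChar
      (by exact (continuous_inner (𝕜 := ℝ) (E := ℝ))) hFi
  have hi : Integrable (FourierTransform.fourier F) :=
    hB.mono' hc.aestronglyMeasurable (Filter.Eventually.of_forall h)
  have hinv := congrFun (hF.fourierInv_fourier_eq hFi hi) y
  rw [← hinv, Real.fourierInv_eq']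
  refine norm_integral_le_of_norm_le hB (Filter.Eventually.of_forall fun v => ?_)
  rw [norm_smul, Complex.norm_exp_ofReal_mul_I, one_mul]
  exact h v

theorem exists_compact_bound {t s : ℝ} {ht : 0 < t} {hs : 0 < s} {ψ : Space t s}
    {u : Ultradistribution t s} {x₀ : ℝ} (h : ∀ ξ, DecaysNear ht hs ψ u (x₀, ξ)) (L : ℝ) :
    ∃ C : ℝ, ∀ ξ ∈ Set.Icc (-L) L, ∀ μ : ℝ, 0 < μ →
      Real.exp μ * ‖stft ht hs ψ u (μ ^ t * x₀) (μ ^ s * ξ)‖ ≤ C := by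
  refine (isCompact_Icc (a := -L) (b := L)).induction_on (p := fun S => ∃ C : ℝ, ∀ ξ ∈ S,
    ∀ μ : ℝ, 0 < μ → Real.exp μ * ‖stft ht hs ψ u (μ ^ t * x₀) (μ ^ s * ξ)‖ ≤ C) ?_ ?_ ?_ ?_
  · exact ⟨0, fun ξ hξ => hξ.elim⟩
  · rintro S T hST ⟨C, hC⟩
    exact ⟨C, fun ξ hξ => hC ξ (hST hξ)⟩
  · rintro S T ⟨C, hC⟩ ⟨D, hD⟩
    refine ⟨max C D, fun ξ hξ μ hμ => ?_⟩
    rcases hξ with hξ | hξ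
    · exact (hC ξ hξ μ hμ).trans (le_max_left _ _)
    · exact (hD ξ hξ μ hμ).trans (le_max_right _ _)
  · intro ξ _
    obtain ⟨U, hU, -, hzU, hC⟩ := h ξ
    obtain ⟨C, hC⟩ := hC 1 one_pos
    refine ⟨(fun η : ℝ => (x₀, η)) ⁻¹' U, mem_nhdsWithin_of_mem_nhds
      ((hU.preimage (by fun_prop)).mem_nhds hzU), C, fun η hη μ hμ => ?_⟩
    have := hC μ hμ _ hη
    rwa [one_mul] at this

/-- The point `(μ ^ t * x₀, μ ^ s * (k * σ))` also lies on the curve through `(x₀ / k ^ (t / s),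
σ)`, at parameter `μ * k ^ s⁻¹`. For large `k` this base point is close to `(0, σ)`, so regularity
there controls the far part of every vertical line. -/
theorem exists_vertical_bound {t s : ℝ} {ht : 0 < t} {hs : 0 < s} {ψ : Space t s}
    {u : Ultradistribution t s} {σ : ℝ} (h : DecaysNear ht hs ψ u (0, σ)) (x₀ : ℝ) :
    ∃ L : ℝ, 1 ≤ L ∧ ∃ C : ℝ, ∀ μ : ℝ, 0 < μ → ∀ k : ℝ, L ≤ k →
      Real.exp (2 * (μ * k ^ s⁻¹)) * ‖stft ht hs ψ u (μ ^ t * x₀) (μ ^ s * (k * σ))‖ ≤ C := by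
  obtain ⟨U, hU, -, hzU, hC⟩ := h
  obtain ⟨C, hC⟩ := hC 2 two_pos
  have hnhds : (fun x : ℝ => (x, σ)) ⁻¹' U ∈ nhds (0 : ℝ) :=
    (hU.preimage (by fun_prop)).mem_nhds hzU
  obtain ⟨e, he, heU⟩ := Metric.mem_nhds_iff.1 hnhds
  have hbase : 0 < |x₀| / e + 1 := by positivity
  refine ⟨max 1 ((|x₀| / e + 1) ^ (s / t)), le_max_left _ _, C, fun μ hμ k hk => ?_⟩
  have hk1 : 1 ≤ k := (le_max_left _ _).trans hk
  have hk0 : 0 < k := one_pos.trans_le hk1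
  have hkt : |x₀| / e + 1 ≤ k ^ (t / s) := by
    have := Real.rpow_le_rpow (by positivity) ((le_max_right _ _).trans hk)
      (by positivity : 0 ≤ t / s)
    rwa [← Real.rpow_mul hbase.le, div_mul_div_cancel₀ ht.ne', div_self hs.ne', Real.rpow_one] at this
  have hktpos : 0 < k ^ (t / s) := by positivity
  have hmem : (x₀ / k ^ (t / s), σ) ∈ U := by
    change x₀ / k ^ (t / s) ∈ (fun x : ℝ => (x, σ)) ⁻¹' U
    refine heU ?_
    rw [Metric.mem_ball, Real.dist_eq, sub_zero, abs_div, abs_of_pos hktpos, div_lt_iff₀ hktpos]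
    have h1 : |x₀| / e < k ^ (t / s) := by linarith
    rw [div_lt_iff₀ he] at h1
    linarith
  have := hC (μ * k ^ s⁻¹) (by positivity) _ hmem
  have e1 : (μ * k ^ s⁻¹) ^ t * (x₀ / k ^ (t / s)) = μ ^ t * x₀ := by
    rw [Real.mul_rpow hμ.le (by positivity), ← Real.rpow_mul hk0.le,
      show s⁻¹ * t = t / s by field_simp]
    field_simp
  have e2 : (μ * k ^ s⁻¹) ^ s * σ = μ ^ s * (k * σ) := by
    rw [Real.mul_rpow hμ.le (by positivity), ← Real.rpow_mul hk0.le, inv_mul_cancel₀ hs.ne',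
      Real.rpow_one]
    ring
  rwa [e1, e2] at this

theorem exists_line_bound {t s : ℝ} {ht : 0 < t} {hs : 0 < s} {ψ : Space t s}
    {u : Ultradistribution t s} {x₀ : ℝ} (h : ∀ ξ, DecaysNear ht hs ψ u (x₀, ξ))
    (hpos : DecaysNear ht hs ψ u (0, 1)) (hneg : DecaysNear ht hs ψ u (0, -1)) :
    ∃ C : ℝ, 0 ≤ C ∧ ∀ μ : ℝ, 1 ≤ μ → ∀ ξ : ℝ,
      ‖stft ht hs ψ u (μ ^ t * x₀) (μ ^ s * ξ)‖ ≤
        C * Real.exp (-μ) * Real.exp (-(1 * |ξ| ^ s⁻¹)) := by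
  obtain ⟨L₁, hL₁, C₁, hC₁⟩ := exists_vertical_bound hpos x₀
  obtain ⟨L₂, hL₂, C₂, hC₂⟩ := exists_vertical_bound hneg x₀
  set L := max L₁ L₂
  have hL : 1 ≤ L := hL₁.trans (le_max_left _ _)
  obtain ⟨C₃, hC₃⟩ := exists_compact_bound h L
  -- The rate `2` allows the product to be split: `2 * (μ * κ) ≥ μ + κ` whenever `μ` and `κ = k ^
  -- s⁻¹` are at least `1`.
  have hfar : ∀ {μ k V D : ℝ}, 1 ≤ μ → 1 ≤ k → Real.exp (2 * (μ * k ^ s⁻¹)) * V ≤ D → 0 ≤ V →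
      V ≤ |D| * Real.exp (-μ) * Real.exp (-(1 * k ^ s⁻¹)) := by
    intro μ k V D hμ hk hD hV
    have hk' : 1 ≤ k ^ s⁻¹ := Real.one_le_rpow hk (inv_nonneg.2 hs.le)
    rw [mul_assoc, ← Real.exp_add, ← div_le_iff₀ (Real.exp_pos _), div_eq_mul_inv, ← Real.exp_neg]
    refine le_trans ?_ (hD.trans (le_abs_self D))
    rw [mul_comm]
    refine mul_le_mul_of_nonneg_right (Real.exp_le_exp.2 ?_) hV
    nlinarith
  refine ⟨|C₁| + |C₂| + |C₃| * Real.exp (L ^ s⁻¹), by positivity, fun μ hμ ξ => ?_⟩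
  have hμ0 : 0 < μ := one_pos.trans_le hμ
  have hE : 0 ≤ Real.exp (-μ) * Real.exp (-(1 * |ξ| ^ s⁻¹)) := by positivity
  rw [mul_assoc, add_mul, add_mul]
  have n1 : 0 ≤ |C₁| * (Real.exp (-μ) * Real.exp (-(1 * |ξ| ^ s⁻¹))) := by positivity
  have n2 : 0 ≤ |C₂| * (Real.exp (-μ) * Real.exp (-(1 * |ξ| ^ s⁻¹))) := by positivity
  have n3 : 0 ≤ |C₃| * Real.exp (L ^ s⁻¹) * (Real.exp (-μ) * Real.exp (-(1 * |ξ| ^ s⁻¹))) := by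
    positivity
  rcases le_or_gt |ξ| L with hξ | hξ
  · have h3 := (hC₃ ξ (abs_le.1 hξ) μ hμ0).trans (le_abs_self C₃)
    rw [mul_comm, ← le_div_iff₀ (Real.exp_pos _), div_eq_mul_inv, ← Real.exp_neg] at h3
    have h4 : |ξ| ^ s⁻¹ ≤ L ^ s⁻¹ := Real.rpow_le_rpow (abs_nonneg ξ) hξ (inv_nonneg.2 hs.le)
    have h5 : 1 ≤ Real.exp (L ^ s⁻¹) * Real.exp (-(1 * |ξ| ^ s⁻¹)) := by
      rw [← Real.exp_add]
      exact Real.one_le_exp (by linarith)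
    have h6 : |C₃| * Real.exp (-μ) * 1 ≤
        |C₃| * Real.exp (-μ) * (Real.exp (L ^ s⁻¹) * Real.exp (-(1 * |ξ| ^ s⁻¹))) := by gcongr
    linarith
  · have hξ1 : 1 ≤ |ξ| := hL.trans hξ.le
    rcases le_total 0 ξ with hs0 | hs0
    · have := hfar hμ hξ1 (hC₁ μ hμ0 |ξ| ((le_max_left _ _).trans hξ.le)) (norm_nonneg _)
      rw [mul_one, mul_assoc, abs_of_nonneg hs0] at this
      rw [abs_of_nonneg hs0] at n1 n2 n3 ⊢
      linarith
    · have := hfar hμ hξ1 (hC₂ μ hμ0 |ξ| ((le_max_right _ _).trans hξ.le)) (norm_nonneg _)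
      rw [mul_neg_one, mul_assoc, abs_of_nonpos hs0, neg_neg] at this
      rw [abs_of_nonpos hs0] at n1 n2 n3 ⊢
      linarith

/-- On the line over `X = μ ^ t * x₀` the transform is, up to constants, the Fourier transform of a
function whose modulus at `y + X` is `|ψ y|`. Inversion bounds `|ψ y|` by the integral along the
line, of size `μ ^ s * exp (-μ)` after rescaling, which tends to zero. -/
theorem eq_zero_of_decaysNear {t s : ℝ} {ht : 0 < t} {hs : 0 < s} {ψ : Space t s} {θ : ℝ → ℝ}
    {hθ : Continuous θ} {x₀ : ℝ}
    (h : ∀ ξ, DecaysNear ht hs ψ (ofFunction t s (oscillation θ hθ)) (x₀, ξ))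
    (hpos : DecaysNear ht hs ψ (ofFunction t s (oscillation θ hθ)) (0, 1))
    (hneg : DecaysNear ht hs ψ (ofFunction t s (oscillation θ hθ)) (0, -1)) : ψ = 0 := by
  obtain ⟨C, hC0, hC⟩ := exists_line_bound h hpos hneg
  have hInt := integrable_exp_neg_abs_rpow hs one_pos
  set I := ∫ v : ℝ, Real.exp (-(1 * |v| ^ s⁻¹)) with hI
  have hI0 : 0 ≤ I := integral_nonneg fun v => (Real.exp_pos _).le
  obtain ⟨K, hK0, hK⟩ := exists_rpow_le_exp hs.le (r := 1 / 2) (by norm_num)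
  have hc0 := stftConst_pos
  ext y
  set D := C / stftConst * I / (2 * Real.pi) * K with hD
  have hbound : ∀ μ : ℝ, 1 ≤ μ → ‖(ψ : ℝ → ℂ) y‖ ≤ D * Real.exp (-(1 / 2 * μ)) := by
    intro μ hμ
    have hμ0 : 0 < μ := one_pos.trans_le hμ
    have hμs : 0 < μ ^ s := by positivity
    set X := μ ^ t * x₀
    set F : ℝ → ℂ := fun y => Complex.exp (Complex.I * θ y) *
      (starRingEnd ℂ) ((ψ : ℝ → ℂ) (y - X)) with hF
    have hψc := ψ.2.1.continuous
    have hFc : Continuous F := by fun_prop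
    have hFn : ∀ y, ‖F y‖ = ‖(ψ : ℝ → ℂ) (y - X)‖ := fun y => by
      rw [hF]
      simp only
      rw [norm_mul, mul_comm Complex.I, Complex.norm_exp_ofReal_mul_I, one_mul, RCLike.norm_conj]
    have hFi : Integrable F :=
      ((integrable_coe ψ).comp_sub_right X).norm.mono' hFc.aestronglyMeasurable
        (Filter.Eventually.of_forall fun y => (hFn y).le)
    have hB := (hInt.comp_mul_left' (R := 2 * Real.pi / μ ^ s) (by positivity)).const_mul
      (C / stftConst * Real.exp (-μ))
    have hle := norm_le_integral_norm_fourier hFc hFi hB (fun v => ?_) (y + X)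
    · rw [hFn, add_sub_cancel_right, integral_const_mul,
        Measure.integral_comp_mul_left (fun v => Real.exp (-(1 * |v| ^ s⁻¹))), ← hI, smul_eq_mul,
        abs_of_pos (by positivity), inv_div] at hle
      have hKμ := hK μ hμ0.le
      have he : Real.exp (-μ) * Real.exp (1 / 2 * μ) = Real.exp (-(1 / 2 * μ)) := by
        rw [← Real.exp_add]; congr 1; ring
      calc ‖(ψ : ℝ → ℂ) y‖ ≤ _ := hle
        _ = C / stftConst * I / (2 * Real.pi) * Real.exp (-μ) * μ ^ s := by ring
        _ ≤ C / stftConst * I / (2 * Real.pi) * Real.exp (-μ) * (K * Real.exp (1 / 2 * μ)) := by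
            gcongr
        _ = C / stftConst * I / (2 * Real.pi) * K * (Real.exp (-μ) * Real.exp (1 / 2 * μ)) := by
            ring
        _ = _ := by rw [he]
    · have h1 := norm_fourier_oscillation ht hs ψ θ hθ X v
      have h2 := hC μ hμ (2 * Real.pi / μ ^ s * v)
      rw [show μ ^ s * (2 * Real.pi / μ ^ s * v) = 2 * Real.pi * v by field_simp, h1] at h2
      rw [← mul_le_mul_iff_right₀ hc0]
      refine h2.trans (le_of_eq ?_)
      field_simp
  have hlim : Filter.Tendsto (fun μ : ℝ => D * Real.exp (-(1 / 2 * μ))) Filter.atTop (nhds 0) := by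
    rw [← mul_zero D]
    refine (Real.tendsto_exp_neg_atTop_nhds_zero.comp ?_).const_mul D
    exact Filter.tendsto_id.const_mul_atTop (by norm_num)
  have := ge_of_tendsto hlim ((Filter.eventually_ge_atTop 1).mono hbound)
  exact norm_le_zero_iff.1 this

/-! ### The kernel `(1 + i y)^{-(n+1)}` -/

theorem integrableOn_pow_mul_exp {z : ℂ} (hz : 0 < z.re) (n : ℕ) :
    IntegrableOn (fun ξ : ℝ => (ξ : ℂ) ^ n * Complex.exp (-(z * ξ))) (Set.Ioi 0) := by
  have h := integrableOn_rpow_mul_exp_neg_mul_rpow (p := 1) (s := n) (b := z.re)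
    (by have := Nat.cast_nonneg (α := ℝ) n; linarith) one_pos hz
  refine Integrable.mono' h ?_ ?_
  · exact Continuous.aestronglyMeasurable (by fun_prop)
  · refine (ae_restrict_mem measurableSet_Ioi).mono fun ξ hξ => le_of_eq ?_
    rw [norm_mul, norm_pow, Complex.norm_real, Real.norm_of_nonneg (le_of_lt hξ), Complex.norm_exp,
      Real.rpow_natCast, Real.rpow_one]
    simp

theorem integral_pow_mul_exp {z : ℂ} (hz : 0 < z.re) (n : ℕ) :
    ∫ ξ : ℝ in Set.Ioi 0, (ξ : ℂ) ^ n * Complex.exp (-(z * ξ)) = n ! / z ^ (n + 1) := by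
  have hz0 : z ≠ 0 := fun h => by simp [h] at hz
  have hexp : ∀ ξ : ℝ, HasDerivAt (fun ξ : ℝ => Complex.exp (-(z * ξ)))
      (Complex.exp (-(z * ξ)) * -z) ξ := fun ξ => by
    have := ((hasDerivAt_id ξ).ofReal_comp.const_mul z).neg.cexp
    simpa using this
  have hlim : ∀ n : ℕ, Filter.Tendsto (fun ξ : ℝ => (ξ : ℂ) ^ n * Complex.exp (-(z * ξ)))
      Filter.atTop (nhds 0) := by
    intro n
    rw [tendsto_zero_iff_norm_tendsto_zero]
    refine (tendsto_rpow_mul_exp_neg_mul_atTop_nhds_zero n z.re hz).congr' ?_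
    filter_upwards [Filter.eventually_ge_atTop 0] with ξ hξ
    rw [norm_mul, norm_pow, Complex.norm_real, Real.norm_of_nonneg hξ, Complex.norm_exp,
      Real.rpow_natCast]
    simp
  induction n with
  | zero =>
    have h := integral_Ioi_of_hasDerivAt_of_tendsto' (a := 0) (fun ξ _ => hexp ξ) ?_
      (by simpa using hlim 0)
    · rw [integral_mul_const] at h
      simp only [pow_zero, one_mul, zero_add, pow_one, Nat.factorial_zero, Nat.cast_one]
      rw [eq_div_iff hz0]
      simp only [Complex.ofReal_zero, mul_zero, neg_zero, Complex.exp_zero, zero_sub] at h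
      linear_combination -h
    · have := (integrableOn_pow_mul_exp hz 0).mul_const (-z)
      simp only [pow_zero, one_mul] at this
      exact this
  | succ n ih =>
    have hder : ∀ ξ ∈ Set.Ici (0 : ℝ), HasDerivAt
        (fun ξ : ℝ => (ξ : ℂ) ^ (n + 1) * Complex.exp (-(z * ξ)))
        ((n + 1 : ℂ) * ((ξ : ℂ) ^ n * Complex.exp (-(z * ξ))) -
          z * ((ξ : ℂ) ^ (n + 1) * Complex.exp (-(z * ξ)))) ξ := by
      intro ξ _
      have h1 : HasDerivAt (fun ξ : ℝ => (ξ : ℂ) ^ (n + 1)) ((n + 1 : ℂ) * (ξ : ℂ) ^ n) ξ := by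
        refine ((hasDerivAt_id ξ).ofReal_comp.pow (n + 1)).congr_deriv ?_
        simp
      refine (h1.mul (hexp ξ)).congr_deriv ?_
      ring
    have i1 := (integrableOn_pow_mul_exp hz n).const_mul (n + 1 : ℂ)
    have i2 := (integrableOn_pow_mul_exp hz (n + 1)).const_mul z
    have h := integral_Ioi_of_hasDerivAt_of_tendsto' hder (i1.sub i2) (hlim (n + 1))
    rw [integral_sub i1 i2, integral_const_mul, integral_const_mul, ih] at h
    simp only [Complex.ofReal_zero, ne_eq, Nat.add_eq_zero_iff, one_ne_zero, and_false,
      not_false_eq_true, zero_pow, zero_mul, sub_zero] at h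
    rw [eq_div_iff (pow_ne_zero _ hz0), Nat.factorial_succ]
    rw [sub_eq_zero, ← mul_div_assoc, div_eq_iff (pow_ne_zero _ hz0)] at h
    push_cast
    rw [h]
    ring

/-! ### Rotation of the half line of integration -/

theorem half_one_add_sq_le {τ : ℝ} (hτ : -(1 / 2) ≤ Real.cos τ) {y : ℝ} (hy : 0 ≤ y) :
    (1 + y ^ 2) / 2 ≤ ‖1 + Complex.exp (τ * Complex.I) * y‖ ^ 2 := by
  rw [Complex.sq_norm, Complex.normSq_apply]
  simp only [Complex.add_re, Complex.one_re, Complex.mul_re, Complex.exp_ofReal_mul_I_re,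
    Complex.ofReal_re, Complex.exp_ofReal_mul_I_im, Complex.ofReal_im, mul_zero, sub_zero,
    Complex.add_im, Complex.one_im, Complex.mul_im, zero_add]
  have h1 := Real.sin_sq_add_cos_sq τ
  have h2 := mul_le_mul_of_nonneg_right hτ hy
  have h3 : (Real.sin τ) ^ 2 * y ^ 2 + (Real.cos τ) ^ 2 * y ^ 2 = y ^ 2 := by
    rw [← add_mul, h1, one_mul]
  nlinarith [sq_nonneg (1 - y)]

theorem rpow_mul_inv_pow_le {τ : ℝ} (hτ : -(1 / 2) ≤ Real.cos τ) {y : ℝ} (hy : 0 ≤ y) {β : ℝ}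
    (hβ : 0 ≤ β) {q : ℕ} (hβq : β + 2 ≤ q) :
    y ^ β * (‖1 + Complex.exp (τ * Complex.I) * y‖ ^ q)⁻¹ ≤ 2 ^ q * (1 + y ^ 2)⁻¹ := by
  set N := ‖1 + Complex.exp (τ * Complex.I) * y‖ with hN
  have hN0 : 0 ≤ N := norm_nonneg _
  have h := half_one_add_sq_le hτ hy
  rw [← hN] at h
  set T := Real.sqrt (1 + y ^ 2) with hT
  have hT2 : T ^ 2 = 1 + y ^ 2 := Real.sq_sqrt (by positivity)
  have hT1 : 1 ≤ T := by rw [hT]; exact Real.one_le_sqrt.2 (by nlinarith)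
  have hyT : y ≤ T := Real.le_sqrt_of_sq_le (by linarith)
  have hTN : T ≤ 2 * N := by
    refine (sq_le_sq₀ (by positivity) (by positivity)).1 ?_
    nlinarith
  have hNpos : 0 < N := by linarith
  have h1 : y ^ β * T ^ 2 ≤ T ^ q := by
    calc y ^ β * T ^ 2 ≤ T ^ β * T ^ 2 := by
          gcongr
      _ = T ^ (β + 2) := by rw [Real.rpow_add (by linarith)]; norm_num
      _ ≤ T ^ (q : ℝ) := Real.rpow_le_rpow_of_exponent_le hT1 hβq
      _ = T ^ q := Real.rpow_natCast _ _
  have h2 : T ^ q ≤ 2 ^ q * N ^ q := by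
    rw [← mul_pow]
    gcongr
  rw [← hT2, ← div_eq_mul_inv, ← div_eq_mul_inv, div_le_div_iff₀ (by positivity) (by positivity)]
  exact h1.trans h2

theorem one_add_exp_mul_ne_zero {τ : ℝ} (hτ : -(1 / 2) ≤ Real.cos τ) {y : ℝ} (hy : 0 ≤ y) :
    1 + Complex.exp (τ * Complex.I) * y ≠ 0 := by
  intro h
  have := half_one_add_sq_le hτ hy
  rw [h, norm_zero] at this
  nlinarith [sq_nonneg y]

/-- The derivative of `y ^ (α + 1) / (1 + e^{iτ} y) ^ (n + 1)`. -/
def rayDeriv (α : ℝ) (n : ℕ) (τ y : ℝ) : ℂ :=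
  ((y ^ α : ℝ) : ℂ) * ((α + 1) * ((1 + Complex.exp (τ * Complex.I) * y) ^ (n + 1))⁻¹ -
    (n + 1) * (Complex.exp (τ * Complex.I) * y) *
      ((1 + Complex.exp (τ * Complex.I) * y) ^ (n + 2))⁻¹)

theorem hasDerivAt_ray {τ : ℝ} (hτ : -(1 / 2) ≤ Real.cos τ) (α : ℝ) (n : ℕ) {y : ℝ} (hy : 0 < y) :
    HasDerivAt (fun y : ℝ => ((y ^ (α + 1) : ℝ) : ℂ) *
        ((1 + Complex.exp (τ * Complex.I) * y) ^ (n + 1))⁻¹) (rayDeriv α n τ y) y := by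
  have hne := one_add_exp_mul_ne_zero hτ hy.le
  rw [rayDeriv]
  set v := Complex.exp (τ * Complex.I)
  have h1 : HasDerivAt (fun y : ℝ => ((y ^ (α + 1) : ℝ) : ℂ)) (((α + 1) * y ^ α : ℝ) : ℂ) y := by
    have := (Real.hasDerivAt_rpow_const (x := y) (p := α + 1) (Or.inl hy.ne')).ofReal_comp
    simpa using this
  have h2 : HasDerivAt (fun y : ℝ => 1 + v * (y : ℂ)) v y := by
    simpa using ((hasDerivAt_id y).ofReal_comp.const_mul v).const_add 1
  have h3 := (h2.pow (n + 1)).inv (pow_ne_zero _ hne)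
  refine (h1.mul h3).congr_deriv ?_
  rw [Real.rpow_add_one hy.ne']
  push_cast
  simp only [Pi.pow_apply, Pi.inv_apply]
  field_simp
  ring

theorem norm_rpow_mul_inv_pow_le {τ : ℝ} (hτ : -(1 / 2) ≤ Real.cos τ) {y : ℝ} (hy : 0 ≤ y) {β : ℝ}
    (hβ : 0 ≤ β) {q : ℕ} (hβq : β + 2 ≤ q) :
    ‖((y ^ β : ℝ) : ℂ) * ((1 + Complex.exp (τ * Complex.I) * y) ^ q)⁻¹‖ ≤
      2 ^ q * (1 + y ^ 2)⁻¹ := by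
  rw [norm_mul, norm_inv, norm_pow, Complex.norm_real, Real.norm_of_nonneg (by positivity)]
  exact rpow_mul_inv_pow_le hτ hy hβ hβq

theorem norm_rayDeriv_le {τ : ℝ} (hτ : -(1 / 2) ≤ Real.cos τ) {α : ℝ} (hα : 0 ≤ α) {n : ℕ}
    (hn : α + 2 ≤ n) {y : ℝ} (hy : 0 < y) :
    ‖rayDeriv α n τ y‖ ≤ ((α + 1) * 2 ^ (n + 1) + (n + 1) * 2 ^ (n + 2)) * (1 + y ^ 2)⁻¹ := by
  have h1 := norm_rpow_mul_inv_pow_le hτ hy.le hα (q := n + 1) (by push_cast; linarith)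
  have h2 := norm_rpow_mul_inv_pow_le hτ hy.le (β := α + 1) (by linarith) (q := n + 2)
    (by push_cast; linarith)
  have e : rayDeriv α n τ y =
      ((α + 1 : ℝ) : ℂ) *
        (((y ^ α : ℝ) : ℂ) * ((1 + Complex.exp (τ * Complex.I) * y) ^ (n + 1))⁻¹) -
      ((n + 1 : ℝ) : ℂ) * (Complex.exp (τ * Complex.I) *
        (((y ^ (α + 1) : ℝ) : ℂ) * ((1 + Complex.exp (τ * Complex.I) * y) ^ (n + 2))⁻¹)) := by
    rw [rayDeriv, Real.rpow_add_one hy.ne']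
    push_cast
    ring
  rw [e, add_mul, mul_assoc, mul_assoc]
  refine (norm_sub_le _ _).trans (add_le_add ?_ ?_)
  · rw [norm_mul, Complex.norm_real, Real.norm_of_nonneg (by linarith)]
    gcongr
  · rw [norm_mul, norm_mul, Complex.norm_real, Real.norm_of_nonneg (by positivity),
      Complex.norm_exp_ofReal_mul_I, one_mul]
    gcongr

theorem continuousOn_ray {τ : ℝ} (hτ : -(1 / 2) ≤ Real.cos τ) {β : ℝ} (hβ : 0 ≤ β) (q : ℕ) :
    ContinuousOn (fun y : ℝ => ((y ^ β : ℝ) : ℂ) *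
      ((1 + Complex.exp (τ * Complex.I) * y) ^ q)⁻¹) (Set.Ici 0) := by
  refine ContinuousOn.mul (Continuous.continuousOn ?_) (ContinuousOn.inv₀ (by fun_prop) ?_)
  · exact Complex.continuous_ofReal.comp (Real.continuous_rpow_const hβ)
  · exact fun y hy => pow_ne_zero _ (one_add_exp_mul_ne_zero hτ hy)

theorem integrableOn_ray {τ : ℝ} (hτ : -(1 / 2) ≤ Real.cos τ) {β : ℝ} (hβ : 0 ≤ β) {q : ℕ}
    (hβq : β + 2 ≤ q) :
    IntegrableOn (fun y : ℝ => ((y ^ β : ℝ) : ℂ) *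
      ((1 + Complex.exp (τ * Complex.I) * y) ^ q)⁻¹) (Set.Ioi 0) := by
  refine Integrable.mono' (integrable_inv_one_add_sq.const_mul (2 ^ q)).integrableOn ?_ ?_
  · exact ((continuousOn_ray hτ hβ q).mono Set.Ioi_subset_Ici_self).aestronglyMeasurable
      measurableSet_Ioi
  · exact (ae_restrict_mem measurableSet_Ioi).mono fun y hy =>
      norm_rpow_mul_inv_pow_le hτ (le_of_lt hy) hβ hβq

theorem continuousOn_rayDeriv {τ : ℝ} (hτ : -(1 / 2) ≤ Real.cos τ) {α : ℝ} (hα : 0 ≤ α) (n : ℕ) :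
    ContinuousOn (rayDeriv α n τ) (Set.Ioi 0) := by
  have hne : ∀ y ∈ Set.Ioi (0 : ℝ), 1 + Complex.exp (τ * Complex.I) * y ≠ 0 := fun y hy =>
    one_add_exp_mul_ne_zero hτ (le_of_lt hy)
  refine ContinuousOn.mul (Continuous.continuousOn ?_) (ContinuousOn.sub ?_ ?_)
  · exact Complex.continuous_ofReal.comp (Real.continuous_rpow_const hα)
  · exact continuousOn_const.mul
      (ContinuousOn.inv₀ (by fun_prop) fun y hy => pow_ne_zero _ (hne y hy))
  · exact ContinuousOn.mul (by fun_prop)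
      (ContinuousOn.inv₀ (by fun_prop) fun y hy => pow_ne_zero _ (hne y hy))

theorem tendsto_const_mul_inv_one_add_sq (K : ℝ) :
    Filter.Tendsto (fun y : ℝ => K * (1 + y ^ 2)⁻¹) Filter.atTop (nhds 0) := by
  rw [← mul_zero K]
  refine (Filter.Tendsto.comp tendsto_inv_atTop_zero ?_).const_mul K
  exact Filter.tendsto_atTop_add_const_left _ _ (Filter.tendsto_pow_atTop two_ne_zero)

theorem integral_rayDeriv {τ : ℝ} (hτ : -(1 / 2) ≤ Real.cos τ) {α : ℝ} (hα : 0 ≤ α) {n : ℕ}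
    (hn : α + 2 ≤ n) : ∫ y : ℝ in Set.Ioi 0, rayDeriv α n τ y = 0 := by
  have hInt : IntegrableOn (rayDeriv α n τ) (Set.Ioi 0) := by
    refine Integrable.mono' (integrable_inv_one_add_sq.const_mul
      ((α + 1) * 2 ^ (n + 1) + (n + 1) * 2 ^ (n + 2))).integrableOn ?_ ?_
    · exact (continuousOn_rayDeriv hτ hα n).aestronglyMeasurable measurableSet_Ioi
    · exact (ae_restrict_mem measurableSet_Ioi).mono fun y hy => norm_rayDeriv_le hτ hα hn hy
  have hlim : Filter.Tendsto (fun y : ℝ => ((y ^ (α + 1) : ℝ) : ℂ) *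
      ((1 + Complex.exp (τ * Complex.I) * y) ^ (n + 1))⁻¹) Filter.atTop (nhds 0) := by
    refine squeeze_zero_norm' ?_ (tendsto_const_mul_inv_one_add_sq (2 ^ (n + 1)))
    filter_upwards [Filter.eventually_ge_atTop 0] with y hy
    exact norm_rpow_mul_inv_pow_le hτ hy (by linarith) (by push_cast; linarith)
  rw [integral_Ioi_of_hasDerivAt_of_tendsto
    ((continuousOn_ray hτ (by linarith : 0 ≤ α + 1) (n + 1)) 0 Set.self_mem_Ici)
    (fun y hy => hasDerivAt_ray hτ α n hy) hInt hlim, Real.zero_rpow (by linarith)]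
  simp

/-- The integral of `y ^ α / (1 + e^{iτ} y) ^ (n + 1)` over the half line, times `e^{i(α + 1)τ}`. -/
def rayIntegral (α : ℝ) (n : ℕ) (τ : ℝ) : ℂ :=
  ∫ y : ℝ in Set.Ioi 0, Complex.exp (((α + 1) * τ : ℝ) * Complex.I) *
    (((y ^ α : ℝ) : ℂ) * ((1 + Complex.exp (τ * Complex.I) * y) ^ (n + 1))⁻¹)

/-- This open interval contains `[0, π / 2]` and stays away from the pole direction `τ = π`, so the
integrands have a common majorant while the ray is rotated. -/
theorem neg_half_le_cos {τ : ℝ} (hτ : τ ∈ Set.Ioo (-(2 * Real.pi / 3)) (2 * Real.pi / 3)) :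
    -(1 / 2) ≤ Real.cos τ := by
  have hpi := Real.pi_pos
  have h : Real.cos (2 * Real.pi / 3) = -(1 / 2) := by
    rw [show 2 * Real.pi / 3 = Real.pi - Real.pi / 3 by ring, Real.cos_pi_sub, Real.cos_pi_div_three]
  rw [← h, ← Real.cos_abs τ]
  exact Real.cos_le_cos_of_nonneg_of_le_pi (abs_nonneg τ) (by linarith) (abs_lt.2 hτ).le

/-- A substitute for Cauchy's theorem: the `τ`-derivative of the integrand is `i e^{i(α + 1)τ}`
times the `y`-derivative of `y ^ (α + 1) / (1 + e^{iτ} y) ^ (n + 1)`, which vanishes at both ends.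
-/
theorem hasDerivAt_rayIntegral {α : ℝ} (hα : 0 ≤ α) {n : ℕ} (hn : α + 2 ≤ n) {τ : ℝ}
    (hτ : τ ∈ Set.Ioo (-(2 * Real.pi / 3)) (2 * Real.pi / 3)) :
    HasDerivAt (rayIntegral α n) 0 τ := by
  have key := hasDerivAt_integral_of_dominated_loc_of_deriv_le (μ := volume.restrict (Set.Ioi 0))
    (F := fun (τ : ℝ) (y : ℝ) => Complex.exp (((α + 1) * τ : ℝ) * Complex.I) *
      (((y ^ α : ℝ) : ℂ) * ((1 + Complex.exp (τ * Complex.I) * y) ^ (n + 1))⁻¹))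
    (F' := fun τ y => Complex.exp (((α + 1) * τ : ℝ) * Complex.I) * Complex.I * rayDeriv α n τ y)
    (bound := fun y => ((α + 1) * 2 ^ (n + 1) + (n + 1) * 2 ^ (n + 2)) * (1 + y ^ 2)⁻¹)
    (Ioo_mem_nhds hτ.1 hτ.2) ?_ ?_ ?_ ?_ ?_ ?_
  · have h := key.2
    rw [integral_const_mul, integral_rayDeriv (neg_half_le_cos hτ) hα hn, mul_zero] at h
    exact h
  · filter_upwards [Ioo_mem_nhds hτ.1 hτ.2] with τ' hτ'
    exact (integrableOn_ray (neg_half_le_cos hτ') hα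
      (by push_cast; linarith)).aestronglyMeasurable.const_mul _
  · exact (integrableOn_ray (neg_half_le_cos hτ) hα (by push_cast; linarith)).const_mul _
  · exact ((continuousOn_rayDeriv (neg_half_le_cos hτ) hα n).aestronglyMeasurable
      measurableSet_Ioi).const_mul _
  · refine (ae_restrict_mem measurableSet_Ioi).mono fun y hy τ' hτ' => ?_
    rw [norm_mul, norm_mul, Complex.norm_exp_ofReal_mul_I, Complex.norm_I, one_mul, one_mul]
    exact norm_rayDeriv_le (neg_half_le_cos hτ') hα hn hy
  · exact (integrable_inv_one_add_sq.const_mul _).integrableOn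
  · refine (ae_restrict_mem measurableSet_Ioi).mono fun y hy τ' hτ' => ?_
    have hne := one_add_exp_mul_ne_zero (neg_half_le_cos hτ') (le_of_lt (Set.mem_Ioi.1 hy))
    have h1 : HasDerivAt (fun τ : ℝ => Complex.exp (((α + 1) * τ : ℝ) * Complex.I))
        (Complex.exp (((α + 1) * τ' : ℝ) * Complex.I) * ((α + 1) * Complex.I)) τ' := by
      have := (((hasDerivAt_id τ').const_mul (α + 1)).ofReal_comp.mul_const Complex.I).cexp
      simpa using this
    have h2 : HasDerivAt (fun τ : ℝ => 1 + Complex.exp (τ * Complex.I) * y)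
        (Complex.exp (τ' * Complex.I) * Complex.I * y) τ' := by
      have := ((((hasDerivAt_id τ').ofReal_comp.mul_const Complex.I).cexp).mul_const
        (y : ℂ)).const_add 1
      simpa using this
    have h3 := ((h2.pow (n + 1)).inv (pow_ne_zero _ hne)).const_mul ((y ^ α : ℝ) : ℂ)
    refine (h1.mul h3).congr_deriv ?_
    rw [rayDeriv]
    push_cast
    simp only [Pi.pow_apply, Pi.inv_apply]
    field_simp
    ring

theorem rayIntegral_eq {α : ℝ} (hα : 0 ≤ α) {n : ℕ} (hn : α + 2 ≤ n) :
    rayIntegral α n (Real.pi / 2) = rayIntegral α n 0 := by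
  have hpi := Real.pi_pos
  have h := Convex.norm_image_sub_le_of_norm_hasDerivWithin_le
    (s := Set.Ioo (-(2 * Real.pi / 3)) (2 * Real.pi / 3)) (x := 0) (y := Real.pi / 2) (C := 0)
    (fun τ hτ => (hasDerivAt_rayIntegral hα hn hτ).hasDerivWithinAt) (fun τ _ => by simp)
    (convex_Ioo _ _) ⟨by linarith, by linarith⟩ ⟨by linarith, by linarith⟩
  rw [zero_mul] at h
  exact sub_eq_zero.1 (norm_le_zero_iff.1 h)

theorem rayIntegral_zero_pos {α : ℝ} (hα : 0 ≤ α) {n : ℕ} (hn : α + 2 ≤ n) :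
    ∃ P : ℝ, 0 < P ∧ rayIntegral α n 0 = P := by
  have e : ∀ y : ℝ, Complex.exp (((α + 1) * 0 : ℝ) * Complex.I) * (((y ^ α : ℝ) : ℂ) *
      ((1 + Complex.exp ((0 : ℝ) * Complex.I) * y) ^ (n + 1))⁻¹) =
      ((y ^ α * ((1 + y) ^ (n + 1))⁻¹ : ℝ) : ℂ) := fun y => by simp
  refine ⟨∫ y : ℝ in Set.Ioi 0, y ^ α * ((1 + y) ^ (n + 1))⁻¹, ?_, ?_⟩
  · have hi := integrableOn_ray (τ := 0) (by rw [Real.cos_zero]; norm_num) hα (q := n + 1)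
      (by push_cast; linarith)
    have hi' : IntegrableOn (fun y : ℝ => y ^ α * ((1 + y) ^ (n + 1))⁻¹) (Set.Ioi 0) := by
      have := hi.re
      refine this.congr (Filter.Eventually.of_forall fun y => ?_)
      have e' := e y
      simp only [mul_zero, Complex.ofReal_zero, zero_mul, Complex.exp_zero, one_mul] at e'
      simp only [Complex.ofReal_zero, zero_mul, Complex.exp_zero, one_mul]
      rw [e']
      exact Complex.ofReal_re _
    rw [setIntegral_pos_iff_support_of_nonneg_ae ?_ hi']
    · have : Set.Ioi (0 : ℝ) ⊆
          Function.support (fun y : ℝ => y ^ α * ((1 + y) ^ (n + 1))⁻¹) ∩ Set.Ioi 0 := by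
        intro y hy
        have hy' : 0 < y := hy
        refine ⟨?_, hy⟩
        have : 0 < y ^ α * ((1 + y) ^ (n + 1))⁻¹ := by positivity
        exact this.ne'
      refine lt_of_lt_of_le ?_ (measure_mono this)
      simp
    · refine (ae_restrict_mem measurableSet_Ioi).mono fun y hy => ?_
      have hy' : 0 < y := hy
      simp only [Pi.zero_apply]
      positivity
  · rw [rayIntegral, ← integral_complex_ofReal]
    exact integral_congr_ae (Filter.Eventually.of_forall e)

/-- The kernel `(1 + i y)^{-(n+1)}`. -/
def kernel (n : ℕ) (y : ℝ) : ℂ := ((1 + Complex.I * y) ^ (n + 1))⁻¹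

theorem kernel_neg (n : ℕ) (y : ℝ) : kernel n (-y) = (starRingEnd ℂ) (kernel n y) := by
  simp [kernel]

theorem continuous_kernel (n : ℕ) : Continuous (kernel n) := by
  refine Continuous.inv₀ (by fun_prop) fun y => pow_ne_zero _ fun h => ?_
  simpa using congrArg Complex.re h

theorem abs_rpow_mul_norm_kernel_le {β : ℝ} (hβ : 0 ≤ β) {n : ℕ} (hn : β + 1 ≤ n) (y : ℝ) :
    |y| ^ β * ‖kernel n y‖ ≤ 2 ^ (n + 1) * (1 + y ^ 2)⁻¹ := by
  have h : ∀ y : ℝ, 0 ≤ y → |y| ^ β * ‖kernel n y‖ ≤ 2 ^ (n + 1) * (1 + y ^ 2)⁻¹ := by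
    intro y hy
    have := rpow_mul_inv_pow_le (τ := Real.pi / 2) (by rw [Real.cos_pi_div_two]; norm_num) hy hβ
      (q := n + 1) (by push_cast; linarith)
    rw [abs_of_nonneg hy, kernel, norm_inv, norm_pow]
    have e : Complex.exp ((Real.pi / 2 : ℝ) * Complex.I) = Complex.I := by
      push_cast
      exact Complex.exp_pi_div_two_mul_I
    rwa [e] at this
  rcases le_total 0 y with hy | hy
  · exact h y hy
  · have := h (-y) (by linarith)
    rwa [kernel_neg, RCLike.norm_conj, abs_neg, neg_sq] at this

theorem integrable_abs_rpow_mul_kernel {β : ℝ} (hβ : 0 ≤ β) {n : ℕ} (hn : β + 1 ≤ n) :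
    Integrable fun y : ℝ => ((|y| ^ β : ℝ) : ℂ) * kernel n y := by
  refine (integrable_inv_one_add_sq.const_mul (2 ^ (n + 1))).mono' ?_
    (Filter.Eventually.of_forall fun y => ?_)
  · refine Continuous.aestronglyMeasurable (Continuous.mul ?_ (continuous_kernel n))
    exact Complex.continuous_ofReal.comp (continuous_abs.rpow_const fun _ => Or.inr hβ)
  · rw [norm_mul, Complex.norm_real, Real.norm_of_nonneg (by positivity)]
    exact abs_rpow_mul_norm_kernel_le hβ hn y

/-- Rotating the ray by `π / 2` shows that the half line integral is `e^{-i(α + 1)π/2} P` with `P >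
0`. The negative half line gives the complex conjugate, so the sum is `2 P cos ((α + 1) π / 2)`,
which for `α ≥ 0` vanishes only at even integers. -/
theorem integral_abs_rpow_mul_kernel_ne_zero {α : ℝ} (hα : 0 ≤ α) (hα2 : ∀ k : ℕ, α ≠ 2 * k) {n : ℕ}
    (hn : α + 2 ≤ n) : ∫ y : ℝ, ((|y| ^ α : ℝ) : ℂ) * kernel n y ≠ 0 := by
  set f : ℝ → ℂ := fun y => ((|y| ^ α : ℝ) : ℂ) * kernel n y with hf
  have hInt : Integrable f := integrable_abs_rpow_mul_kernel hα (by linarith)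
  set Jp := ∫ y : ℝ in Set.Ioi 0, f y with hJp
  obtain ⟨P, hP, hPe⟩ := rayIntegral_zero_pos hα hn
  rw [← rayIntegral_eq hα hn, rayIntegral, integral_const_mul] at hPe
  have hJ : Jp = Complex.exp ((-((α + 1) * (Real.pi / 2)) : ℝ) * Complex.I) * P := by
    have e : ∫ y : ℝ in Set.Ioi 0, (((y ^ α : ℝ) : ℂ) *
        ((1 + Complex.exp ((Real.pi / 2 : ℝ) * Complex.I) * y) ^ (n + 1))⁻¹) = Jp := by
      refine setIntegral_congr_fun measurableSet_Ioi fun y hy => ?_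
      have hy' : 0 < y := hy
      simp only [hf, kernel, abs_of_pos hy']
      push_cast
      rw [Complex.exp_pi_div_two_mul_I]
    rw [e] at hPe
    rw [← hPe, ← mul_assoc, ← Complex.exp_add]
    simp
  have hneg : ∫ y : ℝ in Set.Iic 0, f y = (starRingEnd ℂ) Jp := by
    rw [hJp, ← integral_conj, ← neg_zero, ← integral_comp_neg_Ioi, neg_zero]
    refine integral_congr_ae (Filter.Eventually.of_forall fun y => ?_)
    simp only [hf, abs_neg, kernel_neg, map_mul, Complex.conj_ofReal]
  rw [← intervalIntegral.integral_Iic_add_Ioi (b := 0) hInt.integrableOn hInt.integrableOn, hneg,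
    ← hJp, add_comm, Complex.add_conj, hJ, Complex.re_mul_ofReal, Complex.exp_ofReal_mul_I_re,
    Real.cos_neg]
  have hcos : Real.cos ((α + 1) * (Real.pi / 2)) ≠ 0 := by
    rw [Ne, Real.cos_eq_zero_iff]
    rintro ⟨k, hk⟩
    have hpi := Real.pi_pos
    have hk' : α = 2 * k := by
      have : (α + 1) * (Real.pi / 2) = (2 * k + 1) * (Real.pi / 2) := by rw [hk]; ring
      have := mul_right_cancel₀ (by positivity) this
      linarith
    have hk0 : 0 ≤ k := by
      have : (0 : ℝ) ≤ k := by linarith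
      exact_mod_cast this
    obtain ⟨l, rfl⟩ := Int.eq_ofNat_of_zero_le hk0
    exact hα2 l (by exact_mod_cast hk')
  exact_mod_cast mul_ne_zero two_ne_zero (mul_ne_zero hcos hP.ne')

/-! ### One-sided rapid decay excludes a singularity `|y| ^ α` -/

/-- `n ! / (ε + i y) ^ (n + 1)` is the integral of `ξ ^ n * exp (-(ε + i y) ξ)` over `ξ > 0`. By
Fubini only the Fourier transform of `R` on the positive half line enters, and its decay bounds the
pairing uniformly in `ε`. The orders `n` and `n + 2` together produce the integrable factor `(1 + ξ
^ 2)⁻¹`. -/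
theorem exists_norm_integral_inv_pow_le {R : ℝ → ℂ} (hR : Integrable R)
    (hdecay : ∀ p : ℕ, ∃ C : ℝ, ∀ ξ : ℝ, 0 < ξ →
      ξ ^ p * ‖∫ y : ℝ, R y * Complex.exp (-(Complex.I * y * ξ))‖ ≤ C) (n : ℕ) :
    ∃ B : ℝ, 0 ≤ B ∧ ∀ ε : ℝ, 0 < ε → ‖∫ y : ℝ, R y * ((ε + Complex.I * y) ^ (n + 1))⁻¹‖ ≤ B := by
  obtain ⟨C₁, hC₁⟩ := hdecay n
  obtain ⟨C₂, hC₂⟩ := hdecay (n + 2)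
  set W := ∫ ξ : ℝ in Set.Ioi 0, (|C₁| + |C₂|) * (1 + ξ ^ 2)⁻¹ with hW
  have hfac : (0 : ℝ) < n ! := by exact_mod_cast Nat.factorial_pos n
  have hW0 : 0 ≤ W := integral_nonneg fun ξ => by positivity
  refine ⟨W / n !, by positivity, fun ε hε => ?_⟩
  have hker : ∀ y : ℝ, ((n ! : ℝ) : ℂ) * (R y * ((ε + Complex.I * y) ^ (n + 1))⁻¹) =
      ∫ ξ : ℝ in Set.Ioi 0, R y * ((ξ : ℂ) ^ n * Complex.exp (-((ε + Complex.I * y) * ξ))) := by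
    intro y
    rw [integral_const_mul, integral_pow_mul_exp (by simpa using hε)]
    push_cast
    ring
  have hprod : Integrable (Function.uncurry fun (y ξ : ℝ) =>
      R y * ((ξ : ℂ) ^ n * Complex.exp (-((ε + Complex.I * y) * ξ))))
      (volume.prod (volume.restrict (Set.Ioi 0))) := by
    have h := hR.mul_prod (integrableOn_pow_mul_exp (z := ε) (by simpa using hε) n)
    refine h.mono ?_ (Filter.Eventually.of_forall fun ⟨y, ξ⟩ => le_of_eq ?_)
    · refine (hR.aestronglyMeasurable.comp_fst).mul (Continuous.aestronglyMeasurable ?_)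
      fun_prop
    · simp only [Function.uncurry, norm_mul, Complex.norm_exp]
      simp
  have hswap := integral_integral_swap hprod
  simp_rw [← hker] at hswap
  rw [integral_const_mul] at hswap
  have hnorm : (n ! : ℝ) * ‖∫ y : ℝ, R y * ((ε + Complex.I * y) ^ (n + 1))⁻¹‖ ≤ W := by
    rw [← Real.norm_of_nonneg hfac.le, ← Complex.norm_real, ← norm_mul, hswap]
    refine norm_integral_le_of_norm_le
      (integrable_inv_one_add_sq.const_mul (|C₁| + |C₂|)).integrableOn ?_
    refine (ae_restrict_mem measurableSet_Ioi).mono fun ξ hξ => ?_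
    have hξ' : 0 < ξ := hξ
    have e : ∀ y : ℝ, R y * ((ξ : ℂ) ^ n * Complex.exp (-((ε + Complex.I * y) * ξ))) =
        ((ξ : ℂ) ^ n * Complex.exp ((-(ε * ξ) : ℝ))) *
          (R y * Complex.exp (-(Complex.I * y * ξ))) := by
      intro y
      rw [show -((ε + Complex.I * y) * ξ) = ((-(ε * ξ) : ℝ) : ℂ) + -(Complex.I * y * ξ) by
        push_cast; ring, Complex.exp_add]
      ring
    simp_rw [e]
    rw [integral_const_mul, norm_mul, norm_mul, norm_pow, Complex.norm_real,
      Real.norm_of_nonneg hξ'.le, Complex.norm_exp, Complex.ofReal_re]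
    set V := ‖∫ y : ℝ, R y * Complex.exp (-(Complex.I * y * ξ))‖
    have h1 := (hC₁ ξ hξ').trans (le_abs_self _)
    have h2 := (hC₂ ξ hξ').trans (le_abs_self _)
    have h3 : Real.exp (-(ε * ξ)) ≤ 1 := Real.exp_le_one_iff.2 (by nlinarith)
    have hV : 0 ≤ V := norm_nonneg _
    rw [← div_eq_mul_inv, le_div_iff₀ (by positivity)]
    calc ξ ^ n * Real.exp (-(ε * ξ)) * V * (1 + ξ ^ 2) ≤ ξ ^ n * 1 * V * (1 + ξ ^ 2) := by gcongr
      _ = ξ ^ n * V + ξ ^ (n + 2) * V := by ring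
      _ ≤ _ := add_le_add h1 h2
  rw [le_div_iff₀ hfac]
  linarith

theorem exists_norm_integral_kernel_le {R : ℝ → ℂ} (hR : Integrable R)
    (hdecay : ∀ p : ℕ, ∃ C : ℝ, ∀ ξ : ℝ, 0 < ξ →
      ξ ^ p * ‖∫ y : ℝ, R y * Complex.exp (-(Complex.I * y * ξ))‖ ≤ C) (n : ℕ) :
    ∃ B : ℝ, 0 ≤ B ∧ ∀ ε : ℝ, 0 < ε → ‖∫ y : ℝ, R (ε * y) * kernel n y‖ ≤ B * ε ^ n := by
  obtain ⟨B, hB0, hB⟩ := exists_norm_integral_inv_pow_le hR hdecay n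
  refine ⟨B, hB0, fun ε hε => ?_⟩
  have hε' : (ε : ℂ) ≠ 0 := by exact_mod_cast hε.ne'
  have h := Measure.integral_comp_mul_left
    (fun y : ℝ => R y * ((ε + Complex.I * y) ^ (n + 1))⁻¹) ε
  have e : ∀ y : ℝ, R (ε * y) * ((ε + Complex.I * (ε * y : ℝ)) ^ (n + 1))⁻¹ =
      ((ε : ℂ) ^ (n + 1))⁻¹ * (R (ε * y) * kernel n y) := by
    intro y
    rw [kernel, show (ε : ℂ) + Complex.I * (ε * y : ℝ) = ε * (1 + Complex.I * y) by
      push_cast; ring, mul_pow, mul_inv]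
    ring
  simp_rw [e] at h
  rw [integral_const_mul] at h
  have h2 := congrArg norm h
  rw [norm_mul, norm_smul, norm_inv, norm_pow, Complex.norm_real, Real.norm_of_nonneg hε.le,
    Real.norm_eq_abs, abs_abs, abs_of_pos (by positivity), inv_mul_eq_iff_eq_mul₀ (by positivity)]
    at h2
  rw [h2]
  calc ε ^ (n + 1) * (ε⁻¹ * _) ≤ ε ^ (n + 1) * (ε⁻¹ * B) := by
        gcongr
        exact hB ε hε
    _ = _ := by rw [pow_succ]; field_simp

/-- Pairing `R (ε * y)` with the kernel gives `O(ε ^ n)` by one-sided decay, but `b * J * ε ^ α +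
O(ε ^ (α + 1))` by the expansion at the origin, with `J ≠ 0`. Dividing by `ε ^ α` and letting `ε →
0` leaves `b * J = 0`. -/
theorem eq_zero_of_one_sided_decay {R : ℝ → ℂ} (hRc : Continuous R) (hR : Integrable R)
    (hdecay : ∀ p : ℕ, ∃ C : ℝ, ∀ ξ : ℝ, 0 < ξ →
      ξ ^ p * ‖∫ y : ℝ, R y * Complex.exp (-(Complex.I * y * ξ))‖ ≤ C)
    {α : ℝ} (hα : 0 ≤ α) (hα2 : ∀ k : ℕ, α ≠ 2 * k) {b : ℂ} {D : ℝ} (hD : 0 ≤ D)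
    (hb : ∀ y : ℝ, ‖R y - b * (|y| ^ α : ℝ)‖ ≤ D * |y| ^ (α + 1)) : b = 0 := by
  -- Large enough that `|y| ^ (α + 1)` times the kernel is integrable and that `ε ^ n ≤ ε ^ (α + 1)`
  -- for `ε ≤ 1`.
  set n := ⌈α⌉₊ + 2 with hn
  have hnα : α + 2 ≤ n := by
    rw [hn]
    push_cast
    linarith [Nat.le_ceil α]
  obtain ⟨B, hB0, hB⟩ := exists_norm_integral_kernel_le hR hdecay n
  set J := ∫ y : ℝ, ((|y| ^ α : ℝ) : ℂ) * kernel n y with hJ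
  have hJ0 : J ≠ 0 := integral_abs_rpow_mul_kernel_ne_zero hα hα2 hnα
  have hJi := integrable_abs_rpow_mul_kernel hα (n := n) (by linarith)
  set W := ∫ y : ℝ, D * (2 ^ (n + 1) * (1 + y ^ 2)⁻¹) with hW
  have hW0 : 0 ≤ W := integral_nonneg fun y => by positivity
  have hmain : ∀ ε : ℝ, 0 < ε → ε ≤ 1 → ‖b * J‖ ≤ (B + W) * ε := by
    intro ε hε hε1
    set E : ℝ → ℂ := fun y => (R (ε * y) - b * (|ε * y| ^ α : ℝ)) * kernel n y with hE
    have hEb : ∀ y, ‖E y‖ ≤ ε ^ (α + 1) * (D * (2 ^ (n + 1) * (1 + y ^ 2)⁻¹)) := by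
      intro y
      rw [hE]
      simp only
      rw [norm_mul]
      have h1 := hb (ε * y)
      rw [abs_mul ε y, Real.mul_rpow (abs_nonneg ε) (abs_nonneg y) (z := α + 1), abs_of_pos hε]
        at h1
      have h2 := abs_rpow_mul_norm_kernel_le (β := α + 1) (by linarith) (n := n) (by linarith) y
      rw [abs_mul, abs_of_pos hε]
      calc _ ≤ D * (ε ^ (α + 1) * |y| ^ (α + 1)) * ‖kernel n y‖ := by gcongr
        _ = ε ^ (α + 1) * (D * (|y| ^ (α + 1) * ‖kernel n y‖)) := by ring
        _ ≤ _ := by gcongr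
    have hbi : Integrable fun y : ℝ => ε ^ (α + 1) * (D * (2 ^ (n + 1) * (1 + y ^ 2)⁻¹)) :=
      ((integrable_inv_one_add_sq.const_mul _).const_mul _).const_mul _
    have hEi : Integrable E := by
      refine hbi.mono' (Continuous.aestronglyMeasurable ?_) (Filter.Eventually.of_forall hEb)
      refine Continuous.mul (Continuous.sub (by fun_prop) (continuous_const.mul ?_))
        (continuous_kernel n)
      exact Complex.continuous_ofReal.comp
        ((continuous_abs.comp (continuous_const.mul continuous_id)).rpow_const
          fun _ => Or.inr hα)
    have hEW : ‖∫ y, E y‖ ≤ ε ^ (α + 1) * W := by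
      refine (norm_integral_le_of_norm_le hbi (Filter.Eventually.of_forall hEb)).trans (le_of_eq ?_)
      rw [integral_const_mul]
    have hsplit : ∫ y : ℝ, R (ε * y) * kernel n y = (∫ y, E y) + (b * (ε ^ α : ℝ)) * J := by
      rw [hJ, ← integral_const_mul, ← integral_add hEi (hJi.const_mul _)]
      refine integral_congr_ae (Filter.Eventually.of_forall fun y => ?_)
      simp only [hE]
      rw [abs_mul, abs_of_pos hε, Real.mul_rpow hε.le (abs_nonneg y)]
      push_cast
      ring
    have h3 : ‖(b * (ε ^ α : ℝ)) * J‖ ≤ B * ε ^ n + ε ^ (α + 1) * W := by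
      rw [eq_sub_of_add_eq' hsplit.symm]
      exact (norm_sub_le _ _).trans (add_le_add (hB ε hε) hEW)
    have h4 : ε ^ n ≤ ε ^ (α + 1) := by
      rw [← Real.rpow_natCast]
      exact Real.rpow_le_rpow_of_exponent_ge hε hε1 (by linarith)
    have h5 : ‖(b * (ε ^ α : ℝ)) * J‖ = ε ^ α * ‖b * J‖ := by
      rw [norm_mul, norm_mul, norm_mul, Complex.norm_real, Real.norm_of_nonneg (by positivity)]
      ring
    rw [h5] at h3
    have h6 : ε ^ α * ‖b * J‖ ≤ ε ^ α * ((B + W) * ε) := by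
      calc _ ≤ B * ε ^ n + ε ^ (α + 1) * W := h3
        _ ≤ B * ε ^ (α + 1) + ε ^ (α + 1) * W := by gcongr
        _ = _ := by rw [Real.rpow_add_one hε.ne']; ring
    exact le_of_mul_le_mul_left h6 (by positivity)
  have hlim : Filter.Tendsto (fun ε : ℝ => (B + W) * ε) (nhdsWithin 0 (Set.Ioi 0)) (nhds 0) := by
    have : Filter.Tendsto (fun ε : ℝ => (B + W) * ε) (nhds 0) (nhds ((B + W) * 0)) :=
      (continuous_const.mul continuous_id).tendsto 0
    rw [mul_zero] at this
    exact this.mono_left nhdsWithin_le_nhds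
  have hle : ‖b * J‖ ≤ 0 := by
    refine ge_of_tendsto hlim ?_
    filter_upwards [Ioc_mem_nhdsGT one_pos] with ε hε
    exact hmain ε hε.1 hε.2
  exact (mul_eq_zero.1 (norm_le_zero_iff.1 hle)).resolve_right hJ0

/-! ### The singular points of the power chirp -/

/-- The reflection `y ↦ σ * y`, with `σ = ±1`, reduces both signs of the frequency to the positive
half line. -/
theorem norm_stft_oscillation_signed {t s : ℝ} (ht : 0 < t) (hs : 0 < s) (ψ : Space t s)
    (θ : ℝ → ℝ) (hθ : Continuous θ) {σ : ℝ} (hσ : σ * σ = 1) (x ξ : ℝ) :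
    ‖stft ht hs ψ (ofFunction t s (oscillation θ hθ)) x (σ * ξ)‖ = stftConst *
      ‖∫ y : ℝ, Complex.exp (Complex.I * θ (σ * y)) * (starRingEnd ℂ) ((ψ : ℝ → ℂ) (σ * y - x)) *
        Complex.exp (-(Complex.I * y * ξ))‖ := by
  have hσ1 : |σ⁻¹| = 1 := by
    rcases mul_self_eq_one_iff.1 hσ with rfl | rfl <;> simp
  have h := Measure.integral_comp_mul_left (fun y : ℝ => Complex.exp (Complex.I * θ y) *
    (starRingEnd ℂ) (Complex.exp (Complex.I * (y * (σ * ξ) : ℝ)) * (ψ : ℝ → ℂ) (y - x))) σ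
  rw [hσ1, one_smul] at h
  rw [stft_oscillation, ← h, norm_mul, Complex.norm_real, Real.norm_of_nonneg stftConst_pos.le]
  congr 3
  funext y
  have e : σ * y * (σ * ξ) = y * ξ := by linear_combination (y * ξ) * hσ
  rw [e, map_mul, ← Complex.exp_conj, map_mul, Complex.conj_I, Complex.conj_ofReal]
  push_cast
  ring_nf

/-- The vertical bound is used at `μ = 1`: it already contains decay like `exp (-2 * k ^ s⁻¹)` on
the line over any `x`, which beats every power. Below `L * κ` the trivial bound applies. -/
theorem exists_pow_mul_norm_le_of_decaysNear {t s : ℝ} {ht : 0 < t} {hs : 0 < s} {ψ : Space t s}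
    {θ : ℝ → ℝ} {hθ : Continuous θ} {σ κ : ℝ} (hσ : σ * σ = 1) (hκ : 0 < κ)
    (h : DecaysNear ht hs ψ (ofFunction t s (oscillation θ hθ)) (0, σ * κ)) (x : ℝ) (p : ℕ) :
    ∃ C : ℝ, ∀ ξ : ℝ, 0 < ξ → ξ ^ p *
      ‖∫ y : ℝ, Complex.exp (Complex.I * θ (σ * y)) * (starRingEnd ℂ) ((ψ : ℝ → ℂ) (σ * y - x)) *
        Complex.exp (-(Complex.I * y * ξ))‖ ≤ C := by
  obtain ⟨L, hL, C, hC⟩ := exists_vertical_bound h x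
  obtain ⟨K, hK0, hK⟩ := exists_rpow_le_exp (p := s * p) (by positivity) two_pos
  have hc := stftConst_pos
  set I := stftConst * ∫ y : ℝ, ‖(ψ : ℝ → ℂ) y‖ with hI
  have hI0 : 0 ≤ I := mul_nonneg hc.le (integral_nonneg fun y => norm_nonneg _)
  refine ⟨(κ ^ p * (K * |C|) + (L * κ) ^ p * I) / stftConst, fun ξ hξ => ?_⟩
  rw [le_div_iff₀ hc, mul_assoc, mul_comm _ stftConst, ← norm_stft_oscillation_signed ht hs ψ θ hθ hσ]
  set V := ‖stft ht hs ψ (ofFunction t s (oscillation θ hθ)) x (σ * ξ)‖ with hV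
  have hV0 : 0 ≤ V := norm_nonneg _
  rcases lt_or_ge ξ (L * κ) with hlt | hge
  · refine le_add_of_nonneg_of_le (by positivity) ?_
    exact mul_le_mul (by gcongr) (norm_stft_oscillation_le ht hs ψ θ hθ x _) hV0 (by positivity)
  · refine le_add_of_le_of_nonneg ?_ (by positivity)
    set k := ξ / κ with hk
    have hkL : L ≤ k := (le_div_iff₀ hκ).2 hge
    have hk0 : 0 < k := by positivity
    have hξk : ξ = κ * k := by rw [hk]; field_simp
    have h1 := hC 1 one_pos k hkL
    rw [Real.one_rpow, Real.one_rpow, one_mul, one_mul, one_mul,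
      show k * (σ * κ) = σ * ξ by rw [hξk]; ring] at h1
    have h2 := hK (k ^ s⁻¹) (by positivity)
    rw [← Real.rpow_mul hk0.le, inv_mul_cancel_left₀ hs.ne', Real.rpow_natCast] at h2
    calc ξ ^ p * V = κ ^ p * (k ^ p * V) := by rw [hξk, mul_pow]; ring
      _ ≤ κ ^ p * (K * Real.exp (2 * k ^ s⁻¹) * V) := by gcongr
      _ = κ ^ p * (K * (Real.exp (2 * k ^ s⁻¹) * V)) := by ring
      _ ≤ _ := by
          gcongr
          exact h1.trans (le_abs_self C)

/-- The constant `1` has slope `0`, so it is regular at every nonzero frequency. It is subtracted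
from the chirp to isolate the singularity `|y| ^ α`. -/
theorem decaysNear_one {t s : ℝ} (ht : 0 < t) (hs0 : 0 < s) (hs : 1 < s) (ψ : Space t s)
    {ξ₀ : ℝ} (hξ₀ : ξ₀ ≠ 0) :
    DecaysNear ht hs0 ψ (ofFunction t s (oscillation (fun _ => 0) continuous_const)) (0, ξ₀) := by
  refine decaysNear_of_ne ht hs0 hs ψ (fun _ => 0) continuous_const (fun _ => 0) (by simp)
    (η := 1) (M := 0) (R := 1) one_pos one_pos (fun μ _ v _ => hasDerivAt_const _ _)
    contDiffOn_const (fun v _ j => ?_) hξ₀.symm (fun h => hξ₀ (congrArg Prod.snd h))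
  simp

theorem norm_exp_sub_one_sub_le (τ : ℝ) :
    ‖Complex.exp (Complex.I * τ) - 1 - Complex.I * τ‖ ≤ 2 * τ ^ 2 := by
  have hn : ‖Complex.I * (τ : ℂ)‖ = |τ| := by
    rw [norm_mul, Complex.norm_I, one_mul, Complex.norm_real, Real.norm_eq_abs]
  rcases le_total |τ| 1 with h | h
  · have := Complex.norm_exp_sub_one_sub_id_le (x := Complex.I * τ) (by rwa [hn])
    rw [hn, sq_abs] at this
    nlinarith [sq_nonneg τ]
  · have h1 := Real.norm_exp_I_mul_ofReal_sub_one_le (x := τ)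
    rw [Real.norm_eq_abs] at h1
    refine (norm_sub_le _ _).trans ?_
    rw [hn, ← sq_abs]
    nlinarith

theorem exists_bound_and_lipschitz {t s : ℝ} (ψ : Space t s) : ∃ G : ℝ, 0 ≤ G ∧
    (∀ y, ‖(ψ : ℝ → ℂ) y‖ ≤ G) ∧ ∀ y z, ‖(ψ : ℝ → ℂ) y - (ψ : ℝ → ℂ) z‖ ≤ G * |y - z| := by
  obtain ⟨C, hC0, hC⟩ := (bddAbove_ratio_iff t s one_pos ψ).1 (ψ.2.2 1 one_pos)
  refine ⟨C, hC0, fun y => by simpa using hC 0 0 y, fun y z => ?_⟩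
  refine Convex.norm_image_sub_le_of_norm_deriv_le (s := Set.univ)
    (fun w _ => (ψ.2.1.differentiable (by simp)).differentiableAt) (fun w _ => ?_) convex_univ
    (Set.mem_univ z) (Set.mem_univ y)
  simpa using hC 0 1 w

/-- For `|y| ≤ 1` this is Taylor's formula; the quadratic term is harmless because `2 * α ≥ α + 1`.
For `|y| ≥ 1` all terms are trivially dominated by `|y| ^ (α + 1)`. -/
theorem norm_remainder_le {g : ℝ → ℂ} {G c α : ℝ} (hG : 0 ≤ G) (hα : 1 < α) (hg : ∀ y, ‖g y‖ ≤ G)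
    (hgl : ∀ y, ‖g y - g 0‖ ≤ G * |y|) (y : ℝ) :
    ‖g y * (Complex.exp (Complex.I * (c * |y| ^ α : ℝ)) - 1) -
      (Complex.I * c * g 0) * (|y| ^ α : ℝ)‖ ≤
      (2 * G + 2 * G * c ^ 2 + G * |c|) * |y| ^ (α + 1) := by
  set τ := c * |y| ^ α with hτ
  have hy0 := abs_nonneg y
  have hP : 0 ≤ |y| ^ (α + 1) := by positivity
  rcases le_total |y| 1 with h | h
  · have e : g y * (Complex.exp (Complex.I * τ) - 1) - (Complex.I * c * g 0) * (|y| ^ α : ℝ) =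
        g y * (Complex.exp (Complex.I * τ) - 1 - Complex.I * τ) +
          Complex.I * τ * (g y - g 0) := by
      rw [hτ]; push_cast; ring
    have h1 : τ ^ 2 ≤ c ^ 2 * |y| ^ (α + 1) := by
      rw [hτ, mul_pow, ← Real.rpow_natCast (|y| ^ α), ← Real.rpow_mul hy0]
      exact mul_le_mul_of_nonneg_left (Real.rpow_le_rpow_of_exponent_ge' hy0 h (by linarith)
        (by push_cast; linarith)) (sq_nonneg c)
    have h2 : |τ| * |y| = |c| * |y| ^ (α + 1) := by
      rw [hτ, abs_mul, abs_of_nonneg (a := |y| ^ α) (by positivity), mul_assoc]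
      congr 1
      rcases hy0.eq_or_lt with h0 | h0
      · rw [← h0, mul_zero, Real.zero_rpow (by linarith)]
      · rw [Real.rpow_add_one h0.ne']
    rw [e]
    calc _ ≤ G * (2 * τ ^ 2) + |τ| * (G * |y|) := by
          refine (norm_add_le _ _).trans (add_le_add ?_ ?_)
          · rw [norm_mul]
            exact mul_le_mul (hg y) (norm_exp_sub_one_sub_le τ) (norm_nonneg _) hG
          · rw [norm_mul, norm_mul, Complex.norm_I, one_mul, Complex.norm_real, Real.norm_eq_abs]
            gcongr
            exact hgl y
      _ = 2 * G * τ ^ 2 + G * (|τ| * |y|) := by ring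
      _ ≤ 2 * G * (c ^ 2 * |y| ^ (α + 1)) + G * (|c| * |y| ^ (α + 1)) := by
          rw [h2]
          gcongr
      _ ≤ _ := by nlinarith [mul_nonneg hG hP]
  · have h1 : |y| ^ α ≤ |y| ^ (α + 1) := Real.rpow_le_rpow_of_exponent_le h (by linarith)
    have h2 : 1 ≤ |y| ^ (α + 1) := Real.one_le_rpow h (by linarith)
    have h3 : ‖Complex.exp (Complex.I * τ) - 1‖ ≤ 2 := by
      refine (norm_sub_le _ _).trans ?_
      rw [Complex.norm_exp_I_mul_ofReal, norm_one]
      norm_num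
    calc _ ≤ G * 2 + |c| * G * |y| ^ α := by
          refine (norm_sub_le _ _).trans (add_le_add ?_ ?_)
          · rw [norm_mul]
            exact mul_le_mul (hg y) h3 (norm_nonneg _) hG
          · rw [norm_mul, norm_mul, norm_mul, Complex.norm_I, one_mul, Complex.norm_real,
              Complex.norm_real, Real.norm_eq_abs, Real.norm_of_nonneg (by positivity)]
            gcongr
            exact hg 0
      _ ≤ G * 2 * |y| ^ (α + 1) + |c| * G * |y| ^ (α + 1) := by
          exact add_le_add (le_mul_of_one_le_right (by positivity) h2) (by gcongr)
      _ ≤ _ := by nlinarith [mul_nonneg (mul_nonneg hG (sq_nonneg c)) hP]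

theorem not_decaysNear_powerChirp {c α t : ℝ} (hc : c ≠ 0) (hα : 1 < α) (hα0 : 0 ≤ α)
    (hα2 : ∀ k : ℕ, α ≠ 2 * k) (ht : 0 < t) (hs0 : 0 < t * (α - 1)) (hs : 1 < t * (α - 1))
    {ψ : Space t (t * (α - 1))} (hψ : ψ ≠ 0) {ξ₀ : ℝ} (hξ₀ : ξ₀ ≠ 0) :
    ¬ DecaysNear ht hs0 ψ (ofFunction t _ (powerChirp c α hα0)) (0, ξ₀) := by
  intro hdec
  obtain ⟨σ, κ, hσ, hκ, rfl⟩ : ∃ σ κ : ℝ, σ * σ = 1 ∧ 0 < κ ∧ ξ₀ = σ * κ := by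
    rcases lt_or_gt_of_ne hξ₀ with h | h
    · exact ⟨-1, -ξ₀, by norm_num, by linarith, by ring⟩
    · exact ⟨1, ξ₀, by norm_num, h, by ring⟩
  have hσ1 : |σ| = 1 := by
    rcases mul_self_eq_one_iff.1 hσ with rfl | rfl <;> simp
  have hone := decaysNear_one ht hs0 hs ψ hξ₀
  obtain ⟨G, hG0, hG, hGl⟩ := exists_bound_and_lipschitz ψ
  refine hψ (Subtype.ext (funext fun x => ?_))
  -- The translation by `-x` puts the value of the window at `x` onto the singular point of the
  -- chirp: `g 0` is the conjugate of `ψ x`.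
  set g : ℝ → ℂ := fun y => (starRingEnd ℂ) ((ψ : ℝ → ℂ) (σ * y - -x)) with hg
  have hψc := ψ.2.1.continuous
  have hgc : Continuous g := by fun_prop
  have hσ0 : σ ≠ 0 := fun h => by simp [h] at hσ
  have hgi : Integrable g := by
    have h1 : Integrable fun y => (ψ : ℝ → ℂ) (σ * y - -x) :=
      ((integrable_coe ψ).comp_sub_right (-x)).comp_mul_left' hσ0
    exact h1.norm.mono' hgc.aestronglyMeasurable
      (Filter.Eventually.of_forall fun y => by rw [hg, RCLike.norm_conj])
  set u : ℝ → ℂ := fun y => Complex.exp (Complex.I * (c * |y| ^ α : ℝ)) with hu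
  have huc : Continuous u := by
    have : Continuous fun y : ℝ => |y| ^ α := continuous_abs.rpow_const fun _ => Or.inr hα0
    fun_prop
  have hun : ∀ y, ‖u y‖ = 1 := fun y => Complex.norm_exp_I_mul_ofReal _
  have hugi : Integrable fun y => u y * g y :=
    hgi.norm.mono' (huc.mul hgc).aestronglyMeasurable
      (Filter.Eventually.of_forall fun y => by rw [norm_mul, hun, one_mul])
  have hchar : ∀ {f : ℝ → ℂ} (ξ : ℝ), Integrable f →
      Integrable fun y : ℝ => f y * Complex.exp (-(Complex.I * y * ξ)) := by
    intro f ξ hf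
    refine hf.norm.mono' (hf.aestronglyMeasurable.mul
      (Continuous.aestronglyMeasurable (by fun_prop))) (Filter.Eventually.of_forall fun y => ?_)
    rw [norm_mul, show -(Complex.I * y * ξ) = Complex.I * ((-(y * ξ) : ℝ) : ℂ) by push_cast; ring,
      Complex.norm_exp_I_mul_ofReal, mul_one]
  have key : Complex.I * c * g 0 = 0 := by
    refine eq_zero_of_one_sided_decay (R := fun y => g y * (u y - 1)) (by fun_prop) ?_ ?_ hα0 hα2
      (D := 2 * G + 2 * G * c ^ 2 + G * |c|) (by positivity)
      (norm_remainder_le hG0 hα (fun y => ?_) (fun y => ?_))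
    · refine (hugi.sub hgi).congr (Filter.Eventually.of_forall fun y => ?_)
      simp only [Pi.sub_apply]
      ring
    · intro p
      obtain ⟨C₁, hC₁⟩ := exists_pow_mul_norm_le_of_decaysNear hσ hκ hdec (-x) p
      obtain ⟨C₂, hC₂⟩ := exists_pow_mul_norm_le_of_decaysNear hσ hκ hone (-x) p
      refine ⟨C₁ + C₂, fun ξ hξ => ?_⟩
      have h1 := hC₁ ξ hξ
      have h2 := hC₂ ξ hξ
      simp only [abs_mul, hσ1, one_mul] at h1
      simp only [Complex.ofReal_zero, mul_zero, Complex.exp_zero, one_mul] at h2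
      have e : ∫ y : ℝ, g y * (u y - 1) * Complex.exp (-(Complex.I * y * ξ)) =
          (∫ y : ℝ, u y * g y * Complex.exp (-(Complex.I * y * ξ))) -
            ∫ y : ℝ, g y * Complex.exp (-(Complex.I * y * ξ)) := by
        rw [← integral_sub (hchar ξ hugi) (hchar ξ hgi)]
        refine integral_congr_ae (Filter.Eventually.of_forall fun y => ?_)
        simp only
        ring
      rw [e]
      refine (mul_le_mul_of_nonneg_left (norm_sub_le _ _) (by positivity)).trans ?_
      rw [mul_add]
      exact add_le_add h1 h2
    · rw [hg, RCLike.norm_conj]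
      exact hG _
    · rw [hg]
      simp only
      rw [← map_sub, RCLike.norm_conj]
      refine (hGl _ _).trans (le_of_eq ?_)
      congr 1
      rw [mul_zero, sub_sub_sub_cancel_right, sub_zero, abs_mul, hσ1, one_mul]
  have hg0 : g 0 = 0 :=
    (mul_eq_zero.1 key).resolve_left (mul_ne_zero Complex.I_ne_zero (by exact_mod_cast hc))
  simpa [hg] using hg0

theorem one_lt_index {β t : ℝ} (hβ : 1 < β) (ht : 1 / (β - 1) < t) : 1 < t * (β - 1) :=
  (div_lt_iff₀ (sub_pos.2 hβ)).1 ht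

end GelfandShilov

end

/-! ### The wave front sets of the chirps -/

theorem theorem4p2 (c : ℝ) (hc : c ≠ 0) :
    (∀ (m : ℕ) (hm : 2 ≤ m) (t : ℝ) (ht : 1 / ((m : ℝ) - 1) < t)
      (ψ : GelfandShilov.Space t (t * ((m : ℝ) - 1))), ψ ≠ 0 →
      GelfandShilov.waveFrontSet
          (GelfandShilov.index_pos (Nat.one_lt_cast.2 hm) ht)
          (GelfandShilov.index_mul_pos (Nat.one_lt_cast.2 hm) ht) ψ
          (GelfandShilov.ofFunction t (t * ((m : ℝ) - 1)) (GelfandShilov.monomialChirp c m)) =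
        {p : ℝ × ℝ | ∃ x : ℝ, x ≠ 0 ∧ p = (x, c * m * x ^ (m - 1))}) ∧
    (∀ (α : ℝ) (hα : 1 < α), (∀ k : ℕ, α ≠ 2 * k) → ∀ (t : ℝ) (ht : 1 / (α - 1) < t)
      (ψ : GelfandShilov.Space t (t * (α - 1))), ψ ≠ 0 →
      {p : ℝ × ℝ | p.1 = 0 ∧ p.2 ≠ 0} ⊆
        GelfandShilov.waveFrontSet
          (GelfandShilov.index_pos hα ht) (GelfandShilov.index_mul_pos hα ht) ψ
          (GelfandShilov.ofFunction t (t * (α - 1))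
            (GelfandShilov.powerChirp c α (zero_le_one.trans hα.le))) ∧
      GelfandShilov.waveFrontSet
          (GelfandShilov.index_pos hα ht) (GelfandShilov.index_mul_pos hα ht) ψ
          (GelfandShilov.ofFunction t (t * (α - 1))
            (GelfandShilov.powerChirp c α (zero_le_one.trans hα.le))) ⊆
        {p : ℝ × ℝ | ∃ x : ℝ, x ≠ 0 ∧ p = (x, c * α * Real.sign x * |x| ^ (α - 1))} ∪
          {p : ℝ × ℝ | p.1 = 0 ∧ p.2 ≠ 0}) := by
  refine ⟨fun m hm t ht ψ hψ => ?_, fun α hα hα2 t ht ψ hψ => ⟨?_, ?_⟩⟩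
  · have hs : 1 < t * ((m : ℝ) - 1) := GelfandShilov.one_lt_index (Nat.one_lt_cast.2 hm) ht
    -- Since `m ≥ 2` the slope vanishes at `0`. Hence over `x = 0` the curve meets only the excluded
    -- origin, and `(0, ±1)` are regular points.
    have h0 : (0 : ℝ) = c * m * 0 ^ (m - 1) := by
      rw [zero_pow (by omega), mul_zero]
    ext ⟨x, ξ⟩
    rw [GelfandShilov.mem_waveFrontSet_iff]
    constructor
    · rintro ⟨hz, hdec⟩
      have hξ : ξ = c * m * x ^ (m - 1) := by
        by_contra hne
        exact hdec (GelfandShilov.decaysNear_monomialChirp hm _ _ hs ψ hne hz)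
      refine ⟨x, ?_, by rw [hξ]⟩
      rintro rfl
      exact hz (by rw [hξ, ← h0]; rfl)
    · rintro ⟨x', hx', h⟩
      obtain ⟨rfl, rfl⟩ := Prod.mk.inj h
      refine ⟨fun h => hx' (congrArg Prod.fst h), fun hdec => hψ ?_⟩
      refine GelfandShilov.eq_zero_of_decaysNear (ht := GelfandShilov.index_pos (Nat.one_lt_cast.2 hm) ht)
        (hs := zero_lt_one.trans hs) (x₀ := x) (fun ξ => ?_)
        (GelfandShilov.decaysNear_monomialChirp hm _ _ hs ψ (by rw [← h0]; norm_num) (by simp))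
        (GelfandShilov.decaysNear_monomialChirp hm _ _ hs ψ (by rw [← h0]; norm_num) (by simp))
      -- Only one point of the vertical line over `x` lies on the curve; there regularity is the
      -- assumption to be refuted, elsewhere it holds by non-stationary phase.
      by_cases hξ : ξ = c * m * x ^ (m - 1)
      · rw [hξ]
        exact hdec
      · exact GelfandShilov.decaysNear_monomialChirp hm _ _ hs ψ hξ fun h => hx' (congrArg Prod.fst h)
  · have hs : 1 < t * (α - 1) := GelfandShilov.one_lt_index hα ht
    rintro ⟨x, ξ⟩ ⟨hx, hξ⟩
    simp only at hx hξ
    subst hx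
    rw [GelfandShilov.mem_waveFrontSet_iff]
    exact ⟨fun h => hξ (congrArg Prod.snd h),
      GelfandShilov.not_decaysNear_powerChirp hc hα _ hα2 _ _ hs hψ hξ⟩
  · have hs : 1 < t * (α - 1) := GelfandShilov.one_lt_index hα ht
    rintro ⟨x, ξ⟩ hz
    rw [GelfandShilov.mem_waveFrontSet_iff] at hz
    obtain ⟨hz, hdec⟩ := hz
    by_cases hx : x = 0
    · subst hx
      exact Or.inr ⟨rfl, fun h => hz (by rw [show ξ = 0 from h]; rfl)⟩
    · refine Or.inl ⟨x, hx, ?_⟩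
      by_contra hne
      refine hdec (GelfandShilov.decaysNear_powerChirp hα _ _ _ hs ψ hx fun h => hne ?_)
      rw [h, GelfandShilov.powerSlope]
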